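/- **Setting.** Let $\alpha\in(0,2)$ and $a,b\in(0,\infty]$. Let $X_{12}$ be a complex and $X_{11}$ a real random variable with $$\lim_{t\to\infty}-t^{-\alpha}\log\mathbb P(|X_{12}|\ge t)=a,\qquad \lim_{t\to\infty}-t^{-\alpha}\log\mathbb P(|X_{11}|\ge t)=b .$$ Let $\vartheta_a,\vartheta_b$ be probability measures on the unit circle $\mathbb S^1$ such that, if $a<\infty$, there is $t_0>0$ with $\mathbb P(X_{12}/|X_{12}|\in U,\ |X_{12}|\ge t)=\vartheta_a(U)\,\mathbb P(|X_{12}|\ge t)$ for all $t\ge t_0$ and all measurable $U\subset\mathbb S^1$, and likewise for $X_{11},\vartheta_b$ if $b<\infty$. (If $a=\infty$ or $b=\infty$, the corresponding measure is arbitrary.) Let $S_a,S_b\subset\mathbb S^1$ be the supports of $\vartheta_a,\vartheta_b$. ($X_{12}$ and $X_{11}$ are an off-diagonal and a diagonal entry of a Wigner matrix $X$; the function $\Phi$ below governs the large deviations of the spectral measure of $X/\sqrt n$ at speed $n^{1+\alpha/2}$.) **Networks.** A *network* $G=(V,\omega)$ is a countable set $V$ with weights $\omega:V^2\to\mathbb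 C$ such that $\omega(u,v)=\overline{\omega(v,u)}$ and $\deg(v)=\sum_u|\omega(v,u)|^2<\infty$ for all $u,v$. The distance $D(u,v)$ is the infimum of $\big(\sum_{i=1}^k|\omega(u_{i-1},u_i)|^{-2}\big)^{1/2}$ over paths $u=u_0,\dots,u_k=v$ with nonzero weights. A *rooted network* $(G,o)$ is a network in which any two vertices are joined by such a path, with a distinguished vertex $o$; $\mathcal G_*$ is the set of rooted networks up to root-preserving isomorphism. Let $(G,o)_t$ be the subnetwork on $\{u:D(o,u)\le t\}$. The local topology on $\mathcal G_*$ is the one given by $d_{\rm loc}=1/(1+T)$, where $T$ is the supremum of the $t>0$ for which there is a root-preserving bijection between the vertex sets of $(G_1,o_1)_t$ and $(G_2,o_2)_t$ changing the weights by at most $1/t$: a set is open if it contains a $d_{\rm loc}$-ball around each of its points. $\mathcal P(\mathcal G_*)$ denotes the Borel probability measures on $\mathcal G_*$. **Admissible sofic measures.** For a hermitian $n\times n$ matrix $H$, viewed as a network on $\{1,\dots,n\}$ with weights $H_{ij}$, let $U(H)\in\mathcal P(\mathcal G_*)$ be the law of the class of the connected component of a uniformly chosen vertex, rooted at this vertex.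 Let $\mathcal A_n$ be the set of hermitian $n\times n$ matrices with $H_{ij}=0$ or $H_{ij}/|H_{ij}|\in S_a$ for $i<j$, and $H_{ii}=0$ or $H_{ii}/|H_{ii}|\in S_b$ for all $i$. Then $\mathcal P_s$ is the set of weak limits $\rho\in\mathcal P(\mathcal G_*)$, for the local topology, of sequences $U(H_n)$ with $H_n\in\mathcal A_n$, $n\ge 1$. **Spectral measures.** For $0<\theta<1$ and $x\ge 0$ put $\chi_\theta(x)=0\vee(1\wedge\frac{x-\theta}{\theta})$ and $\widetilde\chi_\theta(x)=0\vee(1\wedge(\theta^{-2}-x))$. The truncation $G_\theta$ of $G$ has the weights $\omega_\theta(u,v)=\widetilde\omega_\theta(u,v)\,\chi_\theta(|\widetilde\omega_\theta(u,v)|)$, where $\widetilde\omega_\theta(u,v)=\omega(u,v)\,\widetilde\chi_\theta(\deg(u)\vee\deg(v))$, and $g_\theta$ is the class of the component of the root in $G_\theta$. The weights of $g_\theta$ define a bounded self-adjoint operator $T$ on $\ell^2$ by $Te_v=\sum_u\omega_\theta(u,v)e_u$; its spectral measure $\mu_{g_\theta}$ at the root is the unique probability measure on $\mathbb R$ with moments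 $\langle e_o,T^ke_o\rangle$, $k\ge0$. For $\rho\in\mathcal P(\mathcal G_*)$ let $\mu_{\rho_\theta}=\mathbb E_\rho\,\mu_{g_\theta}$. For $\rho\in\mathcal P_s$, if $\mathbb E_\rho\sum_v|\omega(o,v)|^\beta<\infty$ for some $\beta\in(0,2)$, let $\mu_\rho$ be the weak limit of $\mu_{\rho_\theta}$ as $\theta\to0$; otherwise let $\mu_\rho=\delta_0$. **Rate function.** For $\rho\in\mathcal P_s$ let $$I(\rho)=b\,\mathbb E_\rho|\omega(o,o)|^\alpha+\frac a2\,\mathbb E_\rho\sum_{v\ne o}|\omega(o,v)|^\alpha\in[0,\infty],$$ with $\infty\cdot0=0$, and for a probability measure $\nu$ on $\mathbb R$ let $$\Phi(\nu)=\inf\{I(\rho):\rho\in\mathcal P_s,\ \mu_\rho=\nu\},\qquad m_\alpha(\nu)=\int|x|^\alpha\,d\nu(x)\in[0,\infty],\qquad \inf\emptyset=\infty .$$ **Theorem.** Suppose $S_b=\{+1\}$, and let $\nu$ be a probability measure on $\mathbb R$. (a) If $\operatorname{supp}\nu\subset[0,\infty)$, then $\Phi(\nu)\le b\,m_\alpha(\nu)$.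 (b) If $\alpha\in(1,2)$ and $\nu$ is symmetric, then $\Phi(\nu)=\frac a2\,m_\alpha(\nu)$. (c) If $\alpha\in(1,2)$ and $\int x\,d\nu(x)<0$ (the value $-\infty$ is allowed; that is, $\int x^+\,d\nu<\int x^-\,d\nu$), then $\Phi(\nu)=+\infty$. -/

import Mathlib

open MeasureTheory Filter Topology
open scoped ENNReal BoundedContinuousFunction

noncomputable section

namespace WignerLDP

/-! ### Tail assumptions on the entries -/

section Tails

variable {Ω : Type*} [MeasurableSpace Ω]

/-- `lim_{t → ∞} - t ^ (-α) * log P(|Y| ≥ t) = a` in `[-∞, ∞]`, with `log 0 = -∞`. -/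
def HasTail (P : Measure Ω) (Y : Ω → ℂ) (α : ℝ) (a : ℝ≥0∞) : Prop :=
  Tendsto (fun t : ℝ => -(((t ^ (-α) : ℝ) : EReal) * ENNReal.log (P {x | t ≤ ‖Y x‖})))
    atTop (𝓝 (a : EReal))

/-- For large values of `|Y|`, the phase `Y / |Y|` has law `ϑ` on the unit circle and is
independent of `|Y|`. -/
def HasAngularLaw (P : Measure Ω) (Y : Ω → ℂ) (ϑ : Measure (Metric.sphere (0 : ℂ) 1)) : Prop :=
  ∃ t₀ : ℝ, 0 < t₀ ∧ ∀ t : ℝ, t₀ ≤ t →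
    ∀ U : Set (Metric.sphere (0 : ℂ) 1), MeasurableSet U →
      P {x | Y x / (‖Y x‖ : ℂ) ∈ (Subtype.val '' U : Set ℂ) ∧ t ≤ ‖Y x‖}
        = ϑ U * P {x | t ≤ ‖Y x‖}

/-- The class `𝒮_α(a)`, `a ∈ (0, ∞]`, together with the angular law `ϑ` of `Y`. When `a = ∞` the
class only asks for the tail condition, and nothing is asked of `ϑ`. -/
def InTailClass (P : Measure Ω) (Y : Ω → ℂ) (α : ℝ) (a : ℝ≥0∞)
    (ϑ : Measure (Metric.sphere (0 : ℂ) 1)) : Prop :=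
  HasTail P Y α a ∧ (a ≠ ∞ → HasAngularLaw P Y ϑ)

end Tails

/-- The support of a measure on the unit circle, as a set of complex numbers. -/
def phaseSupport (ϑ : Measure (Metric.sphere (0 : ℂ) 1)) : Set ℂ := Subtype.val '' ϑ.support

/-! ### Networks -/

/-- Hermitian, locally finite networks on a countable vertex set, not necessarily connected. -/
structure Network : Type 1 where
  V : Type
  countable : Countable V
  ω : V → V → ℂ
  hermitian : ∀ u v, ω u v = star (ω v u)
  locallyFinite : ∀ v, Summable fun u => ‖ω v u‖ ^ 2

namespace Network

variable (G : Network)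

/-- The degree `∑_u |ω(v, u)|²`. -/
def deg (v : G.V) : ℝ := ∑' u, ‖G.ω v u‖ ^ 2

/-- Nonzero weight. -/
def Adj (u v : G.V) : Prop := G.ω u v ≠ 0

/-- There is a path (possibly of length zero) from `u` to `v` along edges of nonzero weight. -/
def Reachable (u v : G.V) : Prop := Relation.ReflTransGen G.Adj u v

/-- `p 0, …, p k` is a path from `u` to `v` along edges of nonzero weight. -/
def IsPath (u v : G.V) {k : ℕ} (p : Fin (k + 1) → G.V) : Prop :=
  p 0 = u ∧ p (Fin.last k) = v ∧ ∀ i : Fin k, G.Adj (p i.castSucc) (p i.succ)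

/-- The `ℓ²` length of a path, an edge of weight `w` having length `1 / |w|`. -/
def pathLength {k : ℕ} (p : Fin (k + 1) → G.V) : ℝ :=
  Real.sqrt (∑ i : Fin k, (‖G.ω (p i.castSucc) (p i.succ)‖ ^ 2)⁻¹)

/-- The distance between two vertices, infinite if no path joins them. -/
def dist (u v : G.V) : ℝ≥0∞ :=
  ⨅ (k : ℕ) (p : Fin (k + 1) → G.V) (_ : G.IsPath u v p), ENNReal.ofReal (G.pathLength p)

theorem adj_symm {u v : G.V} (h : G.Adj u v) : G.Adj v u := by
  unfold Adj at *
  intro h0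
  exact h (by rw [G.hermitian u v, h0, star_zero])

theorem reachable_symm {u v : G.V} (h : G.Reachable u v) : G.Reachable v u := by
  unfold Reachable at *
  induction h with
  | refl => exact Relation.ReflTransGen.refl
  | tail _ hbc ih => exact Relation.ReflTransGen.head (G.adj_symm hbc) ih

theorem reachable_map {G H : Network} (f : G.V → H.V) (hf : ∀ u v, H.ω (f u) (f v) = G.ω u v)
    {u v : G.V} (h : G.Reachable u v) : H.Reachable (f u) (f v) := by
  unfold Reachable at *
  induction h with
  | refl => exact Relation.ReflTransGen.refl
  | tail _ hbc ih =>
    refine Relation.ReflTransGen.tail ih ?_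
    unfold Adj at *
    rw [hf]
    exact hbc

end Network

/-- Connected rooted networks. -/
structure RootedNetwork : Type 1 extends Network where
  root : V
  connected : ∀ u v, toNetwork.Reachable u v

/-- The connected component `G(v)` of `v` in `G`, rooted at `v`. -/
def Network.component (G : Network) (v : G.V) : RootedNetwork where
  V := {u : G.V // G.Reachable v u}
  countable := by
    have := G.countable
    infer_instance
  ω := fun u w => G.ω u w
  hermitian := fun u w => G.hermitian u w
  locallyFinite := fun u => (G.locallyFinite u).comp_injective Subtype.val_injective
  root := ⟨v, Relation.ReflTransGen.refl⟩
  connected := by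
    let N : Network :=
      { V := {u : G.V // G.Reachable v u}
        countable := by
          have := G.countable
          infer_instance
        ω := fun u w => G.ω u w
        hermitian := fun u w => G.hermitian u w
        locallyFinite := fun u => (G.locallyFinite u).comp_injective Subtype.val_injective }
    have key : ∀ (w : G.V) (hw : G.Reachable v w),
        N.Reachable ⟨v, Relation.ReflTransGen.refl⟩ ⟨w, hw⟩ := by
      intro w hw
      induction hw with
      | refl => exact Relation.ReflTransGen.refl
      | tail hab hbc ih => exact Relation.ReflTransGen.tail ih hbc
    intro u w
    exact Relation.ReflTransGen.trans (N.reachable_symm (key u.1 u.2)) (key w.1 w.2)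

namespace RootedNetwork

/-- The vertex set of the neighbourhood `(G, o)_t`. -/
def ball (G : RootedNetwork) (t : ℝ) : Set G.V := {u | G.dist G.root u ≤ ENNReal.ofReal t}

theorem root_mem_ball (G : RootedNetwork) (t : ℝ) : G.root ∈ G.ball t := by
  have h : G.dist G.root G.root ≤ ENNReal.ofReal (G.pathLength (k := 0) (fun _ => G.root)) :=
    iInf_le_of_le 0 (iInf_le_of_le (fun _ => G.root)
      (iInf_le_of_le ⟨rfl, rfl, fun i => i.elim0⟩ le_rfl))
  refine h.trans ?_
  simp [Network.pathLength]

/-- The two neighbourhoods of radius `t` of the roots are matched by a bijection that preserves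
the root and changes the weights by at most `1 / t`. -/
def CloseAt (G H : RootedNetwork) (t : ℝ) : Prop :=
  ∃ σ : G.ball t ≃ H.ball t,
    σ ⟨G.root, G.root_mem_ball t⟩ = ⟨H.root, H.root_mem_ball t⟩ ∧
    ∀ u v : G.ball t, ‖G.ω u v - H.ω (σ u) (σ v)‖ ≤ 1 / t

/-- `d_loc = 1 / (1 + T)`, where `T ∈ [0, ∞]` is the supremum of the `t > 0` at which the two
networks are close. -/
def dloc (G H : RootedNetwork) : ℝ≥0∞ :=
  (1 + ⨆ (t : ℝ) (_ : 0 < t ∧ CloseAt G H t), ENNReal.ofReal t)⁻¹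

/-- Rooted isomorphism. -/
def Iso (G H : RootedNetwork) : Prop :=
  ∃ σ : G.V ≃ H.V, σ G.root = H.root ∧ ∀ u v, H.ω (σ u) (σ v) = G.ω u v

theorem Iso.symm {G H : RootedNetwork} (h : Iso G H) : Iso H G := by
  obtain ⟨σ, h0, h1⟩ := h
  refine ⟨σ.symm, by rw [← h0, Equiv.symm_apply_apply], fun u v => ?_⟩
  rw [← h1, Equiv.apply_symm_apply, Equiv.apply_symm_apply]

instance setoid : Setoid RootedNetwork where
  r := Iso
  iseqv :=
    { refl := fun _ => ⟨Equiv.refl _, rfl, fun _ _ => rfl⟩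
      symm := Iso.symm
      trans := by
        rintro G H K ⟨σ, h0, h1⟩ ⟨τ, k0, k1⟩
        exact ⟨σ.trans τ, by simp [h0, k0], fun u v => by simp [h1, k1]⟩ }

theorem dist_le_of_map {G H : Network} (f : G.V → H.V) (hf : ∀ u v, H.ω (f u) (f v) = G.ω u v)
    (u v : G.V) : H.dist (f u) (f v) ≤ G.dist u v := by
  refine le_iInf fun k => le_iInf fun p => le_iInf fun hp => ?_
  have hlen : H.pathLength (fun i => f (p i)) = G.pathLength p := by
    simp [Network.pathLength, hf]
  rw [← hlen]
  refine iInf_le_of_le k (iInf_le_of_le (fun i => f (p i)) (iInf_le_of_le ?_ le_rfl))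
  refine ⟨congrArg f hp.1, congrArg f hp.2.1, fun i => ?_⟩
  have := hp.2.2 i
  simpa [Network.Adj, hf] using this

theorem mem_ball_of_map {G H : RootedNetwork} (f : G.V → H.V)
    (hf : ∀ u v, H.ω (f u) (f v) = G.ω u v) (h0 : f G.root = H.root) {t : ℝ} {u : G.V}
    (hu : u ∈ G.ball t) : f u ∈ H.ball t := by
  have h1 := dist_le_of_map f hf G.root u
  rw [h0] at h1
  exact h1.trans hu

theorem closeAt_of_iso {G G' H H' : RootedNetwork} (hG : Iso G G') (hH : Iso H H') {t : ℝ}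
    (h : CloseAt G H t) : CloseAt G' H' t := by
  have bij : ∀ {A B : RootedNetwork}, Iso A B → ∃ e : A.ball t ≃ B.ball t,
      e ⟨A.root, A.root_mem_ball t⟩ = ⟨B.root, B.root_mem_ball t⟩ ∧
      ∀ u v : A.ball t, B.ω (e u) (e v) = A.ω u v := by
    rintro A B ⟨σ, h0, h1⟩
    have h1' : ∀ u v, A.ω (σ.symm u) (σ.symm v) = B.ω u v := fun u v => by
      rw [← h1, Equiv.apply_symm_apply, Equiv.apply_symm_apply]
    have h0' : σ.symm B.root = A.root := by rw [← h0, Equiv.symm_apply_apply]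
    refine ⟨⟨fun u => ⟨σ u, mem_ball_of_map σ h1 h0 u.2⟩,
      fun u => ⟨σ.symm u, mem_ball_of_map σ.symm h1' h0' u.2⟩,
      fun u => by simp, fun u => by simp⟩, ?_, fun u v => h1 _ _⟩
    exact Subtype.ext h0
  obtain ⟨σ, s0, s1⟩ := h
  obtain ⟨e, e0, e1⟩ := bij hG.symm
  obtain ⟨f, f0, f1⟩ := bij hH
  refine ⟨(e.trans σ).trans f, by simp [e0, s0, f0], fun u v => ?_⟩
  have := s1 (e u) (e v)
  rw [e1] at this
  simpa [f1] using this

theorem dloc_congr {G G' H H' : RootedNetwork} (hG : Iso G G') (hH : Iso H H') :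
    dloc G H = dloc G' H' := by
  have : ∀ t, CloseAt G H t ↔ CloseAt G' H' t := fun t =>
    ⟨closeAt_of_iso hG hH, closeAt_of_iso hG.symm hH.symm⟩
  simp only [dloc, this]

/-- `ψ_α(G, o) = |ω(o, o)| ^ α`. -/
def psi (α : ℝ) (G : RootedNetwork) : ℝ≥0∞ := ENNReal.ofReal (‖G.ω G.root G.root‖ ^ α)

/-- `φ_α(G, o) = (1 / 2) ∑_{v ≠ o} |ω(o, v)| ^ α`. -/
def phi (α : ℝ) (G : RootedNetwork) : ℝ≥0∞ :=
  2⁻¹ * ∑' v : {v : G.V // v ≠ G.root}, ENNReal.ofReal (‖G.ω G.root v‖ ^ α)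

/-- `ξ_β(G, o) = ∑_v |ω(o, v)| ^ β`. -/
def xi (β : ℝ) (G : RootedNetwork) : ℝ≥0∞ := ∑' v, ENNReal.ofReal (‖G.ω G.root v‖ ^ β)

theorem psi_congr (α : ℝ) {G H : RootedNetwork} (h : Iso G H) : psi α G = psi α H := by
  obtain ⟨σ, h0, h1⟩ := h
  simp only [psi, ← h1, h0]

theorem phi_congr (α : ℝ) {G H : RootedNetwork} (h : Iso G H) : phi α G = phi α H := by
  obtain ⟨σ, h0, h1⟩ := h
  unfold phi
  rw [← (σ.subtypeEquiv (p := fun v => v ≠ G.root) (q := fun v => v ≠ H.root)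
    (fun v => by rw [← h0, ne_eq, ne_eq, σ.apply_eq_iff_eq])).tsum_eq]
  simp only [Equiv.subtypeEquiv_apply, ← h0, h1]

theorem xi_congr (β : ℝ) {G H : RootedNetwork} (h : Iso G H) : xi β G = xi β H := by
  obtain ⟨σ, h0, h1⟩ := h
  unfold xi
  rw [← σ.tsum_eq]
  simp only [← h0, h1]

end RootedNetwork

/-! ### Truncation -/

/-- For `0 < θ < 1` and `x ≥ 0`: zero on `[0, θ)`, `(x - θ) / θ` on `[θ, 2θ)`, one on `[2θ, ∞)`. -/
def chi (θ x : ℝ) : ℝ := max 0 (min 1 ((x - θ) / θ))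

/-- For `0 < θ < 1` and `x ≥ 0`: one on `[0, θ⁻² - 1)`, `θ⁻² - x` on `[θ⁻² - 1, θ⁻²)`, zero on
`[θ⁻², ∞)`. -/
def chiTilde (θ x : ℝ) : ℝ := max 0 (min 1 ((θ ^ 2)⁻¹ - x))

namespace Network

/-- The weights after truncation of the large degrees. -/
def weightTilde (G : Network) (θ : ℝ) (u v : G.V) : ℂ :=
  G.ω u v * (chiTilde θ (max (G.deg u) (G.deg v)) : ℂ)

/-- The truncated network `G_θ`. -/
def trunc (G : Network) (θ : ℝ) : Network where
  V := G.V
  countable := G.countable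
  ω := fun u v => G.weightTilde θ u v * (chi θ ‖G.weightTilde θ u v‖ : ℂ)
  hermitian := by
    have h : ∀ u v, G.weightTilde θ u v = star (G.weightTilde θ v u) := by
      intro u v
      unfold weightTilde
      rw [star_mul', ← G.hermitian, max_comm]
      simp
    intro u v
    rw [star_mul', ← h u v, show ‖G.weightTilde θ v u‖ = ‖G.weightTilde θ u v‖ by
      rw [h u v, norm_star]]
    simp
  locallyFinite := by
    intro v
    refine Summable.of_nonneg_of_le (fun u => by positivity) (fun u => ?_) (G.locallyFinite v)
    have hc : ∀ x : ℝ, ‖((max 0 (min 1 x) : ℝ) : ℂ)‖ ≤ 1 := by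
      intro x
      rw [Complex.norm_real, Real.norm_of_nonneg (le_max_left _ _)]
      exact max_le zero_le_one (min_le_left _ _)
    refine pow_le_pow_left₀ (norm_nonneg _) ?_ 2
    have h1 : ‖G.weightTilde θ v u‖ ≤ ‖G.ω v u‖ := by
      rw [weightTilde, norm_mul]
      exact mul_le_of_le_one_right (norm_nonneg _) (hc _)
    rw [norm_mul]
    exact (mul_le_of_le_one_right (norm_nonneg _) (hc _)).trans h1

end Network

/-- The truncation `(G_θ(o), o)` of a rooted network: the component of the root in `G_θ`. -/
def RootedNetwork.trunc (G : RootedNetwork) (θ : ℝ) : RootedNetwork :=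
  (G.toNetwork.trunc θ).component G.root

theorem RootedNetwork.trunc_congr (θ : ℝ) {G H : RootedNetwork} (h : RootedNetwork.Iso G H) :
    RootedNetwork.Iso (G.trunc θ) (H.trunc θ) := by
  obtain ⟨σ, h0, h1⟩ := h
  have hdeg : ∀ v, H.deg (σ v) = G.deg v := by
    intro v
    unfold Network.deg
    rw [← σ.tsum_eq]
    simp only [h1]
  have hω : ∀ u v : G.V, (H.toNetwork.trunc θ).ω (σ u) (σ v) = (G.toNetwork.trunc θ).ω u v := by
    intro u v
    simp only [Network.trunc, Network.weightTilde, h1, hdeg]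
  have hreach : ∀ v : G.V, (G.toNetwork.trunc θ).Reachable G.root v ↔
      (H.toNetwork.trunc θ).Reachable H.root (σ v) := by
    intro v
    constructor
    · intro hr
      rw [← h0]
      exact Network.reachable_map (G := G.toNetwork.trunc θ) (H := H.toNetwork.trunc θ) σ hω hr
    · intro hr
      have hω' : ∀ u v : H.V,
          (G.toNetwork.trunc θ).ω (σ.symm u) (σ.symm v) = (H.toNetwork.trunc θ).ω u v := by
        intro u v
        have := hω (σ.symm u) (σ.symm v)
        rw [Equiv.apply_symm_apply, Equiv.apply_symm_apply] at this
        exact this.symm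
      have h2 := Network.reachable_map (G := H.toNetwork.trunc θ) (H := G.toNetwork.trunc θ)
        σ.symm hω' hr
      rw [Equiv.symm_apply_apply, ← h0, Equiv.symm_apply_apply] at h2
      exact h2
  exact ⟨σ.subtypeEquiv hreach, Subtype.ext h0, fun u v => hω _ _⟩

/-! ### The space of unlabelled rooted networks -/

/-- The space `𝒢_*` of rooted networks up to rooted isomorphism. -/
def NetworkClass : Type 1 := Quotient RootedNetwork.setoid

namespace NetworkClass

/-- The class of a rooted network. -/
def mk (G : RootedNetwork) : NetworkClass := Quotient.mk _ G

def dloc (g h : NetworkClass) : ℝ≥0∞ :=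
  Quotient.liftOn₂ g h RootedNetwork.dloc
    fun _ _ _ _ hG hH => RootedNetwork.dloc_congr hG hH

def psi (α : ℝ) (g : NetworkClass) : ℝ≥0∞ :=
  Quotient.liftOn g (RootedNetwork.psi α) fun _ _ h => RootedNetwork.psi_congr α h

def phi (α : ℝ) (g : NetworkClass) : ℝ≥0∞ :=
  Quotient.liftOn g (RootedNetwork.phi α) fun _ _ h => RootedNetwork.phi_congr α h

def xi (β : ℝ) (g : NetworkClass) : ℝ≥0∞ :=
  Quotient.liftOn g (RootedNetwork.xi β) fun _ _ h => RootedNetwork.xi_congr β h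

/-- The truncation map `g ↦ g_θ`. -/
def trunc (θ : ℝ) (g : NetworkClass) : NetworkClass :=
  Quotient.liftOn g (fun G => mk (G.trunc θ))
    fun _ _ h => Quotient.sound (RootedNetwork.trunc_congr θ h)

/-- The local topology: a set is open if it contains a `d_loc`-ball around each of its points. -/
instance : TopologicalSpace NetworkClass where
  IsOpen U := ∀ g ∈ U, ∃ ε : ℝ≥0∞, 0 < ε ∧ ∀ h, dloc g h < ε → h ∈ U
  isOpen_univ := fun _ _ => ⟨1, one_pos, fun _ _ => trivial⟩
  isOpen_inter := by
    intro s t hs ht g hg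
    obtain ⟨ε, hε, h1⟩ := hs g hg.1
    obtain ⟨δ, hδ, h2⟩ := ht g hg.2
    exact ⟨min ε δ, lt_min hε hδ, fun h hh =>
      ⟨h1 h (hh.trans_le (min_le_left _ _)), h2 h (hh.trans_le (min_le_right _ _))⟩⟩
  isOpen_sUnion := by
    intro S hS g hg
    obtain ⟨s, hs, hgs⟩ := hg
    obtain ⟨ε, hε, h1⟩ := hS s hs g hgs
    exact ⟨ε, hε, fun h hh => ⟨s, hs, h1 h hh⟩⟩

instance : MeasurableSpace NetworkClass := borel NetworkClass

instance : BorelSpace NetworkClass := ⟨rfl⟩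

end NetworkClass

/-! ### Admissible sofic measures -/

/-- The network of a hermitian matrix. -/
abbrev matrixNetwork {n : ℕ} (H : Matrix (Fin n) (Fin n) ℂ) (hH : H.IsHermitian) : Network where
  V := Fin n
  countable := inferInstance
  ω := fun i j => H i j
  hermitian := fun i j => (hH.apply i j).symm
  locallyFinite := fun _ => Summable.of_finite

/-- `U(H)`, the law of the class of the component of a uniformly chosen root in the network of a
hermitian matrix `H` of size `n ≥ 1`. -/
def uniformRoot {n : ℕ} [NeZero n] (H : Matrix (Fin n) (Fin n) ℂ) (hH : H.IsHermitian) :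
    ProbabilityMeasure NetworkClass :=
  ⟨((n : ℝ≥0∞)⁻¹) • ∑ v : Fin n,
      Measure.dirac (NetworkClass.mk ((matrixNetwork H hH).component v)), ⟨by
    have hn : (n : ℝ≥0∞) ≠ 0 := by exact_mod_cast NeZero.ne n
    simp [Measure.smul_apply, Measure.finsetSum_apply,
      ENNReal.inv_mul_cancel hn (ENNReal.natCast_ne_top n)]⟩⟩

/-- The hermitian matrices in `𝒜_n`: the nonzero entries above the diagonal have phase in `Sa`,
the nonzero diagonal entries have phase in `Sb`. -/
def IsAdmissible (Sa Sb : Set ℂ) {n : ℕ} (H : Matrix (Fin n) (Fin n) ℂ) : Prop :=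
  (∀ i j, i < j → H i j = 0 ∨ H i j / (‖H i j‖ : ℂ) ∈ Sa) ∧
    ∀ i, H i i = 0 ∨ H i i / (‖H i i‖ : ℂ) ∈ Sb

/-- Admissible sofic measures: limits of `U(H_n)`, `H_n ∈ 𝒜_n`, for the weak convergence associated
with the local topology. The matrix `H m` has size `m + 1`. -/
def IsAdmissibleSofic (Sa Sb : Set ℂ) (ρ : ProbabilityMeasure NetworkClass) : Prop :=
  ∃ (H : ∀ m : ℕ, Matrix (Fin (m + 1)) (Fin (m + 1)) ℂ) (hH : ∀ m, (H m).IsHermitian),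
    (∀ m, IsAdmissible Sa Sb (H m)) ∧
      Tendsto (fun m => uniformRoot (H m) (hH m)) atTop (𝓝 ρ)

/-! ### Spectral measures -/

open Classical in
/-- The vector `e_v` of the canonical orthonormal basis of `ℓ²(V)`. -/
def basisVec {V : Type} (v : V) : lp (fun _ : V => ℂ) 2 := lp.single 2 v (1 : ℂ)

/-- `T` is the bounded operator of the network: `T e_v = ∑_u ω(u, v) e_u`. -/
def Network.IsOperator (G : Network)
    (T : lp (fun _ : G.V => ℂ) 2 →L[ℂ] lp (fun _ : G.V => ℂ) 2) : Prop :=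
  ∀ u v : G.V, (T (basisVec v) : G.V → ℂ) u = G.ω u v

/-- `μ` is the spectral measure at the root of the operator `T` of the network: a probability
measure with moments `⟨e_o, T ^ k e_o⟩`. -/
def RootedNetwork.IsSpectralMeasure (G : RootedNetwork) (μ : Measure ℝ) : Prop :=
  IsProbabilityMeasure μ ∧
    ∃ T : lp (fun _ : G.V => ℂ) 2 →L[ℂ] lp (fun _ : G.V => ℂ) 2, G.IsOperator T ∧
      ∀ k : ℕ, Integrable (fun x : ℝ => x ^ k) μ ∧
        ((∫ x, x ^ k ∂μ : ℝ) : ℂ) = inner ℂ (basisVec G.root) ((T ^ k) (basisVec G.root))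

open Classical in
/-- The spectral measure at the root, a function of the class of the network only. It exists and is
unique as soon as the network defines a bounded operator, in particular for all truncated networks;
the value for other networks is irrelevant. -/
def NetworkClass.spectralMeasure (g : NetworkClass) : Measure ℝ :=
  if h : ∃ μ : Measure ℝ, ∃ G : RootedNetwork, NetworkClass.mk G = g ∧ G.IsSpectralMeasure μ
  then h.choose else Measure.dirac 0

/-- The spectral measure `μ_{ρ_θ}`: the expectation of the spectral measure at the root of `g_θ`,
where `g` has law `ρ`. -/
def truncSpectralMeasure (ρ : ProbabilityMeasure NetworkClass) (θ : ℝ) : Measure ℝ :=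
  (ρ : Measure NetworkClass).bind fun g => (g.trunc θ).spectralMeasure

/-- `𝔼_ρ ξ_β < ∞` for some `β ∈ (0, 2)`. -/
def HasFiniteMoment (ρ : ProbabilityMeasure NetworkClass) : Prop :=
  ∃ β : ℝ, 0 < β ∧ β < 2 ∧ ∫⁻ g, g.xi β ∂(ρ : Measure NetworkClass) < ∞

/-- `μ_ρ = ν` for an admissible sofic `ρ`: the measure `μ_ρ` is the weak limit of `μ_{ρ_θ}` as
`θ → 0` if `𝔼_ρ ξ_β < ∞` for some `β ∈ (0, 2)`, and the Dirac mass at `0` otherwise. -/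
def HasSpectralMeasure (ρ : ProbabilityMeasure NetworkClass) (ν : ProbabilityMeasure ℝ) : Prop :=
  (HasFiniteMoment ρ → ∀ f : ℝ →ᵇ ℝ,
    Tendsto (fun θ : ℝ => ∫ x, f x ∂(truncSpectralMeasure ρ θ)) (𝓝[>] 0)
      (𝓝 (∫ x, f x ∂(ν : Measure ℝ)))) ∧
  (¬ HasFiniteMoment ρ → (ν : Measure ℝ) = Measure.dirac 0)

/-! ### The rate functions -/

open Classical in
/-- `I(ρ) = b 𝔼_ρ ψ + a 𝔼_ρ φ` if `ρ` is admissible sofic, and `∞` otherwise (`∞ * 0 = 0`). -/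
def rateI (α : ℝ) (a b : ℝ≥0∞) (Sa Sb : Set ℂ) (ρ : ProbabilityMeasure NetworkClass) : ℝ≥0∞ :=
  if IsAdmissibleSofic Sa Sb ρ then
    b * ∫⁻ g, g.psi α ∂(ρ : Measure NetworkClass) + a * ∫⁻ g, g.phi α ∂(ρ : Measure NetworkClass)
  else ∞

/-- `Φ(ν) = inf {I(ρ) : ρ admissible sofic, μ_ρ = ν}`. -/
def ratePhi (α : ℝ) (a b : ℝ≥0∞) (Sa Sb : Set ℂ) (ν : ProbabilityMeasure ℝ) : ℝ≥0∞ :=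
  ⨅ (ρ : ProbabilityMeasure NetworkClass)
    (_ : IsAdmissibleSofic Sa Sb ρ ∧ HasSpectralMeasure ρ ν), rateI α a b Sa Sb ρ

/-- The absolute moment `m_α(ν) = ∫ |x| ^ α dν ∈ [0, ∞]`. -/
def absMoment (α : ℝ) (ν : ProbabilityMeasure ℝ) : ℝ≥0∞ :=
  ∫⁻ x, ENNReal.ofReal (|x| ^ α) ∂(ν : Measure ℝ)

end WignerLDP

end

noncomputable section

namespace WignerLDP

/-! The upper bounds come from the two simplest kinds of networks. A diagonal matrix with entries
`c_k ≥ 0` is a family of isolated loops; its spectrum is the family `c_k` and a vertex pays `b c_k ^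
α`. A matrix pairing the indices `2k` and `2k + 1` by an edge of weight `s c_k`, with `s ∈ S_a`, has
the eigenvalues `±c_k`, and a vertex pays `(a / 2) c_k ^ α`. With `c_k` the absolute values of
midpoint quantiles of `ν`, the measures `U(H_n)` converge to an explicit `mixLaw`: quantile averages
converge on the line, and `continuous_pairClass` carries this to `𝒢_*`. The spectral measures of
these limits are identified from few moments.

The lower bounds use only the first two moments of `μ_{g_θ}`: the mean is the truncated loop at the
root, and the second moment is the truncated degree. Jensen's inequality and subadditivity of `x ^
(α / 2)` turn the latter into `m_α(μ_{g_θ}) ≤ ξ_α(g)`. Absolute moments are lower semicontinuous, so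
`m_α(ν) ≤ 𝔼 ξ_α = 𝔼 ψ_α + 2 𝔼 φ_α` (`absMoment_le_lintegral_xi`). If `α > 1`, a finite moment of
order `α` gives uniform integrability, and the mean survives too: `∫ x dν = 𝔼 ω(o, o)`
(`integral_eq_of_hasSpectralMeasure`).

Since `S_b = {1}`, loops are nonnegative in the matrices and remain so in the limit
(`ae_rootLoop_nonneg`). A negative mean is therefore impossible at finite cost, which is (c). A
symmetric `ν` has mean zero, so its loops vanish almost surely; then `𝔼 ψ_α = 0` and `I(ρ) = a 𝔼 φ_α
≥ (a / 2) m_α(ν)`, the lower bound in (b).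

Measurability on `𝒢_*` is obtained by showing that suitable sets are open. Measurability of `g ↦
μ_{g_θ}` is never proved in general: in the lower bounds it is forced by the assumed weak
convergence (`eventually_aemeasurable`), and in the upper bounds it follows from explicit formulas.
-/

/-! ### Quantiles and empirical approximation -/

open ProbabilityTheory in
/-- The quantile function of a measure on the line, extended by `0` outside `(0, 1)`. -/
def quantile (ν : Measure ℝ) (u : ℝ) : ℝ :=
  if u ∈ Set.Ioo (0 : ℝ) 1 then sInf {x | u ≤ cdf ν x} else 0

-- Right continuity of the distribution function makes the infimum attained, so on `(0, 1)` the
-- quantile and the distribution function are adjoint. The limits at `±∞` make the set nonempty and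
-- bounded below.
open ProbabilityTheory in
theorem quantile_le_iff (ν : Measure ℝ) [IsProbabilityMeasure ν] {u : ℝ}
    (hu : u ∈ Set.Ioo (0 : ℝ) 1) (x : ℝ) : quantile ν u ≤ x ↔ u ≤ cdf ν x := by
  have hne : {x | u ≤ cdf ν x}.Nonempty := by
    obtain ⟨x, hx⟩ := ((tendsto_cdf_atTop ν).eventually (lt_mem_nhds hu.2)).exists
    exact ⟨x, hx.le⟩
  have hbdd : BddBelow {x | u ≤ cdf ν x} := by
    obtain ⟨y, hy⟩ := ((tendsto_cdf_atBot ν).eventually (gt_mem_nhds hu.1)).exists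
    refine ⟨y, fun x hx => ?_⟩
    by_contra h
    exact absurd (hx.trans (monotone_cdf ν (not_le.1 h).le)) (not_le.2 hy)
  rw [quantile, if_pos hu]
  constructor
  · intro h
    have hr := (cdf ν).right_continuous x
    have hr' : Tendsto (cdf ν) (𝓝[>] x) (𝓝 (cdf ν x)) :=
      hr.tendsto.mono_left (nhdsWithin_mono _ Set.Ioi_subset_Ici_self)
    refine ge_of_tendsto hr' ?_
    filter_upwards [self_mem_nhdsWithin] with y hy
    obtain ⟨z, hz, hzy⟩ := (csInf_lt_iff hbdd hne).1 (lt_of_le_of_lt h hy)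
    exact hz.trans (monotone_cdf ν hzy.le)
  · exact fun h => csInf_le hbdd h

theorem monotoneOn_quantile (ν : Measure ℝ) [IsProbabilityMeasure ν] :
    MonotoneOn (quantile ν) (Set.Ioo 0 1) := fun _ hu _ hv huv =>
  (quantile_le_iff ν hu _).2 (huv.trans ((quantile_le_iff ν hv _).1 le_rfl))

theorem measurable_quantile (ν : Measure ℝ) [IsProbabilityMeasure ν] :
    Measurable (quantile ν) := by
  refine measurable_of_Iic fun x => ?_
  have : quantile ν ⁻¹' Set.Iic x = (Set.Ioo 0 1 ∩ Set.Iic (ProbabilityTheory.cdf ν x)) ∪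
      ((Set.Ioo 0 1)ᶜ ∩ {_u | (0 : ℝ) ≤ x}) := by
    ext u
    by_cases hu : u ∈ Set.Ioo (0 : ℝ) 1
    · have := quantile_le_iff ν hu x
      simp only [Set.mem_preimage, Set.mem_Iic, Set.mem_union, Set.mem_inter_iff, hu, this,
        Set.mem_compl_iff, not_true, false_and, or_false, true_and]
    · simp only [Set.mem_preimage, Set.mem_Iic, Set.mem_union, Set.mem_inter_iff, hu,
        Set.mem_compl_iff, false_and, false_or, not_false_eq_true, true_and, Set.mem_ofPred_eq]
      rw [quantile, if_neg hu]
  rw [this]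
  exact (measurableSet_Ioo.inter measurableSet_Iic).union
    (measurableSet_Ioo.compl.inter (MeasurableSet.const _))

/-- Inverse transform sampling: by `quantile_le_iff` the preimage of a half-line is, inside `(0,
1)`, an interval whose length is the distribution function. -/
theorem map_quantile (ν : Measure ℝ) [IsProbabilityMeasure ν] :
    (volume.restrict (Set.Ioo (0 : ℝ) 1)).map (quantile ν) = ν := by
  have : IsProbabilityMeasure (volume.restrict (Set.Ioo (0 : ℝ) 1)) := ⟨by simp⟩
  have := Measure.isProbabilityMeasure_map (μ := volume.restrict (Set.Ioo (0 : ℝ) 1))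
    (measurable_quantile ν).aemeasurable
  refine Measure.ext_of_Iic _ _ fun x => ?_
  rw [Measure.map_apply (measurable_quantile ν) measurableSet_Iic,
    Measure.restrict_apply (measurable_quantile ν measurableSet_Iic),
    ← ProbabilityTheory.ofReal_cdf ν x]
  have h1 : quantile ν ⁻¹' Set.Iic x ∩ Set.Ioo 0 1 =
      Set.Ioo 0 1 ∩ Set.Iic (ProbabilityTheory.cdf ν x) := by
    ext u
    simp only [Set.mem_inter_iff, Set.mem_preimage, Set.mem_Iic]
    constructor
    · rintro ⟨h, hu⟩
      exact ⟨hu, (quantile_le_iff ν hu x).1 h⟩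
    · rintro ⟨hu, h⟩
      exact ⟨(quantile_le_iff ν hu x).2 h, hu⟩
  rw [h1]
  have h0 := ProbabilityTheory.cdf_nonneg ν x
  have h1 := ProbabilityTheory.cdf_le_one ν x
  apply le_antisymm
  · calc _ ≤ volume (Set.Ioc 0 (ProbabilityTheory.cdf ν x)) :=
        measure_mono (by rintro u ⟨hu, h⟩; exact ⟨hu.1, h⟩)
      _ = _ := by simp
  · calc _ = volume (Set.Ioo 0 (ProbabilityTheory.cdf ν x)) := by simp
      _ ≤ _ := measure_mono (by rintro u hu; exact ⟨⟨hu.1, hu.2.trans_le h1⟩, hu.2.le⟩)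

/-- A midpoint Riemann sum is the integral of a step function. -/
theorem sum_midpoint_eq_integral (h : ℝ → ℝ) {K : ℕ} (hK : 0 < K) :
    (∑ k ∈ Finset.range K, h ((k + 1 / 2) / K)) / K =
      ∫ u in Set.Ioo (0 : ℝ) 1, h ((⌊K * u⌋₊ + 1 / 2) / K) := by
  have hK' : (0 : ℝ) < K := by exact_mod_cast hK
  have hcongr : ∀ k : ℕ, ∀ u ∈ Set.Ioo ((k : ℝ) / K) ((k + 1 : ℕ) / K),
      h ((⌊K * u⌋₊ + 1 / 2) / K) = h ((k + 1 / 2) / K) := by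
    intro k u hu
    have h1 : (k : ℝ) < K * u := by
      have := hu.1; rw [div_lt_iff₀ hK'] at this; linarith
    have h2 : K * u < k + 1 := by
      have := hu.2; rw [lt_div_iff₀ hK'] at this; push_cast at this; linarith
    rw [(Nat.floor_eq_iff (k.cast_nonneg.trans h1.le)).2 ⟨h1.le, h2⟩]
  have hle : ∀ k : ℕ, (k : ℝ) / K ≤ (k + 1 : ℕ) / K := fun k => by
    push_cast; gcongr; linarith
  -- The right endpoint of each cell, where the floor jumps, is discarded as a null set.
  have hae : ∀ k : ℕ, ∀ᵐ u ∂volume, u ∈ Set.uIoc ((k : ℝ) / K) ((k + 1 : ℕ) / K) →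
      h ((k + 1 / 2) / K) = h ((⌊K * u⌋₊ + 1 / 2) / K) := by
    intro k
    have : ∀ᵐ u ∂(volume : Measure ℝ), u ≠ ((k + 1 : ℕ) : ℝ) / K :=
      Measure.ae_ne volume _
    filter_upwards [this] with u hu hu'
    rw [Set.uIoc_of_le (hle k)] at hu'
    exact (hcongr k u ⟨hu'.1, lt_of_le_of_ne hu'.2 hu⟩).symm
  have hint : ∀ k < K, IntervalIntegrable (fun u : ℝ => h ((⌊K * u⌋₊ + 1 / 2) / K)) volume
      ((fun k : ℕ => (k : ℝ) / K) k) ((fun k : ℕ => (k : ℝ) / K) (k + 1)) := by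
    intro k _
    exact (intervalIntegrable_const (c := h ((k + 1 / 2) / K))).congr_ae
      ((ae_restrict_iff' measurableSet_uIoc).2 (hae k))
  have hsum := intervalIntegral.sum_integral_adjacent_intervals hint
  simp only [Nat.cast_zero, zero_div, div_self hK'.ne'] at hsum
  rw [← integral_Ioc_eq_integral_Ioo, ← intervalIntegral.integral_of_le zero_le_one, ← hsum,
    Finset.sum_div]
  refine Finset.sum_congr rfl fun k _ => ?_
  rw [← intervalIntegral.integral_congr_ae (hae k), intervalIntegral.integral_const]
  have : ((k + 1 : ℕ) : ℝ) / K - k / K = 1 / K := by push_cast; ring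
  rw [this, smul_eq_mul]
  ring

/-- Averages over the `K` midpoint quantiles of a probability measure converge to integrals. -/
theorem tendsto_average_quantile (ν : Measure ℝ) [IsProbabilityMeasure ν] (f : ℝ →ᵇ ℝ) :
    Tendsto (fun K : ℕ => (∑ k ∈ Finset.range K, f (quantile ν ((k + 1 / 2) / K))) / K) atTop
      (𝓝 (∫ x, f x ∂ν)) := by
  have hlim : ∫ x, f x ∂ν = ∫ u in Set.Ioo (0 : ℝ) 1, f (quantile ν u) := by
    conv_lhs => rw [← map_quantile ν]
    rw [integral_map (measurable_quantile ν).aemeasurable f.continuous.aestronglyMeasurable]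
  rw [hlim]
  have hev : (fun K : ℕ => ∫ u in Set.Ioo (0 : ℝ) 1, f (quantile ν ((⌊K * u⌋₊ + 1 / 2) / K)))
      =ᶠ[atTop] fun K : ℕ =>
        (∑ k ∈ Finset.range K, f (quantile ν ((k + 1 / 2) / K))) / K := by
    filter_upwards [eventually_gt_atTop 0] with K hK
    exact (sum_midpoint_eq_integral (fun u => f (quantile ν u)) hK).symm
  refine Tendsto.congr' hev ?_
  have : IsFiniteMeasure (volume.restrict (Set.Ioo (0 : ℝ) 1)) := ⟨by simp⟩
  refine tendsto_integral_of_dominated_convergence (fun _ => ‖f‖) (fun K => ?_)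
    (integrable_const _) (fun K => ae_of_all _ fun u => f.norm_coe_le_norm _) ?_
  · refine (f.continuous.measurable.comp ((measurable_quantile ν).comp ?_)).aestronglyMeasurable
    have : Measurable fun u : ℝ => (⌊(K : ℝ) * u⌋₊ : ℝ) :=
      (measurable_from_top (f := fun n : ℕ => (n : ℝ))).comp
        (Nat.measurable_floor.comp (measurable_const_mul _))
    exact (this.add_const _).div_const _
  -- A monotone function has countably many discontinuities, so almost every `u` is a continuity
  -- point, and the midpoint of its cell tends to `u`.
  · have hc := (monotoneOn_quantile ν).countable_not_continuousWithinAt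
    rw [ae_restrict_iff' measurableSet_Ioo]
    filter_upwards [hc.ae_notMem volume] with u hu hu01
    have hcont : ContinuousAt (quantile ν) u := by
      by_contra h
      exact hu ⟨hu01, fun h' => h (h'.continuousAt (isOpen_Ioo.mem_nhds hu01))⟩
    refine (f.continuous.tendsto _).comp (hcont.tendsto.comp ?_)
    have h1 : Tendsto (fun K : ℕ => (⌊u * (K : ℝ)⌋₊ : ℝ) / K) atTop (𝓝 u) :=
      (tendsto_nat_floor_mul_div_atTop hu01.1.le).comp tendsto_natCast_atTop_atTop
    have h2 : Tendsto (fun K : ℕ => (1 / 2 : ℝ) / K) atTop (𝓝 0) :=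
      tendsto_const_div_atTop_nhds_zero_nat _
    simpa [add_div, mul_comm] using h1.add h2

/-! ### The local topology -/

theorem Network.exists_isPath (G : Network) {u v : G.V} (h : G.Reachable u v) :
    ∃ (k : ℕ) (p : Fin (k + 1) → G.V), G.IsPath u v p := by
  unfold Network.Reachable at h
  induction h with
  | refl => exact ⟨0, fun _ => u, rfl, rfl, fun i => i.elim0⟩
  | @tail b c _ hbc ih =>
    obtain ⟨k, p, h0, h1, h2⟩ := ih
    refine ⟨k + 1, Fin.snoc (α := fun _ => G.V) p c, ?_, ?_, fun i => ?_⟩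
    · rw [← h0]
      exact Fin.snoc_castSucc (α := fun _ => G.V) c p 0
    · simp
    · refine Fin.lastCases ?_ (fun j => ?_) i
      · rw [Fin.succ_last, Fin.snoc_last, Fin.snoc_castSucc, h1]
        exact hbc
      · rw [Fin.succ_castSucc, Fin.snoc_castSucc, Fin.snoc_castSucc]
        exact h2 j

theorem RootedNetwork.eventually_mem_ball (G : RootedNetwork) (v : G.V) :
    ∀ᶠ t : ℝ in atTop, v ∈ G.ball t := by
  obtain ⟨k, p, hp⟩ := G.exists_isPath (G.connected G.root v)
  filter_upwards [eventually_ge_atTop (G.pathLength p)] with t ht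
  have h : G.dist G.root v ≤ ENNReal.ofReal (G.pathLength p) :=
    iInf_le_of_le k (iInf_le_of_le p (iInf_le_of_le hp le_rfl))
  exact h.trans (ENNReal.ofReal_le_ofReal ht)

namespace NetworkClass

/-- A small `dloc` gives closeness at some radius `t ≥ t₀` that cannot be prescribed, hence the
hypothesis on all large `t`. This is the criterion behind every openness statement on `𝒢_*` proved
by matching neighbourhoods. -/
theorem isOpen_of_closeAt {U : Set NetworkClass}
    (h : ∀ G : RootedNetwork, mk G ∈ U →
      ∀ᶠ t : ℝ in atTop, ∀ H, RootedNetwork.CloseAt G H t → mk H ∈ U) : IsOpen U := by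
  intro g
  induction g using Quotient.inductionOn with | _ G => ?_
  intro hg
  obtain ⟨t₀, ht₀⟩ := eventually_atTop.1 (h G hg)
  refine ⟨(1 + ENNReal.ofReal t₀)⁻¹, ENNReal.inv_pos.2 (by finiteness), fun g' => ?_⟩
  induction g' using Quotient.inductionOn with | _ H => ?_
  intro hlt
  have h1 : (1 + ⨆ (t : ℝ) (_ : 0 < t ∧ RootedNetwork.CloseAt G H t), ENNReal.ofReal t)⁻¹
      < (1 + ENNReal.ofReal t₀)⁻¹ := hlt
  rw [ENNReal.inv_lt_inv] at h1
  have h2 := lt_of_add_lt_add_left h1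
  obtain ⟨t, ht⟩ := lt_iSup_iff.1 h2
  obtain ⟨⟨ht0, hc⟩, ht⟩ := lt_iSup_iff.1 ht
  -- When `t₀ < 0`, `ENNReal.ofReal t₀` is `0`, and `t₀ ≤ t` comes from `0 < t` instead.
  exact ht₀ t (ENNReal.lt_ofReal_iff_toReal_lt (by finiteness) |>.1 ht |>.le |> fun h' => by
    rcases le_or_gt 0 t₀ with h3 | h3
    · rwa [ENNReal.toReal_ofReal h3] at h'
    · exact h3.le.trans ht0.le) H hc

/-! ### Measurability of the functionals of the root. -/

/-- The weight of the loop at the root. -/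
def rootLoop (g : NetworkClass) : ℂ :=
  Quotient.liftOn g (fun G : RootedNetwork => G.ω G.root G.root)
    fun _ _ ⟨_, h0, h1⟩ => by rw [← h0, h1]

theorem continuous_rootLoop : Continuous rootLoop := by
  refine continuous_def.2 fun U hU => isOpen_of_closeAt fun G hG => ?_
  obtain ⟨ε, hε, hball⟩ := Metric.isOpen_iff.1 hU _ hG
  have h1 : Tendsto (fun t : ℝ => 1 / t) atTop (𝓝 0) := by
    simpa using tendsto_inv_atTop_zero (𝕜 := ℝ)
  filter_upwards [h1.eventually (gt_mem_nhds hε)] with t ht H hc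
  obtain ⟨σ, h0, hσ⟩ := hc
  refine hball ?_
  have := hσ ⟨G.root, G.root_mem_ball t⟩ ⟨G.root, G.root_mem_ball t⟩
  rw [h0] at this
  rw [Metric.mem_ball, dist_eq_norm, norm_sub_rev]
  exact this.trans_lt ht

/-- Lower semicontinuity: finitely many neighbours of the root already bring the sum above `c`. They
lie in every large ball, so a close network contains distinct copies of them, with weights smaller
by at most `1 / t`. -/
theorem isOpen_lt_phi {α : ℝ} (hα : 0 < α) (c : ℝ≥0∞) : IsOpen {g : NetworkClass | c < g.phi α} := by
  refine isOpen_of_closeAt fun G hG => ?_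
  have hG : c < 2⁻¹ * ∑' v : {v : G.V // v ≠ G.root}, ENNReal.ofReal (‖G.ω G.root v‖ ^ α) := hG
  rw [← ENNReal.tsum_mul_left, ENNReal.tsum_eq_iSup_sum] at hG
  obtain ⟨s, hs⟩ := lt_iSup_iff.1 hG
  have hlim : Tendsto (fun t : ℝ => ∑ v ∈ s,
      2⁻¹ * ENNReal.ofReal ((max (‖G.ω G.root v‖ - 1 / t) 0) ^ α)) atTop
      (𝓝 (∑ v ∈ s, 2⁻¹ * ENNReal.ofReal (‖G.ω G.root v‖ ^ α))) := by
    refine tendsto_finsetSum _ fun v _ => ENNReal.Tendsto.const_mul ?_ (Or.inr (by simp))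
    refine ENNReal.tendsto_ofReal ?_
    have h1 : Tendsto (fun t : ℝ => max (‖G.ω G.root v‖ - 1 / t) 0) atTop
        (𝓝 ‖G.ω G.root v‖) := by
      have : Tendsto (fun t : ℝ => 1 / t) atTop (𝓝 0) := by
        simpa using tendsto_inv_atTop_zero (𝕜 := ℝ)
      simpa using (this.const_sub ‖G.ω G.root v‖).max (tendsto_const_nhds (x := (0 : ℝ)))
    exact h1.rpow_const (Or.inr hα.le)
  have hball : ∀ᶠ t : ℝ in atTop, ∀ v ∈ s, v.1 ∈ G.ball t :=
    (Finset.eventually_all s).2 fun v _ => G.eventually_mem_ball v.1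
  filter_upwards [hlim.eventually (lt_mem_nhds hs), hball] with t ht hb H hc
  obtain ⟨σ, h0, hσ⟩ := hc
  change c < 2⁻¹ * ∑' v : {v : H.V // v ≠ H.root}, ENNReal.ofReal (‖H.ω H.root v‖ ^ α)
  rw [← ENNReal.tsum_mul_left]
  -- The matching fixes the root and is injective, so the chosen neighbours go to distinct vertices
  -- other than the root.
  let j : s → {v : H.V // v ≠ H.root} := fun v => ⟨σ ⟨v.1.1, hb v.1 v.2⟩, fun h => by
    have h' : σ ⟨v.1.1, hb v.1 v.2⟩ = σ ⟨G.root, G.root_mem_ball t⟩ := by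
      rw [h0]; exact Subtype.ext h
    exact v.1.2 (congrArg Subtype.val (σ.injective h'))⟩
  have hj : Function.Injective j := by
    intro v w hvw
    have h1 : σ ⟨v.1.1, hb v.1 v.2⟩ = σ ⟨w.1.1, hb w.1 w.2⟩ :=
      Subtype.ext (congrArg (fun x : {v : H.V // v ≠ H.root} => x.1) hvw)
    exact Subtype.ext (Subtype.ext (congrArg (fun x : G.ball t => x.1) (σ.injective h1)))
  refine ht.trans_le (le_trans ?_ (ENNReal.tsum_comp_le_tsum_of_injective hj _))
  rw [← Finset.tsum_subtype]
  refine ENNReal.tsum_le_tsum fun v => ?_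
  gcongr
  refine max_le ?_ (norm_nonneg _)
  have := hσ ⟨G.root, G.root_mem_ball t⟩ ⟨v.1.1, hb v.1 v.2⟩
  rw [h0] at this
  have h2 := norm_sub_norm_le (G.ω G.root v.1.1) (H.ω H.root (j v))
  have h3 : ‖G.ω G.root v.1.1 - H.ω H.root (j v)‖ ≤ 1 / t := this
  linarith

theorem measurable_phi {α : ℝ} (hα : 0 < α) : Measurable (phi α) :=
  measurable_of_Ioi fun c => (isOpen_lt_phi hα c).measurableSet

theorem psi_eq (α : ℝ) (g : NetworkClass) : g.psi α = ENNReal.ofReal (‖g.rootLoop‖ ^ α) := by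
  induction g using Quotient.inductionOn with | _ G => rfl

theorem measurable_psi (α : ℝ) : Measurable (psi α) := by
  have : psi α = fun g => ENNReal.ofReal (‖g.rootLoop‖ ^ α) := funext (psi_eq α)
  rw [this]
  exact (continuous_rootLoop.measurable.norm.pow_const α).ennreal_ofReal

theorem xi_eq (α : ℝ) (g : NetworkClass) : g.xi α = g.psi α + 2 * g.phi α := by
  induction g using Quotient.inductionOn with | _ G => ?_
  change ∑' v, ENNReal.ofReal (‖G.ω G.root v‖ ^ α) = ENNReal.ofReal (‖G.ω G.root G.root‖ ^ α) +
    2 * (2⁻¹ * ∑' v : {v : G.V // v ≠ G.root}, ENNReal.ofReal (‖G.ω G.root v‖ ^ α))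
  classical
  rw [← mul_assoc, ENNReal.mul_inv_cancel two_ne_zero ENNReal.ofNat_ne_top, one_mul]
  have h0 := ENNReal.tsum_eq_add_tsum_ite (f := fun v => ENNReal.ofReal (‖G.ω G.root v‖ ^ α)) G.root
  refine h0.trans ?_
  congr 1
  have h := tsum_subtype {v : G.V | v ≠ G.root} fun v => ENNReal.ofReal (‖G.ω G.root v‖ ^ α)
  refine Eq.trans (tsum_congr fun v => ?_) h.symm
  by_cases hv : v = G.root <;> simp [hv]

theorem measurable_xi {α : ℝ} (hα : 0 < α) : Measurable (xi α) := by
  have : xi α = fun g => g.psi α + 2 * g.phi α := funext (xi_eq α)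
  rw [this]
  exact (measurable_psi α).add ((measurable_phi hα).const_mul 2)

theorem measurableSet_of_closeAt {p : RootedNetwork → Prop} {U : Set NetworkClass}
    (hp : ∀ G, mk G ∈ U ↔ p G)
    (h : ∀ G, p G → ∀ᶠ t : ℝ in atTop, ∀ H, RootedNetwork.CloseAt G H t → p H) :
    MeasurableSet U := by
  refine IsOpen.measurableSet (isOpen_of_closeAt fun G hG => ?_)
  simpa only [hp] using h G ((hp G).1 hG)

end NetworkClass

/-! ### Spectral measures of bounded self-adjoint operators -/

section SpectralTheorem

variable {H : Type*} [NormedAddCommGroup H] [InnerProductSpace ℂ H] [CompleteSpace H]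

open scoped CompactlySupported in
/-- The positive functional `f ↦ ⟨e, f(T) e⟩`. -/
def spectralFunctional (T : H →L[ℂ] H) (hT : IsSelfAdjoint T) (e : H) :
    C_c(spectrum ℝ T, ℝ) →ₚ[ℝ] ℝ :=
  PositiveLinearMap.mk₀
    { toFun := fun f => (inner ℂ e (cfcHom (R := ℝ) hT f.toContinuousMap e)).re
      map_add' := fun f g => by
        have : (f + g).toContinuousMap = f.toContinuousMap + g.toContinuousMap := rfl
        rw [this, map_add, add_apply, inner_add_right, Complex.add_re]
      map_smul' := fun c f => by
        have : (c • f).toContinuousMap = c • f.toContinuousMap := rfl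
        rw [this, map_smul, smul_apply, RCLike.real_smul_eq_coe_smul (K := ℂ),
          inner_smul_right]
        simp }
    (fun f hf => by
      -- Positivity: `f = g * g` with `g = √f`, so the functional at `f` is the squared norm of
      -- `g(T) e`.
      let g : C(spectrum ℝ T, ℝ) := ⟨fun x => Real.sqrt (f x), by fun_prop⟩
      have hfg : f.toContinuousMap = star g * g := by
        ext x
        exact (Real.mul_self_sqrt (hf x)).symm
      change 0 ≤ (inner ℂ e (cfcHom (R := ℝ) hT f.toContinuousMap e)).re
      rw [hfg, map_mul, map_star, mul_apply_eq_comp,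
        ContinuousLinearMap.star_eq_adjoint, ContinuousLinearMap.adjoint_inner_right]
      exact inner_self_nonneg (𝕜 := ℂ))

/-- The spectral measure of a bounded self-adjoint operator at a unit vector. -/
theorem exists_spectralMeasure (T : H →L[ℂ] H) (hT : IsSelfAdjoint T) (e : H) (he : ‖e‖ = 1) :
    ∃ μ : Measure ℝ, IsProbabilityMeasure μ ∧ ∀ k : ℕ, Integrable (fun x : ℝ => x ^ k) μ ∧
      ((∫ x, x ^ k ∂μ : ℝ) : ℂ) = inner ℂ e ((T ^ k) e) := by
  let m := RealRMK.rieszMeasure (spectralFunctional T hT e)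
  have key : ∀ f : C(spectrum ℝ T, ℝ),
      ∫ x, f x ∂m = (inner ℂ e (cfcHom (R := ℝ) hT f e)).re := fun f =>
    RealRMK.integral_rieszMeasure (spectralFunctional T hT e)
      (CompactlySupportedContinuousMap.continuousMapEquiv f)
  have hfin : IsFiniteMeasure m := ⟨isCompact_univ.measure_lt_top⟩
  have hone : m Set.univ = 1 := by
    have h1 := key 1
    rw [map_one, one_apply_eq_self, inner_self_eq_norm_sq_to_K, he] at h1
    simp only [ContinuousMap.one_apply, integral_const, smul_eq_mul, mul_one] at h1
    have h2 : m.real Set.univ = 1 := by simpa using h1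
    rw [← ENNReal.toReal_eq_one_iff]
    exact h2
  have hprob : IsProbabilityMeasure m := ⟨hone⟩
  have hmeas : Measurable (Subtype.val : spectrum ℝ T → ℝ) := measurable_subtype_coe
  have hmap : IsProbabilityMeasure (m.map (Subtype.val : spectrum ℝ T → ℝ)) :=
    Measure.isProbabilityMeasure_map hmeas.aemeasurable
  refine ⟨m.map Subtype.val, hmap, fun k => ?_⟩
  let f : C(spectrum ℝ T, ℝ) := (ContinuousMap.restrict (spectrum ℝ T) (ContinuousMap.id ℝ)) ^ k
  have hf : ∀ x, f x = (x : ℝ) ^ k := fun x => rfl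
  constructor
  · rw [integrable_map_measure (by fun_prop) hmeas.aemeasurable]
    have : Integrable f m := by
      have := (BoundedContinuousFunction.mkOfCompact f).integrable m
      exact this
    exact this
  · rw [integral_map hmeas.aemeasurable (by fun_prop)]
    have h1 := key f
    simp only [hf] at h1
    have h2 : cfcHom (R := ℝ) hT f = T ^ k := by rw [map_pow, cfcHom_id]
    rw [h1, h2]
    -- The functional only records real parts; self-adjointness shows that the moments have no
    -- imaginary part to lose.
    have hsa : IsSelfAdjoint (T ^ k) := hT.pow k
    refine Complex.ext rfl ?_
    have h3 : (starRingEnd ℂ) (inner ℂ e ((T ^ k) e)) = inner ℂ e ((T ^ k) e) := by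
      rw [inner_conj_symm]
      conv_lhs => rw [← ContinuousLinearMap.isSelfAdjoint_iff'.1 hsa]
      rw [ContinuousLinearMap.adjoint_inner_left]
    exact (Complex.conj_eq_iff_im.1 h3).symm

end SpectralTheorem

/-! ### The operator of a network -/

theorem inner_basisVec {V : Type} (v : V) (f : lp (fun _ : V => ℂ) 2) :
    inner ℂ (basisVec v) f = (f : V → ℂ) v := by
  classical
  rw [basisVec, lp.inner_single_left]
  simp

theorem norm_basisVec {V : Type} (v : V) : ‖basisVec v‖ = 1 := by
  classical
  rw [basisVec, lp.norm_single (by norm_num)]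
  simp

theorem basisVec_apply_self {V : Type} (v : V) : (basisVec v : V → ℂ) v = 1 := by
  classical
  simp [basisVec]

theorem basisVec_apply_ne {V : Type} {u v : V} (h : u ≠ v) : (basisVec v : V → ℂ) u = 0 := by
  classical
  simp [basisVec, lp.single_apply, h]

namespace Network

variable {G : Network}

/-- Continuity lets `T` act term by term on `f = ∑ f(v) e_v`, so its entries determine it. -/
theorem IsOperator.hasSum {T : lp (fun _ : G.V => ℂ) 2 →L[ℂ] lp (fun _ : G.V => ℂ) 2}
    (hT : G.IsOperator T) (f : lp (fun _ : G.V => ℂ) 2) (u : G.V) :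
    HasSum (fun v => (f : G.V → ℂ) v * G.ω u v) ((T f : G.V → ℂ) u) := by
  classical
  have h1 := lp.hasSum_single (p := 2) (by simp) f
  have h2 := (innerSL ℂ (basisVec u)).hasSum (T.hasSum h1)
  rw [innerSL_apply_apply, inner_basisVec] at h2
  refine h2.congr_fun fun v => ?_
  have h3 : lp.single 2 v ((f : G.V → ℂ) v) = (f : G.V → ℂ) v • basisVec v := by
    rw [basisVec, ← lp.single_smul]
    congr 1
    · simp
  rw [h3, map_smul, map_smul, innerSL_apply_apply,
    inner_basisVec, hT u v, smul_eq_mul]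

theorem IsOperator.inner_left {T : lp (fun _ : G.V => ℂ) 2 →L[ℂ] lp (fun _ : G.V => ℂ) 2}
    (hT : G.IsOperator T) (u : G.V) (f : lp (fun _ : G.V => ℂ) 2) :
    inner ℂ (T (basisVec u)) f = (T f : G.V → ℂ) u := by
  refine (lp.hasSum_inner (𝕜 := ℂ) (T (basisVec u)) f).unique ?_
  refine (hT.hasSum f u).congr_fun fun v => ?_
  rw [hT v u, G.hermitian v u]
  simp

theorem IsOperator.isSelfAdjoint {T : lp (fun _ : G.V => ℂ) 2 →L[ℂ] lp (fun _ : G.V => ℂ) 2}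
    (hT : G.IsOperator T) : IsSelfAdjoint T := by
  rw [ContinuousLinearMap.isSelfAdjoint_iff']
  ext f u
  rw [← inner_basisVec, ContinuousLinearMap.adjoint_inner_right, hT.inner_left]

/-- Weighted Cauchy–Schwarz, from `∑ w (a - l)² ≥ 0` with `l = S / C`, the minimiser when the total
weight is exactly `C`; a smaller total weight only helps. -/
theorem tsum_mul_sq_le {V : Type} {w a : V → ℝ} (hw : ∀ v, 0 ≤ w v) (hsw : Summable w)
    (hs1 : Summable fun v => w v * a v)
    (hs2 : Summable fun v => w v * a v ^ 2) {C : ℝ} (hC : 0 < C) (hwC : ∑' v, w v ≤ C) :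
    (∑' v, w v * a v) ^ 2 ≤ C * ∑' v, w v * a v ^ 2 := by
  set S := ∑' v, w v * a v
  set l := S / C
  have h1 : 0 ≤ ∑' v, w v * (a v - l) ^ 2 := tsum_nonneg fun v => mul_nonneg (hw v) (sq_nonneg _)
  have h2 : ∑' v, w v * (a v - l) ^ 2 =
      (∑' v, w v * a v ^ 2) - 2 * l * S + l ^ 2 * ∑' v, w v := by
    rw [← tsum_mul_left, ← tsum_mul_left, ← (hs2.tsum_sub (hs1.mul_left _)),
      ← ((hs2.sub (hs1.mul_left _)).tsum_add (hsw.mul_left _))]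
    exact tsum_congr fun v => by ring
  have h3 : l ^ 2 * ∑' v, w v ≤ l ^ 2 * C := mul_le_mul_of_nonneg_left hwC (sq_nonneg _)
  have hl : l * C = S := div_mul_cancel₀ _ hC.ne'
  have h4 : 0 ≤ (∑' v, w v * a v ^ 2) - l * S := by
    have : l ^ 2 * C = l * S := by rw [sq, mul_assoc, hl]
    linarith
  have h5 := mul_nonneg hC.le h4
  have : C * (l * S) = S ^ 2 := by rw [← hl]; ring
  linarith [mul_sub C (∑' v, w v * a v ^ 2) (l * S)]

/-- Schur's test: a network with bounded absolute row sums has a bounded operator. -/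
theorem exists_isOperator (G : Network) {C : ℝ} (hC : 0 < C)
    (hs : ∀ u, Summable fun v => ‖G.ω u v‖) (hb : ∀ u, ∑' v, ‖G.ω u v‖ ≤ C) :
    ∃ T, G.IsOperator T := by
  let E := lp (fun _ : G.V => ℂ) 2
  have hbd : ∀ (f : E) v, ‖(f : G.V → ℂ) v‖ ≤ ‖f‖ := fun f v => lp.norm_apply_le_norm (by simp) f v
  have hs1 : ∀ (f : E) u, Summable fun v => ‖G.ω u v‖ * ‖(f : G.V → ℂ) v‖ := fun f u =>
    Summable.of_nonneg_of_le (fun v => by positivity)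
      (fun v => mul_le_mul_of_nonneg_left (hbd f v) (norm_nonneg _)) ((hs u).mul_right ‖f‖)
  have hs2 : ∀ (f : E) u, Summable fun v => ‖G.ω u v‖ * ‖(f : G.V → ℂ) v‖ ^ 2 := fun f u =>
    Summable.of_nonneg_of_le (fun v => by positivity)
      (fun v => mul_le_mul_of_nonneg_left (pow_le_pow_left₀ (norm_nonneg _) (hbd f v) 2)
        (norm_nonneg _)) ((hs u).mul_right (‖f‖ ^ 2))
  have hs0 : ∀ (f : E) u, Summable fun v => G.ω u v * (f : G.V → ℂ) v := fun f u =>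
    Summable.of_norm (by simpa only [norm_mul] using hs1 f u)
  have hf2 : ∀ f : E, HasSum (fun v => ‖(f : G.V → ℂ) v‖ ^ 2) (‖f‖ ^ 2) := fun f => by
    have := lp.hasSum_norm (p := 2) (by simp) f
    simpa using this
  have hrow : ∀ (f : E) u, ‖∑' v, G.ω u v * (f : G.V → ℂ) v‖ ^ 2 ≤
      C * ∑' v, ‖G.ω u v‖ * ‖(f : G.V → ℂ) v‖ ^ 2 := fun f u => by
    refine le_trans (pow_le_pow_left₀ (norm_nonneg _) ?_ 2)
      (tsum_mul_sq_le (fun v => norm_nonneg _) (hs u) (hs1 f u) (hs2 f u) hC (hb u))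
    refine (norm_tsum_le_tsum_norm (by simpa only [norm_mul] using hs1 f u)).trans ?_
    simp only [norm_mul, le_refl]
  -- Hermitian symmetry makes column sums equal to row sums, so one bound serves for both halves of
  -- Schur's test.
  have hcol : ∀ v (s : Finset G.V), ∑ u ∈ s, ‖G.ω u v‖ ≤ C := fun v s => by
    have : ∀ u, ‖G.ω u v‖ = ‖G.ω v u‖ := fun u => by rw [G.hermitian u v, norm_star]
    simp only [this]
    exact ((hs v).sum_le_tsum s fun u _ => norm_nonneg _).trans (hb v)
  have hsum : ∀ (f : E) (s : Finset G.V),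
      ∑ u ∈ s, ‖∑' v, G.ω u v * (f : G.V → ℂ) v‖ ^ 2 ≤ (C * ‖f‖) ^ 2 := fun f s =>
    calc _ ≤ ∑ u ∈ s, C * ∑' v, ‖G.ω u v‖ * ‖(f : G.V → ℂ) v‖ ^ 2 :=
          Finset.sum_le_sum fun u _ => hrow f u
      _ = C * ∑' v, (∑ u ∈ s, ‖G.ω u v‖) * ‖(f : G.V → ℂ) v‖ ^ 2 := by
          rw [← Finset.mul_sum, ← Summable.tsum_finsetSum fun u _ => hs2 f u]
          simp only [Finset.sum_mul]
      _ ≤ C * (C * ‖f‖ ^ 2) := by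
          refine mul_le_mul_of_nonneg_left ?_ hC.le
          rw [← (hf2 f).tsum_eq, ← tsum_mul_left]
          have h1 : ∀ v, (∑ u ∈ s, ‖G.ω u v‖) * ‖(f : G.V → ℂ) v‖ ^ 2 ≤
              C * ‖(f : G.V → ℂ) v‖ ^ 2 := fun v =>
            mul_le_mul_of_nonneg_right (hcol v s) (sq_nonneg _)
          exact Summable.tsum_le_tsum h1 (Summable.of_nonneg_of_le
            (fun v => mul_nonneg (Finset.sum_nonneg fun _ _ => norm_nonneg _) (sq_nonneg _)) h1
            ((hf2 f).summable.mul_left C)) ((hf2 f).summable.mul_left C)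
      _ = (C * ‖f‖) ^ 2 := by ring
  have hmem : ∀ f : E, Memℓp (fun u => ∑' v, G.ω u v * (f : G.V → ℂ) v) 2 := fun f =>
    memℓp_gen' (C := (C * ‖f‖) ^ 2) fun s => by simpa using hsum f s
  let L : E →ₗ[ℂ] E :=
    { toFun := fun f => ⟨fun u => ∑' v, G.ω u v * (f : G.V → ℂ) v, hmem f⟩
      map_add' := fun f g => by
        ext u
        change ∑' v, G.ω u v * ((f : G.V → ℂ) v + (g : G.V → ℂ) v) =
          ∑' v, G.ω u v * (f : G.V → ℂ) v + ∑' v, G.ω u v * (g : G.V → ℂ) v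
        simp only [mul_add]
        exact (hs0 f u).tsum_add (hs0 g u)
      map_smul' := fun c f => by
        ext u
        change ∑' v, G.ω u v * (c * (f : G.V → ℂ) v) = c * ∑' v, G.ω u v * (f : G.V → ℂ) v
        rw [← tsum_mul_left]
        exact tsum_congr fun v => by ring }
  refine ⟨L.mkContinuous C fun f => ?_, fun u v => ?_⟩
  · refine lp.norm_le_of_forall_sum_le (by simp) (by positivity) fun s => ?_
    change ∑ u ∈ s, ‖∑' v, G.ω u v * (f : G.V → ℂ) v‖ ^ _ ≤ _
    simpa using hsum f s
  · change ∑' w, G.ω u w * (basisVec v : G.V → ℂ) w = G.ω u v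
    rw [tsum_eq_single v fun w hw => by rw [basisVec_apply_ne hw, mul_zero], basisVec_apply_self,
      mul_one]

end Network

namespace RootedNetwork

variable {G : RootedNetwork} {μ : Measure ℝ}

theorem exists_isSpectralMeasure (G : RootedNetwork) (h : ∃ T, G.IsOperator T) :
    ∃ μ, G.IsSpectralMeasure μ := by
  obtain ⟨T, hT⟩ := h
  obtain ⟨μ, h1, h2⟩ := exists_spectralMeasure T hT.isSelfAdjoint (basisVec G.root)
    (norm_basisVec _)
  exact ⟨μ, h1, T, hT, h2⟩

theorem IsSpectralMeasure.integral_id (h : G.IsSpectralMeasure μ) :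
    Integrable (fun x => x) μ ∧ ((∫ x, x ∂μ : ℝ) : ℂ) = G.ω G.root G.root := by
  obtain ⟨_, T, hT, hk⟩ := h
  have := hk 1
  simp only [pow_one] at this
  rwa [inner_basisVec, hT] at this

/-- Since `T` is self-adjoint, `⟨e_o, T² e_o⟩ = ‖T e_o‖²`, and `T e_o` is the column of weights at
the root. -/
theorem IsSpectralMeasure.integral_sq (h : G.IsSpectralMeasure μ) :
    Integrable (fun x => x ^ 2) μ ∧ ∫ x, x ^ 2 ∂μ = G.deg G.root := by
  obtain ⟨_, T, hT, hk⟩ := h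
  refine ⟨(hk 2).1, ?_⟩
  have h2 := (hk 2).2
  rw [pow_two T, mul_apply_eq_comp, inner_basisVec, ← hT.inner_left,
    inner_self_eq_norm_sq_to_K] at h2
  have h3 : ∫ x, x ^ 2 ∂μ = ‖T (basisVec G.root)‖ ^ 2 :=
    Complex.ofReal_injective (by rw [h2]; simp)
  rw [h3, Network.deg]
  have := lp.hasSum_norm (p := 2) (by simp) (T (basisVec G.root))
  have h4 : HasSum (fun v => ‖(T (basisVec G.root) : G.V → ℂ) v‖ ^ 2) (‖T (basisVec G.root)‖ ^ 2) := by
    simpa using this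
  rw [← h4.tsum_eq]
  refine tsum_congr fun v => ?_
  rw [hT v G.root, G.hermitian, norm_star]

end RootedNetwork

/-! ### Truncated networks -/

theorem chi_nonneg (θ x : ℝ) : 0 ≤ chi θ x := le_max_left _ _

theorem chi_le_one (θ x : ℝ) : chi θ x ≤ 1 := max_le zero_le_one (min_le_left _ _)

theorem chiTilde_nonneg (θ x : ℝ) : 0 ≤ chiTilde θ x := le_max_left _ _

theorem chiTilde_le_one (θ x : ℝ) : chiTilde θ x ≤ 1 := max_le zero_le_one (min_le_left _ _)

theorem chi_eq_zero {θ x : ℝ} (hθ : 0 < θ) (hx : x ≤ θ) : chi θ x = 0 :=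
  max_eq_left ((min_le_right _ _).trans (div_nonpos_of_nonpos_of_nonneg (by linarith) hθ.le))

theorem chi_eq_one {θ x : ℝ} (hθ : 0 < θ) (hx : 2 * θ ≤ x) : chi θ x = 1 := by
  have h : 1 ≤ (x - θ) / θ := by rw [le_div_iff₀ hθ]; linarith
  rw [chi, min_eq_left h, max_eq_right zero_le_one]

theorem chiTilde_eq_zero {θ x : ℝ} (hx : (θ ^ 2)⁻¹ ≤ x) : chiTilde θ x = 0 :=
  max_eq_left ((min_le_right _ _).trans (by linarith))

theorem chiTilde_eq_one {θ x : ℝ} (hx : x + 1 ≤ (θ ^ 2)⁻¹) : chiTilde θ x = 1 := by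
  rw [chiTilde, min_eq_left (by linarith), max_eq_right zero_le_one]

theorem eventually_chi_eq_one {x : ℝ} (hx : 0 < x) : ∀ᶠ θ in 𝓝[>] (0 : ℝ), chi θ x = 1 := by
  filter_upwards [self_mem_nhdsWithin,
    nhdsWithin_le_nhds (gt_mem_nhds (show (0 : ℝ) < x / 2 by linarith))] with θ h1 h2
  exact chi_eq_one h1 (by linarith)

theorem eventually_chiTilde_eq_one (x : ℝ) : ∀ᶠ θ in 𝓝[>] (0 : ℝ), chiTilde θ x = 1 := by
  have h1 : Tendsto (fun θ : ℝ => (θ ^ 2)⁻¹) (𝓝[>] 0) atTop := by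
    have := (tendsto_pow_atTop (α := ℝ) two_ne_zero).comp tendsto_inv_nhdsGT_zero
    refine this.congr fun θ => ?_
    simp
  filter_upwards [h1.eventually_ge_atTop (x + 1)] with θ h
  exact chiTilde_eq_one h

namespace Network

variable (G : Network) {θ : ℝ}

theorem norm_trunc_ω (u v : G.V) : ‖(G.trunc θ).ω u v‖ =
    ‖G.ω u v‖ * chiTilde θ (max (G.deg u) (G.deg v)) *
      chi θ (‖G.ω u v‖ * chiTilde θ (max (G.deg u) (G.deg v))) := by
  simp only [trunc, weightTilde, norm_mul, Complex.norm_real, Real.norm_eq_abs,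
    abs_of_nonneg (chi_nonneg _ _), abs_of_nonneg (chiTilde_nonneg _ _)]

theorem norm_trunc_ω_le (u v : G.V) : ‖(G.trunc θ).ω u v‖ ≤ ‖G.ω u v‖ := by
  rw [norm_trunc_ω]
  exact (mul_le_of_le_one_right (mul_nonneg (norm_nonneg _) (chiTilde_nonneg _ _))
    (chi_le_one _ _)).trans (mul_le_of_le_one_right (norm_nonneg _) (chiTilde_le_one _ _))

/-- A weight that survives the cutoff `chi` is at least `θ`, hence at most its square over `θ`. This
trades square summability for summability. -/
theorem norm_trunc_ω_le_sq (hθ : 0 < θ) (u v : G.V) :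
    ‖(G.trunc θ).ω u v‖ ≤ ‖G.ω u v‖ ^ 2 / θ := by
  rw [norm_trunc_ω]
  set x := ‖G.ω u v‖ * chiTilde θ (max (G.deg u) (G.deg v))
  have hx0 : 0 ≤ x := mul_nonneg (norm_nonneg _) (chiTilde_nonneg _ _)
  have hx : x ≤ ‖G.ω u v‖ := mul_le_of_le_one_right (norm_nonneg _) (chiTilde_le_one _ _)
  rcases le_total x θ with h | h
  · rw [chi_eq_zero hθ h, mul_zero]
    positivity
  · rw [le_div_iff₀ hθ]
    have h1 : x * chi θ x ≤ x := mul_le_of_le_one_right hx0 (chi_le_one _ _)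
    nlinarith

/-- A row of degree at least `θ⁻²` is erased; any other row has absolute sum at most its degree over
`θ`. The uniform bound is what Schur's test needs. -/
theorem sum_norm_trunc_le (hθ : 0 < θ) (u : G.V) :
    Summable (fun v : G.V => ‖(G.trunc θ).ω u v‖) ∧
      ∑' v : G.V, ‖(G.trunc θ).ω u v‖ ≤ (θ ^ 2)⁻¹ / θ := by
  have hs : Summable fun v => ‖G.ω u v‖ ^ 2 / θ := (G.locallyFinite u).div_const θ
  have hs1 : Summable (fun v : G.V => ‖(G.trunc θ).ω u v‖) :=
    Summable.of_nonneg_of_le (fun v => norm_nonneg _) (G.norm_trunc_ω_le_sq hθ u) hs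
  refine ⟨hs1, ?_⟩
  rcases le_total (θ ^ 2)⁻¹ (G.deg u) with h | h
  · have : ∀ v : G.V, ‖(G.trunc θ).ω u v‖ = 0 := fun v => by
      rw [norm_trunc_ω, chiTilde_eq_zero (h.trans (le_max_left _ _)), mul_zero, zero_mul]
    simp only [this, tsum_zero]
    positivity
  · refine (hs1.tsum_le_tsum (G.norm_trunc_ω_le_sq hθ u) hs).trans ?_
    rw [tsum_div_const]
    exact div_le_div_of_nonneg_right h hθ.le

theorem ω_eq_zero_of_not_reachable {v : G.V} (u : (G.component v).V) {w : G.V}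
    (hw : ¬ G.Reachable v w) : G.ω u.1 w = 0 := by
  by_contra h
  exact hw (Relation.ReflTransGen.tail u.2 h)

theorem deg_component (v : G.V) (u : (G.component v).V) :
    (G.component v).deg u = G.deg u.1 := by
  have h := tsum_subtype {w : G.V | G.Reachable v w} fun w => ‖G.ω u.1 w‖ ^ 2
  refine Eq.trans h (tsum_congr fun w => ?_)
  by_cases hw : G.Reachable v w
  · simp [hw]
  · simp [hw, G.ω_eq_zero_of_not_reachable u hw]

end Network

namespace RootedNetwork

variable (G : RootedNetwork) {θ : ℝ}

theorem exists_isOperator_trunc (hθ : 0 < θ) : ∃ T, (G.trunc θ).IsOperator T := by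
  refine Network.exists_isOperator _ (C := (θ ^ 2)⁻¹ / θ) (by positivity) (fun u => ?_) fun u => ?_
  · exact (G.sum_norm_trunc_le hθ u.1).1.comp_injective Subtype.val_injective
  · obtain ⟨h1, h2⟩ := G.sum_norm_trunc_le hθ u.1
    exact (tsum_comp_le_tsum_of_inj h1 (fun v => norm_nonneg _) Subtype.val_injective).trans h2

theorem xi_trunc_le {α : ℝ} (hα : 0 < α) : (G.trunc θ).xi α ≤ G.xi α := by
  refine le_trans (ENNReal.tsum_le_tsum fun v => ?_) (ENNReal.tsum_comp_le_tsum_of_injective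
    (f := Subtype.val) Subtype.val_injective fun v => ENNReal.ofReal (‖G.ω G.root v‖ ^ α))
  exact ENNReal.ofReal_le_ofReal (Real.rpow_le_rpow (norm_nonneg _)
    (G.norm_trunc_ω_le G.root v.1) hα.le)

theorem deg_eq_xi : G.deg G.root = (G.xi 2).toReal := by
  rw [xi, ENNReal.tsum_toReal_eq (by finiteness)]
  refine tsum_congr fun v => ?_
  rw [ENNReal.toReal_ofReal (by positivity)]
  norm_cast

theorem deg_congr {G H : RootedNetwork} (h : Iso G H) : G.deg G.root = H.deg H.root := by
  rw [deg_eq_xi, deg_eq_xi, xi_congr 2 h]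

theorem root_ω_im : (G.ω G.root G.root).im = 0 :=
  Complex.conj_eq_iff_im.1 (G.hermitian G.root G.root).symm

end RootedNetwork

/-- Subadditivity of `x ^ p` for two terms, extended to finite sums by induction and to the full sum
by continuity. -/
theorem tsum_rpow_le_tsum_rpow {V : Type*} (f : V → ℝ≥0∞) {p : ℝ} (hp : 0 < p) (hp1 : p ≤ 1) :
    (∑' v, f v) ^ p ≤ ∑' v, f v ^ p := by
  have h1 : Tendsto (fun s : Finset V => (∑ v ∈ s, f v) ^ p) atTop (𝓝 ((∑' v, f v) ^ p)) :=
    (ENNReal.continuous_rpow_const.tendsto _).comp (ENNReal.summable (f := f)).hasSum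
  refine le_of_tendsto' h1 fun s => le_trans ?_ (ENNReal.sum_le_tsum s)
  classical
  induction s using Finset.induction_on with
  | empty => simp [hp]
  | insert a s ha ih =>
    rw [Finset.sum_insert ha, Finset.sum_insert ha]
    exact (ENNReal.rpow_add_le_add_rpow _ _ hp.le hp1).trans (add_le_add_right ih _)

/-- The absolute moments of order at most two of a spectral measure, by Jensen's inequality and
subadditivity. -/
theorem RootedNetwork.IsSpectralMeasure.lintegral_rpow_le {G : RootedNetwork} {μ : Measure ℝ}
    (h : G.IsSpectralMeasure μ) {α : ℝ} (hα : 0 < α) (hα2 : α ≤ 2) :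
    ∫⁻ x, ENNReal.ofReal (|x| ^ α) ∂μ ≤ G.xi α := by
  have hprob := h.1
  have hpow : ∀ {β : ℝ}, 0 < β → ∀ y : ℝ, 0 ≤ y → ENNReal.ofReal (y ^ β) = ENNReal.ofReal y ^ β :=
    fun hβ y hy => (ENNReal.ofReal_rpow_of_nonneg hy hβ.le).symm
  have h2 : ∫⁻ x, ENNReal.ofReal |x| ^ (2 : ℝ) ∂μ = ∑' v, ENNReal.ofReal ‖G.ω G.root v‖ ^ (2 : ℝ) := by
    have h3 := ofReal_integral_eq_lintegral_ofReal h.integral_sq.1 (ae_of_all _ fun x => sq_nonneg x)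
    rw [h.integral_sq.2, Network.deg,
      ENNReal.ofReal_tsum_of_nonneg (fun _ => sq_nonneg _) (G.locallyFinite _)] at h3
    rw [← tsum_congr fun v => hpow two_pos ‖G.ω G.root v‖ (norm_nonneg _),
      ← lintegral_congr fun x => hpow two_pos |x| (abs_nonneg _)]
    simpa only [Real.rpow_two, sq_abs] using h3.symm
  have h4 := eLpNorm'_le_eLpNorm'_of_exponent_le hα hα2 (μ := μ) (f := fun x : ℝ => x)
    (by fun_prop)
  simp only [eLpNorm', ← ofReal_norm, Real.norm_eq_abs] at h4
  rw [h2, one_div α, ENNReal.rpow_inv_le_iff hα, ← ENNReal.rpow_mul] at h4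
  rw [lintegral_congr fun x => hpow hα |x| (abs_nonneg _)]
  refine h4.trans ?_
  rw [RootedNetwork.xi, tsum_congr fun v => hpow hα ‖G.ω G.root v‖ (norm_nonneg _)]
  refine (tsum_rpow_le_tsum_rpow _ (by positivity) (by linarith)).trans_eq ?_
  refine tsum_congr fun v => ?_
  rw [← ENNReal.rpow_mul]
  congr 1
  ring

/-! ### Truncated spectral measures as functions of the class. -/

namespace NetworkClass

variable {θ : ℝ}

/-- The representative that comes with the chosen measure is only isomorphic to a given truncation,
so later arguments use isomorphism-invariant data such as the loop and the degree at the root. -/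
theorem exists_isSpectralMeasure_trunc (hθ : 0 < θ) (g : NetworkClass) :
    ∃ G : RootedNetwork, mk G = g.trunc θ ∧ G.IsSpectralMeasure (g.trunc θ).spectralMeasure := by
  have h : ∃ μ : Measure ℝ, ∃ G : RootedNetwork, mk G = g.trunc θ ∧ G.IsSpectralMeasure μ := by
    induction g using Quotient.inductionOn with | _ G => ?_
    obtain ⟨μ, hμ⟩ := (G.trunc θ).exists_isSpectralMeasure (G.exists_isOperator_trunc hθ)
    exact ⟨μ, G.trunc θ, rfl, hμ⟩
  rw [spectralMeasure, dif_pos h]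
  exact h.choose_spec

theorem isProbabilityMeasure_trunc (hθ : 0 < θ) (g : NetworkClass) :
    IsProbabilityMeasure (g.trunc θ).spectralMeasure := by
  obtain ⟨G, _, h⟩ := exists_isSpectralMeasure_trunc hθ g
  exact h.1

theorem xi_trunc_le {α : ℝ} (hα : 0 < α) (g : NetworkClass) : (g.trunc θ).xi α ≤ g.xi α := by
  induction g using Quotient.inductionOn with | _ G => exact G.xi_trunc_le hα

theorem lintegral_rpow_trunc_le (hθ : 0 < θ) (g : NetworkClass) {α : ℝ} (hα : 0 < α)
    (hα2 : α ≤ 2) :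
    ∫⁻ x, ENNReal.ofReal (|x| ^ α) ∂(g.trunc θ).spectralMeasure ≤ g.xi α := by
  obtain ⟨G, hG, h⟩ := exists_isSpectralMeasure_trunc hθ g
  refine (h.lintegral_rpow_le hα hα2).trans ?_
  have h1 : G.xi α = (g.trunc θ).xi α := by rw [← hG]; rfl
  rw [h1]
  exact xi_trunc_le hα g

theorem rootLoop_im (g : NetworkClass) : g.rootLoop.im = 0 := by
  induction g using Quotient.inductionOn with | _ G => exact G.root_ω_im

/-- The truncated weight of the loop at the root. -/
def truncLoop (θ : ℝ) (g : NetworkClass) : ℝ :=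
  g.rootLoop.re * chiTilde θ (g.xi 2).toReal * chi θ (‖g.rootLoop‖ * chiTilde θ (g.xi 2).toReal)

theorem rootLoop_trunc (g : NetworkClass) : (g.trunc θ).rootLoop = truncLoop θ g := by
  induction g using Quotient.inductionOn with | _ G => ?_
  change G.ω G.root G.root * (chiTilde θ (max (G.deg G.root) (G.deg G.root)) : ℂ) *
    (chi θ ‖G.ω G.root G.root * (chiTilde θ (max (G.deg G.root) (G.deg G.root)) : ℂ)‖ : ℂ) =
    (((G.ω G.root G.root).re * chiTilde θ (G.xi 2).toReal *
      chi θ (‖G.ω G.root G.root‖ * chiTilde θ (G.xi 2).toReal) : ℝ) : ℂ)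
  rw [max_self, ← G.deg_eq_xi, norm_mul, Complex.norm_real, Real.norm_eq_abs,
    abs_of_nonneg (chiTilde_nonneg _ _)]
  have h : G.ω G.root G.root = ((G.ω G.root G.root).re : ℂ) :=
    Complex.ext rfl (by rw [G.root_ω_im, Complex.ofReal_im])
  push_cast
  rw [← h]

theorem integral_trunc (hθ : 0 < θ) (g : NetworkClass) :
    Integrable (fun x => x) (g.trunc θ).spectralMeasure ∧
      ∫ x, x ∂(g.trunc θ).spectralMeasure = truncLoop θ g := by
  obtain ⟨G, hG, h⟩ := exists_isSpectralMeasure_trunc hθ g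
  refine ⟨h.integral_id.1, Complex.ofReal_injective ?_⟩
  rw [h.integral_id.2, ← rootLoop_trunc, ← hG]
  rfl

theorem measurable_truncLoop (θ : ℝ) : Measurable (truncLoop θ) := by
  have h1 : Measurable (xi 2) := measurable_xi two_pos
  have h2 := continuous_rootLoop.measurable
  unfold truncLoop chi chiTilde
  fun_prop

theorem truncLoop_nonneg {g : NetworkClass} (h : 0 ≤ g.rootLoop.re) : 0 ≤ truncLoop θ g :=
  mul_nonneg (mul_nonneg h (chiTilde_nonneg _ _)) (chi_nonneg _ _)

theorem truncLoop_le {g : NetworkClass} (h : 0 ≤ g.rootLoop.re) :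
    truncLoop θ g ≤ g.rootLoop.re :=
  (mul_le_of_le_one_right (mul_nonneg h (chiTilde_nonneg _ _)) (chi_le_one _ _)).trans
    (mul_le_of_le_one_right h (chiTilde_le_one _ _))

/-- For a fixed class both cutoffs are inactive once `θ` is small, so the truncated loop is
eventually constant. -/
theorem tendsto_truncLoop (g : NetworkClass) :
    Tendsto (fun θ => truncLoop θ g) (𝓝[>] 0) (𝓝 g.rootLoop.re) := by
  refine Tendsto.congr' ?_ tendsto_const_nhds
  rcases eq_or_ne g.rootLoop 0 with h | h
  · filter_upwards with θ
    simp [truncLoop, h]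
  · filter_upwards [eventually_chiTilde_eq_one (g.xi 2).toReal,
      eventually_chi_eq_one (norm_pos_iff.2 h)] with θ h1 h2
    simp [truncLoop, h1, h2]

end NetworkClass

/-! ### Weak limits and moments -/

section WeakLimits

theorem integrable_of_lintegral_rpow_ne_top {μ : Measure ℝ} [IsFiniteMeasure μ] {α : ℝ}
    (hα : 0 < α) (h : ∫⁻ x, ENNReal.ofReal (|x| ^ α) ∂μ ≠ ∞) :
    Integrable (fun x => |x| ^ α) μ := by
  have hc : Continuous fun x : ℝ => |x| ^ α := continuous_abs.rpow_const fun _ => Or.inr hα.le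
  exact (lintegral_ofReal_ne_top_iff_integrable hc.aestronglyMeasurable
    (ae_of_all _ fun x => by positivity)).1 h

theorem abs_le_one_add_rpow {α : ℝ} (hα : 1 ≤ α) (x : ℝ) : |x| ≤ 1 + |x| ^ α := by
  rcases le_total |x| 1 with h | h
  · have : 0 ≤ |x| ^ α := by positivity
    linarith
  · have := Real.rpow_le_rpow_of_exponent_le h hα
    rw [Real.rpow_one] at this
    linarith

theorem integrable_id_of_lintegral_rpow_ne_top {μ : Measure ℝ} [IsFiniteMeasure μ] {α : ℝ}
    (hα : 1 ≤ α) (h : ∫⁻ x, ENNReal.ofReal (|x| ^ α) ∂μ ≠ ∞) : Integrable (fun x => x) μ :=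
  ((integrable_const (1 : ℝ)).add
    (integrable_of_lintegral_rpow_ne_top (zero_lt_one.trans_le hα) h)).mono'
    (by fun_prop) (ae_of_all _ fun x => abs_le_one_add_rpow hα x)

/-- The truncation of the identity at level `R`. -/
def clip (R x : ℝ) : ℝ := max (-R) (min R x)

theorem abs_clip_le {R : ℝ} (hR : 0 ≤ R) (x : ℝ) : |clip R x| ≤ R :=
  abs_le.2 ⟨le_max_left _ _, max_le (by linarith) (min_le_left _ _)⟩

theorem continuous_clip (R : ℝ) : Continuous (clip R) := by unfold clip; fun_prop

/-- The error vanishes for `|x| ≤ R`. Otherwise it is at most `|x| = |x| ^ (1 - α) * |x| ^ α`, where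
the first factor is at most `R ^ (1 - α)` because its exponent is nonpositive. -/
theorem abs_sub_clip_le {R α : ℝ} (hR : 0 < R) (hα : 1 ≤ α) (x : ℝ) :
    |x - clip R x| ≤ R ^ (1 - α) * |x| ^ α := by
  rcases le_total |x| R with h | h
  · have : clip R x = x := by
      rw [clip, min_eq_right (abs_le.1 h).2, max_eq_right (abs_le.1 h).1]
    rw [this, sub_self, abs_zero]
    positivity
  · have h1 : |x - clip R x| ≤ |x| := by
      unfold clip
      rcases le_total 0 x with h0 | h0
      · rw [abs_of_nonneg h0] at h ⊢
        rw [min_eq_left h, max_eq_right (by linarith), abs_of_nonneg (by linarith)]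
        linarith
      · rw [abs_of_nonpos h0] at h ⊢
        rw [min_eq_right (by linarith), max_eq_left (by linarith), abs_of_nonpos (by linarith)]
        linarith
    have h2 : |x| = |x| ^ (1 - α) * |x| ^ α := by
      rw [← Real.rpow_add (hR.trans_le h)]
      simp
    refine h1.trans ?_
    conv_lhs => rw [h2]
    exact mul_le_mul_of_nonneg_right (Real.rpow_le_rpow_of_nonpos hR h (by linarith))
      (by positivity)

/-- The identity truncated at level `R`, as a bounded continuous function. -/
def clipBCF (R : ℝ) (hR : 0 ≤ R) : ℝ →ᵇ ℝ :=
  BoundedContinuousFunction.ofNormedAddCommGroup (clip R) (continuous_clip R) R (abs_clip_le hR)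

theorem abs_integral_sub_clip_le {μ : Measure ℝ} [IsFiniteMeasure μ] {α R : ℝ} {M : ℝ≥0∞}
    (hα : 1 ≤ α) (hR : 0 < R) (hM : M ≠ ∞) (h : ∫⁻ x, ENNReal.ofReal (|x| ^ α) ∂μ ≤ M) :
    |∫ x, x ∂μ - ∫ x, clipBCF R hR.le x ∂μ| ≤ R ^ (1 - α) * M.toReal := by
  have hne := ne_top_of_le_ne_top hM h
  have hi := integrable_of_lintegral_rpow_ne_top (zero_lt_one.trans_le hα) hne
  rw [← integral_sub (integrable_id_of_lintegral_rpow_ne_top hα hne)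
    ((clipBCF R hR.le).integrable μ)]
  refine (abs_integral_le_integral_abs).trans ?_
  refine (integral_mono_of_nonneg (ae_of_all _ fun x => abs_nonneg _) (hi.const_mul (R ^ (1 - α)))
    (ae_of_all _ fun x => abs_sub_clip_le hR hα x)).trans ?_
  rw [integral_const_mul]
  refine mul_le_mul_of_nonneg_left ?_ (by positivity)
  rw [integral_eq_lintegral_of_nonneg_ae (ae_of_all _ fun x => by positivity)
    hi.aestronglyMeasurable]
  exact ENNReal.toReal_mono hM h

variable {ι : Type*} {l : Filter ι} [l.NeBot] {μ : ι → Measure ℝ} {ν : Measure ℝ}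
  [IsProbabilityMeasure ν] {α : ℝ} {M : ℝ≥0∞}

/-- Absolute moments are lower semicontinuous for weak convergence. -/
theorem lintegral_rpow_le_of_tendsto (hα : 0 < α) (hM : M ≠ ∞)
    (hμ : ∀ᶠ i in l, ∫⁻ x, ENNReal.ofReal (|x| ^ α) ∂(μ i) ≤ M)
    (hlim : ∀ f : ℝ →ᵇ ℝ, Tendsto (fun i => ∫ x, f x ∂(μ i)) l (𝓝 (∫ x, f x ∂ν))) :
    ∫⁻ x, ENNReal.ofReal (|x| ^ α) ∂ν ≤ M := by
  have hc : Continuous fun x : ℝ => |x| ^ α := continuous_abs.rpow_const fun _ => Or.inr hα.le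
  -- Weak convergence only sees bounded functions: the bound is proved for `min (|x| ^ α) n` and
  -- passes to `|x| ^ α` by monotone convergence.
  let f : ℕ → ℝ →ᵇ ℝ := fun n => BoundedContinuousFunction.ofNormedAddCommGroup
    (fun x => min (|x| ^ α) n) (hc.min continuous_const) n fun x => by
      rw [Real.norm_eq_abs, abs_of_nonneg (le_min (by positivity) n.cast_nonneg)]
      exact min_le_right _ _
  have hf0 : ∀ n x, 0 ≤ f n x := fun n x => le_min (by positivity) n.cast_nonneg
  have h1 : ∀ n, ∫⁻ x, ENNReal.ofReal (f n x) ∂ν ≤ M := by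
    intro n
    have hle : ∫ x, f n x ∂ν ≤ M.toReal := by
      refine le_of_tendsto (hlim (f n)) ?_
      filter_upwards [hμ] with i hi
      rw [integral_eq_lintegral_of_nonneg_ae (ae_of_all _ (hf0 n))
        (f n).continuous.aestronglyMeasurable]
      exact ENNReal.toReal_mono hM ((lintegral_mono fun x =>
        ENNReal.ofReal_le_ofReal (min_le_left _ _)).trans hi)
    rw [← ofReal_integral_eq_lintegral_ofReal ((f n).integrable ν) (ae_of_all _ (hf0 n))]
    exact (ENNReal.ofReal_le_ofReal hle).trans_eq (ENNReal.ofReal_toReal hM)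
  have h2 : ∀ x : ℝ, Tendsto (fun n => ENNReal.ofReal (f n x)) atTop
      (𝓝 (ENNReal.ofReal (|x| ^ α))) := fun x => by
    refine tendsto_const_nhds.congr' ?_
    obtain ⟨N, hN⟩ := exists_nat_ge (|x| ^ α)
    filter_upwards [eventually_ge_atTop N] with n hn
    have : f n x = |x| ^ α := min_eq_left (hN.trans (Nat.cast_le.2 hn))
    rw [this]
  have h3 := lintegral_tendsto_of_tendsto_of_monotone (μ := ν)
    (f := fun n x => ENNReal.ofReal (f n x)) (F := fun x => ENNReal.ofReal (|x| ^ α))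
    (fun n => (f n).continuous.measurable.ennreal_ofReal.aemeasurable)
    (ae_of_all _ fun x n m hnm => ENNReal.ofReal_le_ofReal
      (min_le_min le_rfl (Nat.cast_le.2 hnm))) (ae_of_all _ h2)
  exact le_of_tendsto' h3 h1

/-- First moments converge under weak convergence and a bound on a moment of order `α > 1`. -/
theorem tendsto_integral_id_of_tendsto (hα : 1 < α) (hM : M ≠ ∞)
    (hμ : ∀ᶠ i in l, IsFiniteMeasure (μ i) ∧ ∫⁻ x, ENNReal.ofReal (|x| ^ α) ∂(μ i) ≤ M)
    (hlim : ∀ f : ℝ →ᵇ ℝ, Tendsto (fun i => ∫ x, f x ∂(μ i)) l (𝓝 (∫ x, f x ∂ν))) :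
    Tendsto (fun i => ∫ x, x ∂(μ i)) l (𝓝 (∫ x, x ∂ν)) := by
  have hν := lintegral_rpow_le_of_tendsto (zero_lt_one.trans hα) hM (hμ.mono fun i h => h.2) hlim
  rw [Metric.tendsto_nhds]
  intro ε hε
  have h1 : Tendsto (fun R : ℝ => R ^ (1 - α) * M.toReal) atTop (𝓝 0) := by
    have := (tendsto_rpow_neg_atTop (show 0 < α - 1 by linarith)).mul_const M.toReal
    simpa using this
  -- One level `R` makes the truncation error less than `ε / 3` for `ν` and, uniformly in `i`, for
  -- `μ i`; the last third is for the truncated means.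
  obtain ⟨R, hRε, hR⟩ := ((h1.eventually (gt_mem_nhds (show 0 < ε / 3 by linarith))).and
    (eventually_gt_atTop 0)).exists
  filter_upwards [hμ, Metric.tendsto_nhds.1 (hlim (clipBCF R hR.le)) (ε / 3) (by linarith)]
    with i hi hi2
  have := hi.1
  have h2 := abs_integral_sub_clip_le hα.le hR hM hi.2
  have h3 := abs_integral_sub_clip_le hα.le hR hM hν
  rw [Real.dist_eq] at hi2 ⊢
  rw [abs_le] at h2 h3
  rw [abs_lt] at hi2 ⊢
  constructor <;> linarith

end WeakLimits

/-! ### Lower bounds for the rate function -/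

section LowerBound

variable {ρ : ProbabilityMeasure NetworkClass} {ν : ProbabilityMeasure ℝ} {θ α : ℝ}

theorem isProbabilityMeasure_truncSpectralMeasure (hθ : 0 < θ)
    (hm : AEMeasurable (fun g : NetworkClass => (g.trunc θ).spectralMeasure)
      (ρ : Measure NetworkClass)) : IsProbabilityMeasure (truncSpectralMeasure ρ θ) := by
  constructor
  rw [truncSpectralMeasure, Measure.bind_apply MeasurableSet.univ hm]
  have : ∀ g : NetworkClass, (g.trunc θ).spectralMeasure Set.univ = 1 := fun g =>
    (NetworkClass.isProbabilityMeasure_trunc hθ g).measure_univ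
  simp [this]

/-- Weak convergence to a probability measure forces `g ↦ μ_{g_θ}` to be measurable for small
`θ`. -/
theorem eventually_aemeasurable
    (hlim : ∀ f : ℝ →ᵇ ℝ, Tendsto (fun θ : ℝ => ∫ x, f x ∂(truncSpectralMeasure ρ θ)) (𝓝[>] 0)
      (𝓝 (∫ x, f x ∂(ν : Measure ℝ)))) :
    ∀ᶠ θ in 𝓝[>] (0 : ℝ), AEMeasurable (fun g : NetworkClass => (g.trunc θ).spectralMeasure)
      (ρ : Measure NetworkClass) := by
  -- Tested against `1`, the total mass tends to one. Without measurability the bind is the zero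
  -- measure by convention, of mass zero.
  have h := hlim (BoundedContinuousFunction.const ℝ 1)
  simp only [BoundedContinuousFunction.const_apply, integral_const, probReal_univ, smul_eq_mul,
    mul_one] at h
  filter_upwards [h.eventually (lt_mem_nhds one_half_lt_one)] with θ hθ
  by_contra hm
  rw [truncSpectralMeasure, Measure.bind, Measure.map_of_not_aemeasurable hm,
    Measure.join_zero] at hθ
  simp at hθ
  linarith

theorem lintegral_rpow_truncSpectralMeasure_le (hθ : 0 < θ) (hα : 0 < α) (hα2 : α ≤ 2)
    (hm : AEMeasurable (fun g : NetworkClass => (g.trunc θ).spectralMeasure)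
      (ρ : Measure NetworkClass)) :
    ∫⁻ x, ENNReal.ofReal (|x| ^ α) ∂(truncSpectralMeasure ρ θ) ≤
      ∫⁻ g, g.xi α ∂(ρ : Measure NetworkClass) := by
  have hf : Measurable fun x : ℝ => ENNReal.ofReal (|x| ^ α) := by fun_prop
  rw [truncSpectralMeasure, Measure.lintegral_bind hm hf.aemeasurable]
  exact lintegral_mono fun g => NetworkClass.lintegral_rpow_trunc_le hθ g hα hα2

/-- `m_α(μ_ρ) ≤ 𝔼_ρ ξ_α`. -/
theorem absMoment_le_lintegral_xi (hα : 0 < α) (hα2 : α < 2) (h : HasSpectralMeasure ρ ν) :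
    absMoment α ν ≤ ∫⁻ g, g.xi α ∂(ρ : Measure NetworkClass) := by
  by_cases hM : ∫⁻ g, g.xi α ∂(ρ : Measure NetworkClass) = ∞
  · rw [hM]
    exact le_top
  · have hlim := h.1 ⟨α, hα, hα2, lt_top_iff_ne_top.2 hM⟩
    refine lintegral_rpow_le_of_tendsto hα hM ?_ hlim
    filter_upwards [eventually_aemeasurable hlim, self_mem_nhdsWithin] with θ hm hθ
    exact lintegral_rpow_truncSpectralMeasure_le hθ hα hα2.le hm

/-- Each fibre has a nonnegative mean, so its positive part integrates to its negative part plus the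
truncated loop. Averaging this identity in `ℝ≥0∞` and subtracting at the end avoids a Fubini theorem
for signed integrands. -/
theorem integral_truncSpectralMeasure (hθ : 0 < θ)
    (hm : AEMeasurable (fun g : NetworkClass => (g.trunc θ).spectralMeasure)
      (ρ : Measure NetworkClass))
    (hpos : ∀ᵐ g ∂(ρ : Measure NetworkClass), 0 ≤ g.rootLoop.re)
    (hint : Integrable (fun x => x) (truncSpectralMeasure ρ θ)) :
    ∫ x, x ∂(truncSpectralMeasure ρ θ) =
      (∫⁻ g, ENNReal.ofReal (g.truncLoop θ) ∂(ρ : Measure NetworkClass)).toReal := by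
  have hb : ∀ f : ℝ → ℝ≥0∞, Measurable f → ∫⁻ x, f x ∂(truncSpectralMeasure ρ θ) =
      ∫⁻ g, ∫⁻ x, f x ∂(NetworkClass.trunc θ g).spectralMeasure ∂(ρ : Measure NetworkClass) :=
    fun f hf => Measure.lintegral_bind hm hf.aemeasurable
  have hneg : Measurable fun x : ℝ => ENNReal.ofReal (-x) := measurable_id.neg.ennreal_ofReal
  have hsplit : ∫⁻ x, ENNReal.ofReal x ∂(truncSpectralMeasure ρ θ) =
      ∫⁻ x, ENNReal.ofReal (-x) ∂(truncSpectralMeasure ρ θ) +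
        ∫⁻ g, ENNReal.ofReal (g.truncLoop θ) ∂(ρ : Measure NetworkClass) := by
    have hN : AEMeasurable (fun g : NetworkClass => ∫⁻ x, ENNReal.ofReal (-x)
        ∂(NetworkClass.trunc θ g).spectralMeasure) (ρ : Measure NetworkClass) :=
      (Measure.measurable_lintegral hneg).comp_aemeasurable hm
    rw [hb _ ENNReal.measurable_ofReal, hb _ hneg, ← lintegral_add_left' hN]
    refine lintegral_congr_ae ?_
    filter_upwards [hpos] with g hg
    obtain ⟨h1, h2⟩ := NetworkClass.integral_trunc hθ g
    have hP := h1.lintegral_lt_top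
    have hN : ∫⁻ x, ENNReal.ofReal (-x) ∂(NetworkClass.trunc θ g).spectralMeasure < ∞ :=
      h1.neg.lintegral_lt_top
    rw [← h2, integral_eq_lintegral_pos_part_sub_lintegral_neg_part h1]
    have h0 := NetworkClass.truncLoop_nonneg (θ := θ) hg
    rw [← h2, integral_eq_lintegral_pos_part_sub_lintegral_neg_part h1] at h0
    rw [ENNReal.ofReal_sub _ ENNReal.toReal_nonneg, ENNReal.ofReal_toReal hP.ne,
      ENNReal.ofReal_toReal hN.ne, add_tsub_cancel_of_le]
    exact (ENNReal.toReal_le_toReal hN.ne hP.ne).1 (sub_nonneg.1 h0)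
  have hP := hint.lintegral_lt_top
  have hN : ∫⁻ x, ENNReal.ofReal (-x) ∂(truncSpectralMeasure ρ θ) < ∞ := hint.neg.lintegral_lt_top
  have hE : ∫⁻ g, ENNReal.ofReal (g.truncLoop θ) ∂(ρ : Measure NetworkClass) ≠ ∞ := by
    intro h
    rw [h, add_top] at hsplit
    exact hP.ne hsplit
  rw [integral_eq_lintegral_pos_part_sub_lintegral_neg_part hint, hsplit,
    ENNReal.toReal_add hN.ne hE, add_sub_cancel_left]

/-- The mean of `μ_ρ` is the mean of the loop at the root. -/
theorem integral_eq_of_hasSpectralMeasure (hα : 1 < α) (hα2 : α < 2)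
    (hM : ∫⁻ g, g.xi α ∂(ρ : Measure NetworkClass) ≠ ∞)
    (hpos : ∀ᵐ g ∂(ρ : Measure NetworkClass), 0 ≤ g.rootLoop.re)
    (h : HasSpectralMeasure ρ ν) :
    ∫⁻ g, ENNReal.ofReal g.rootLoop.re ∂(ρ : Measure NetworkClass) ≠ ∞ ∧
    Integrable (fun x => x) (ν : Measure ℝ) ∧
    ∫ x, x ∂(ν : Measure ℝ) =
      (∫⁻ g, ENNReal.ofReal g.rootLoop.re ∂(ρ : Measure NetworkClass)).toReal := by
  have hα0 : 0 < α := zero_lt_one.trans hα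
  have hlim := h.1 ⟨α, hα0, hα2, lt_top_iff_ne_top.2 hM⟩
  have hfin : ∫⁻ g, ENNReal.ofReal g.rootLoop.re ∂(ρ : Measure NetworkClass) ≠ ∞ := by
    have hle : ∀ g : NetworkClass, ENNReal.ofReal g.rootLoop.re ≤ 1 + g.xi α := fun g => by
      rw [NetworkClass.xi_eq, NetworkClass.psi_eq]
      have h1 : g.rootLoop.re ≤ 1 + ‖g.rootLoop‖ ^ α :=
        (Complex.re_le_norm _).trans (by
          simpa only [abs_norm] using abs_le_one_add_rpow hα.le ‖g.rootLoop‖)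
      refine (ENNReal.ofReal_le_ofReal h1).trans ?_
      rw [ENNReal.ofReal_add zero_le_one (by positivity), ENNReal.ofReal_one, ← add_assoc]
      exact le_self_add
    refine ne_top_of_le_ne_top ?_ (lintegral_mono hle)
    rw [lintegral_add_left measurable_const]
    simpa using hM
  have hbd : ∀ᶠ θ in 𝓝[>] (0 : ℝ), IsFiniteMeasure (truncSpectralMeasure ρ θ) ∧
      ∫⁻ x, ENNReal.ofReal (|x| ^ α) ∂(truncSpectralMeasure ρ θ) ≤
        ∫⁻ g, g.xi α ∂(ρ : Measure NetworkClass) := by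
    filter_upwards [eventually_aemeasurable hlim, self_mem_nhdsWithin] with θ hm hθ
    have := isProbabilityMeasure_truncSpectralMeasure hθ hm
    exact ⟨inferInstance, lintegral_rpow_truncSpectralMeasure_le hθ hα0 hα2.le hm⟩
  -- The means of `μ_{ρ_θ}` have two limits: the mean of `ν` by the uniform moment bound, and the
  -- mean loop by dominated convergence, since truncation only shrinks a nonnegative loop.
  have h1 := tendsto_integral_id_of_tendsto hα hM hbd hlim
  refine ⟨hfin, integrable_id_of_lintegral_rpow_ne_top hα.le
    (ne_top_of_le_ne_top hM (absMoment_le_lintegral_xi hα0 hα2 h)), tendsto_nhds_unique h1 ?_⟩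
  have h2 : Tendsto (fun θ => ∫⁻ g, ENNReal.ofReal (NetworkClass.truncLoop θ g)
      ∂(ρ : Measure NetworkClass)) (𝓝[>] 0)
      (𝓝 (∫⁻ g, ENNReal.ofReal g.rootLoop.re ∂(ρ : Measure NetworkClass))) := by
    refine tendsto_lintegral_filter_of_dominated_convergence
      (fun g => ENNReal.ofReal (NetworkClass.rootLoop g).re)
      (Eventually.of_forall fun θ => (NetworkClass.measurable_truncLoop θ).ennreal_ofReal)
      (Eventually.of_forall fun θ => ?_) hfin (ae_of_all _ fun g =>
        ENNReal.tendsto_ofReal (NetworkClass.tendsto_truncLoop g))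
    filter_upwards [hpos] with g hg
    exact ENNReal.ofReal_le_ofReal (NetworkClass.truncLoop_le hg)
  refine ((ENNReal.tendsto_toReal hfin).comp h2).congr' ?_
  filter_upwards [eventually_aemeasurable hlim, self_mem_nhdsWithin, hbd] with θ hm hθ hb
  have := hb.1
  exact (integral_truncSpectralMeasure hθ hm hpos
    (integrable_id_of_lintegral_rpow_ne_top hα.le (ne_top_of_le_ne_top hM hb.2))).symm

/-! ### Sign of the loop under an admissible sofic measure. -/

theorem lintegral_uniformRoot {n : ℕ} [NeZero n] (H : Matrix (Fin n) (Fin n) ℂ)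
    (hH : H.IsHermitian) {f : NetworkClass → ℝ≥0∞} (hf : Measurable f) :
    ∫⁻ g, f g ∂(uniformRoot H hH : Measure NetworkClass) =
      (n : ℝ≥0∞)⁻¹ * ∑ v : Fin n, f (NetworkClass.mk ((matrixNetwork H hH).component v)) := by
  rw [uniformRoot, ProbabilityMeasure.coe_mk, lintegral_smul_measure, lintegral_finsetSum_measure]
  simp only [lintegral_dirac' _ hf, smul_eq_mul]

/-- If the diagonal entries are nonnegative, so is the loop at the root. -/
theorem ae_rootLoop_nonneg {Sa : Set ℂ} (h : IsAdmissibleSofic Sa {1} ρ) :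
    ∀ᵐ g ∂(ρ : Measure NetworkClass), 0 ≤ g.rootLoop.re := by
  obtain ⟨H, hH, hadm, hlim⟩ := h
  rw [ProbabilityMeasure.tendsto_iff_forall_lintegral_tendsto] at hlim
  -- The capped negative part of the loop is bounded and continuous for the local topology. Its
  -- integral is zero along the sequence, hence zero in the limit.
  have hcont : Continuous fun g : NetworkClass =>
      (min 1 (-g.rootLoop.re).toNNReal : NNReal) :=
    continuous_const.min (continuous_real_toNNReal.comp
      (Complex.continuous_re.comp NetworkClass.continuous_rootLoop).neg)
  let f : BoundedContinuousFunction NetworkClass NNReal :=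
    BoundedContinuousFunction.mkOfBound ⟨_, hcont⟩ 1 fun x y => by
      rw [NNReal.dist_eq, abs_le]
      have h1 : ∀ z : NNReal, ((min 1 z : NNReal) : ℝ) ≤ 1 := fun z => by
        exact_mod_cast min_le_left _ _
      have h2 := h1 (-x.rootLoop.re).toNNReal
      have h3 := h1 (-y.rootLoop.re).toNNReal
      have h4 := (min 1 (-x.rootLoop.re).toNNReal).coe_nonneg
      have h5 := (min 1 (-y.rootLoop.re).toNNReal).coe_nonneg
      constructor
      · change -1 ≤ ((min 1 (-x.rootLoop.re).toNNReal : NNReal) : ℝ) -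
          ((min 1 (-y.rootLoop.re).toNNReal : NNReal) : ℝ)
        linarith
      · change ((min 1 (-x.rootLoop.re).toNNReal : NNReal) : ℝ) -
          ((min 1 (-y.rootLoop.re).toNNReal : NNReal) : ℝ) ≤ 1
        linarith
  have hmeas : Measurable fun g => (f g : ℝ≥0∞) := f.continuous.measurable.coe_nnreal_ennreal
  have h0 : ∀ m, ∫⁻ g, f g ∂(uniformRoot (H m) (hH m) : Measure NetworkClass) = 0 := by
    intro m
    rw [lintegral_uniformRoot _ _ hmeas, Finset.sum_eq_zero, mul_zero]
    intro v _
    have hloop : (NetworkClass.mk ((matrixNetwork (H m) (hH m)).component v)).rootLoop = H m v v :=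
      rfl
    change (((min 1 (-(NetworkClass.mk ((matrixNetwork (H m) (hH m)).component
      v)).rootLoop.re).toNNReal : NNReal)) : ℝ≥0∞) = 0
    rw [hloop]
    have hre : 0 ≤ (H m v v).re := by
      rcases (hadm m).2 v with h | h
      · rw [h, Complex.zero_re]
      -- Division by zero yields `0 ≠ 1`, so this alternative excludes a zero entry by itself.
      · have hne : (‖H m v v‖ : ℂ) ≠ 0 := by
          intro h0
          rw [h0, div_zero] at h
          exact zero_ne_one h
        rw [Set.mem_singleton_iff, div_eq_one_iff_eq hne] at h
        rw [h, Complex.ofReal_re]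
        exact norm_nonneg _
    rw [Real.toNNReal_of_nonpos (by linarith)]
    simp
  have h1 := hlim f
  simp only [h0] at h1
  have h2 := (lintegral_eq_zero_iff hmeas).1 (tendsto_nhds_unique h1 tendsto_const_nhds)
  filter_upwards [h2] with g hg
  have hg' : ((min 1 (-g.rootLoop.re).toNNReal : NNReal) : ℝ≥0∞) = 0 := hg
  rw [ENNReal.coe_eq_zero] at hg'
  rcases min_eq_iff.1 hg' with h | h
  · exact absurd h.1 one_ne_zero
  · have := Real.toNNReal_eq_zero.1 h.1
    linarith

/-! ### Consequences of a finite cost. -/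

variable {a b : ℝ≥0∞} {Sa : Set ℂ}

theorem lintegral_xi_eq (hα : 0 < α) : ∫⁻ g, g.xi α ∂(ρ : Measure NetworkClass) =
    ∫⁻ g, g.psi α ∂(ρ : Measure NetworkClass) +
      2 * ∫⁻ g, g.phi α ∂(ρ : Measure NetworkClass) := by
  simp only [NetworkClass.xi_eq]
  rw [lintegral_add_left (NetworkClass.measurable_psi α),
    lintegral_const_mul _ (NetworkClass.measurable_phi hα)]

/-- As `a` and `b` are positive, a finite cost controls both parts of `ξ_α`; this puts `ρ` in the
regime where `μ_ρ` is a limit of truncations. -/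
theorem lintegral_xi_ne_top (hα : 0 < α) (ha : 0 < a) (hb : 0 < b)
    (h : b * ∫⁻ g, g.psi α ∂(ρ : Measure NetworkClass) +
      a * ∫⁻ g, g.phi α ∂(ρ : Measure NetworkClass) ≠ ∞) :
    ∫⁻ g, g.xi α ∂(ρ : Measure NetworkClass) ≠ ∞ := by
  rw [lintegral_xi_eq hα]
  obtain ⟨h1, h2⟩ := ENNReal.add_ne_top.1 h
  have h3 : ∫⁻ g, g.psi α ∂(ρ : Measure NetworkClass) ≠ ∞ := fun h0 => by
    rw [h0, ENNReal.mul_top hb.ne'] at h1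
    exact h1 rfl
  have h4 : ∫⁻ g, g.phi α ∂(ρ : Measure NetworkClass) ≠ ∞ := fun h0 => by
    rw [h0, ENNReal.mul_top ha.ne'] at h2
    exact h2 rfl
  finiteness

/-- At finite cost the mean of `ν` would be the mean of a nonnegative loop. -/
theorem ratePhi_eq_top_of_neg (hα : 1 < α) (hα2 : α < 2) (ha : 0 < a) (hb : 0 < b)
    (hν : ∫⁻ x, ENNReal.ofReal x ∂(ν : Measure ℝ) < ∫⁻ x, ENNReal.ofReal (-x) ∂(ν : Measure ℝ)) :
    ratePhi α a b Sa {1} ν = ∞ := by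
  have hα0 := zero_lt_one.trans hα
  refine iInf_eq_top.2 fun ρ => iInf_eq_top.2 fun ⟨hρ, hspec⟩ => ?_
  rw [rateI, if_pos hρ]
  by_contra hI
  obtain ⟨_, hint, hmean⟩ := integral_eq_of_hasSpectralMeasure hα hα2
    (lintegral_xi_ne_top hα0 ha hb hI) (ae_rootLoop_nonneg hρ) hspec
  rw [integral_eq_lintegral_pos_part_sub_lintegral_neg_part hint] at hmean
  have hN : ∫⁻ x, ENNReal.ofReal (-x) ∂(ν : Measure ℝ) < ∞ := hint.neg.lintegral_lt_top
  have h1 := (ENNReal.toReal_lt_toReal (hν.trans hN).ne hN.ne).2 hν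
  have h2 := ENNReal.toReal_nonneg
    (a := ∫⁻ g, ENNReal.ofReal (NetworkClass.rootLoop g).re ∂(ρ : Measure NetworkClass))
  linarith

/-- The mean of `ν` is zero and equals the mean of a nonnegative loop, so loops vanish almost
surely. Then `ξ_α = 2 φ_α` in mean, and the moment inequality gives the factor `a / 2`. -/
theorem le_ratePhi_of_symmetric (hα : 1 < α) (hα2 : α < 2) (ha : 0 < a) (hb : 0 < b)
    (hν : (ν : Measure ℝ).map (fun x => -x) = (ν : Measure ℝ)) :
    a / 2 * absMoment α ν ≤ ratePhi α a b Sa {1} ν := by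
  have hα0 := zero_lt_one.trans hα
  refine le_iInf fun ρ => le_iInf fun ⟨hρ, hspec⟩ => ?_
  rw [rateI, if_pos hρ]
  by_cases hI : b * ∫⁻ g, g.psi α ∂(ρ : Measure NetworkClass) +
      a * ∫⁻ g, g.phi α ∂(ρ : Measure NetworkClass) = ∞
  · rw [hI]
    exact le_top
  have hpos := ae_rootLoop_nonneg hρ
  obtain ⟨hfin, hint, hmean⟩ := integral_eq_of_hasSpectralMeasure hα hα2
    (lintegral_xi_ne_top hα0 ha hb hI) hpos hspec
  have h0 : ∫ x, x ∂(ν : Measure ℝ) = 0 := by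
    have h1 : ∫ x, x ∂(ν : Measure ℝ) = ∫ x, -x ∂(ν : Measure ℝ) := by
      conv_lhs => rw [← hν]
      exact integral_map measurable_neg.aemeasurable (by fun_prop)
    rw [integral_neg] at h1
    linarith
  rw [h0] at hmean
  have h1 : ∫⁻ g, ENNReal.ofReal g.rootLoop.re ∂(ρ : Measure NetworkClass) = 0 :=
    ((ENNReal.toReal_eq_zero_iff _).1 hmean.symm).resolve_right hfin
  have hre : Measurable fun g : NetworkClass => ENNReal.ofReal g.rootLoop.re :=
    (Complex.measurable_re.comp NetworkClass.continuous_rootLoop.measurable).ennreal_ofReal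
  rw [lintegral_eq_zero_iff hre] at h1
  have hpsi : ∫⁻ g, g.psi α ∂(ρ : Measure NetworkClass) = 0 := by
    rw [lintegral_eq_zero_iff (NetworkClass.measurable_psi α)]
    filter_upwards [h1, hpos] with g hg hg0
    have hre : g.rootLoop.re = 0 := le_antisymm (ENNReal.ofReal_eq_zero.1 hg) hg0
    have : g.rootLoop = 0 := Complex.ext hre g.rootLoop_im
    rw [NetworkClass.psi_eq, this]
    simp [hα0.ne']
  have h2 := absMoment_le_lintegral_xi hα0 hα2 hspec
  rw [lintegral_xi_eq hα0, hpsi, zero_add] at h2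
  rw [hpsi, mul_zero, zero_add]
  refine (mul_le_mul_right h2 _).trans_eq ?_
  rw [← mul_assoc, ENNReal.div_mul_cancel two_ne_zero ENNReal.ofNat_ne_top]

end LowerBound

/-! ### Networks with at most two vertices -/

/-- Components are preserved by isolated embeddings. -/
theorem Network.iso_component {M N : Network} (f : M.V → N.V) (hf : Function.Injective f)
    (hω : ∀ u v, N.ω (f u) (f v) = M.ω u v)
    (hiso : ∀ u v, v ∉ Set.range f → N.ω (f u) v = 0) (x : M.V) :
    RootedNetwork.Iso (M.component x) (N.component (f x)) := by
  let F : (M.component x).V → (N.component (f x)).V := fun u =>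
    ⟨f u.1, Network.reachable_map f hω u.2⟩
  have hF : Function.Bijective F := by
    refine ⟨fun u v h => Subtype.ext (hf (congrArg Subtype.val h)), ?_⟩
    -- No edge leaves the range of `f`, so a path started in it lifts step by step.
    have key : ∀ v, N.Reachable (f x) v → ∃ u, M.Reachable x u ∧ f u = v := by
      intro v hv
      unfold Network.Reachable at hv
      induction hv with
      | refl => exact ⟨x, Relation.ReflTransGen.refl, rfl⟩
      | @tail b c _ hbc ih =>
        obtain ⟨u, hu, rfl⟩ := ih
        by_cases hc : c ∈ Set.range f
        · obtain ⟨w, rfl⟩ := hc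
          refine ⟨w, Relation.ReflTransGen.tail hu ?_, rfl⟩
          unfold Network.Adj at *
          rwa [← hω]
        · exact absurd (hiso u c hc) hbc
    rintro ⟨v, hv⟩
    obtain ⟨u, hu, huv⟩ := key v hv
    exact ⟨⟨u, hu⟩, Subtype.ext huv⟩
  exact ⟨Equiv.ofBijective F hF, Subtype.ext rfl, fun u v => hω u.1 v.1⟩

/-- The network on two vertices with a loop of weight `d` at the first vertex, `true`, and an edge
of weight `w` from the first to the second vertex. -/
abbrev pairNetwork (d : ℝ) (w : ℂ) : Network where
  V := Bool
  countable := inferInstance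
  ω := fun u v => match u, v with
    | true, true => d
    | true, false => w
    | false, true => star w
    | false, false => 0
  hermitian := fun u v => by cases u <;> cases v <;> simp
  locallyFinite := fun _ => Summable.of_finite

/-- The component of the first vertex of `pairNetwork`. -/
def pairRooted (d : ℝ) (w : ℂ) : RootedNetwork := (pairNetwork d w).component true

/-- The class of `pairRooted`. -/
def pairClass (d : ℝ) (w : ℂ) : NetworkClass := NetworkClass.mk (pairRooted d w)

theorem exists_fin_step {k : ℕ} (p : Fin (k + 1) → Bool) (h0 : p 0 = true)
    (h1 : p (Fin.last k) = false) : ∃ i : Fin k, p i.castSucc = true ∧ p i.succ = false := by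
  by_contra! h
  have : ∀ i, p i = true := fun i => by
    induction i using Fin.induction with
    | zero => exact h0
    | succ i ih => simpa using h i ih
  rw [this] at h1
  exact Bool.noConfusion h1

/-- A path between the two vertices of `pairNetwork` crosses its edge. -/
theorem le_pathLength_pairNetwork {d : ℝ} {w : ℂ} (N : Network) {k : ℕ}
    (p : Fin (k + 1) → N.V) (f : N.V → Bool) (h0 : f (p 0) = true)
    (h1 : f (p (Fin.last k)) = false)
    (hω : ∀ u v, N.ω u v = (pairNetwork d w).ω (f u) (f v)) :
    ‖w‖⁻¹ ≤ N.pathLength p ∧ ∃ i : Fin k, N.ω (p i.castSucc) (p i.succ) = w := by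
  obtain ⟨i, hi0, hi1⟩ := exists_fin_step (fun i => f (p i)) h0 h1
  have hw : N.ω (p i.castSucc) (p i.succ) = w := by rw [hω, hi0, hi1]
  refine ⟨Real.le_sqrt_of_sq_le ?_, i, hw⟩
  refine le_trans (le_of_eq ?_) (Finset.single_le_sum
    (f := fun i : Fin k => (‖N.ω (p i.castSucc) (p i.succ)‖ ^ 2)⁻¹)
    (fun _ _ => by positivity) (Finset.mem_univ i))
  simp only [hw, inv_pow]

/-- Every path to the second vertex crosses the edge, so the distance is `1 / ‖w‖`. The product form
on the right also covers `w = 0`, where the second vertex is unreachable. -/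
theorem false_mem_ball_iff {d : ℝ} {w : ℂ} {t : ℝ} (ht : 0 < t) :
    (∃ h : (pairNetwork d w).Reachable true false,
      (⟨false, h⟩ : (pairRooted d w).V) ∈ (pairRooted d w).ball t) ↔ 1 ≤ t * ‖w‖ := by
  constructor
  · rintro ⟨h, hb⟩
    have hpos : 0 < ‖w‖ := by
      obtain ⟨k, p, hp⟩ := (pairNetwork d w).exists_isPath h
      obtain ⟨i, hi⟩ := (le_pathLength_pairNetwork (d := d) (w := w) (pairNetwork d w) p id
        hp.1 hp.2.1 fun _ _ => rfl).2
      have := hp.2.2 i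
      unfold Network.Adj at this
      rw [hi] at this
      exact norm_pos_iff.2 this
    have h1 : ENNReal.ofReal ‖w‖⁻¹ ≤
        (pairRooted d w).dist (pairRooted d w).root ⟨false, h⟩ := by
      refine le_iInf fun k => le_iInf fun p => le_iInf fun hp => ENNReal.ofReal_le_ofReal ?_
      refine (le_pathLength_pairNetwork (d := d) (w := w) (pairRooted d w).toNetwork p
        (fun u => u.1) ?_ ?_ fun _ _ => rfl).1
      · rw [hp.1]; rfl
      · rw [hp.2.1]
    have h2 := h1.trans hb
    rw [ENNReal.ofReal_le_ofReal_iff ht.le, inv_le_iff_one_le_mul₀ hpos] at h2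
    exact h2
  · intro h
    have hpos : 0 < ‖w‖ := by
      by_contra h0
      have : ‖w‖ = 0 := le_antisymm (not_lt.1 h0) (norm_nonneg _)
      rw [this, mul_zero] at h
      linarith
    have hadj : (pairNetwork d w).Adj true false := norm_pos_iff.1 hpos
    have hr : (pairNetwork d w).Reachable true false := Relation.ReflTransGen.single hadj
    refine ⟨hr, ?_⟩
    let p : Fin (1 + 1) → (pairRooted d w).V := ![(pairRooted d w).root, ⟨false, hr⟩]
    have hp : (pairRooted d w).IsPath (pairRooted d w).root ⟨false, hr⟩ p := by
      refine ⟨rfl, rfl, fun i => ?_⟩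
      fin_cases i
      exact hadj
    have hlen : (pairRooted d w).pathLength p = ‖w‖⁻¹ := by
      unfold Network.pathLength
      rw [Fin.sum_univ_one]
      change Real.sqrt ((‖w‖ ^ 2)⁻¹) = _
      rw [Real.sqrt_inv, Real.sqrt_sq (norm_nonneg _)]
    have hd : (pairRooted d w).dist (pairRooted d w).root ⟨false, hr⟩ ≤
        ENNReal.ofReal ((pairRooted d w).pathLength p) :=
      iInf_le_of_le 1 (iInf_le_of_le p (iInf_le_of_le hp le_rfl))
    refine hd.trans ?_
    rw [hlen]
    refine ENNReal.ofReal_le_ofReal ?_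
    rwa [inv_le_iff_one_le_mul₀ hpos]

/-- A bijection between the balls needs equally many vertices, which is the role of `hiff`. -/
theorem closeAt_pairRooted {d d' : ℝ} {w w' : ℂ} {t : ℝ} (ht : 0 < t)
    (hiff : 1 ≤ t * ‖w‖ ↔ 1 ≤ t * ‖w'‖) (hd : |d - d'| ≤ 1 / t) (hw : ‖w - w'‖ ≤ 1 / t) :
    RootedNetwork.CloseAt (pairRooted d w) (pairRooted d' w') t := by
  have key : ∀ {d d' : ℝ} {w w' : ℂ}, (1 ≤ t * ‖w‖ → 1 ≤ t * ‖w'‖) →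
      ∀ u : (pairRooted d w).ball t, ∃ u' : (pairRooted d' w').ball t, u'.1.1 = u.1.1 := by
    rintro d d' w w' himp ⟨⟨u, hu⟩, hb⟩
    cases u
    · obtain ⟨h1, h2⟩ := (false_mem_ball_iff (d := d') ht).2
        (himp ((false_mem_ball_iff (d := d) ht).1 ⟨hu, hb⟩))
      exact ⟨⟨_, h2⟩, rfl⟩
    · exact ⟨⟨(pairRooted d' w').root, (pairRooted d' w').root_mem_ball t⟩, rfl⟩
  choose F hF using key (d := d) (d' := d') hiff.1
  choose F' hF' using key (d := d') (d' := d) hiff.2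
  refine ⟨⟨F, F', fun u => Subtype.ext (Subtype.ext ((hF' _).trans (hF u))),
    fun u => Subtype.ext (Subtype.ext ((hF _).trans (hF' u)))⟩,
    Subtype.ext (Subtype.ext (hF _)), fun u v => ?_⟩
  change ‖(pairNetwork d w).ω u.1.1 v.1.1 - (pairNetwork d' w').ω (F u).1.1 (F v).1.1‖ ≤ 1 / t
  rw [hF, hF]
  rcases u.1.1 with _ | _ <;> rcases v.1.1 with _ | _
  · simpa using ht.le
  · change ‖star w - star w'‖ ≤ 1 / t
    rwa [← star_sub, norm_star]
  · exact hw
  · change ‖(d : ℂ) - (d' : ℂ)‖ ≤ 1 / t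
    rwa [← Complex.ofReal_sub, Complex.norm_real]

/-- One large radius `t` makes `dloc` small. It is chosen with `t * ‖w‖` either `0` or greater than
`1`, so that the vertex set of the ball is locally constant in the weights, even where an edge
degenerates at `w = 0`. -/
theorem continuous_pairClass : Continuous fun x : ℝ × ℂ => pairClass x.1 x.2 := by
  refine continuous_def.2 fun U hU => isOpen_iff_mem_nhds.2 fun ⟨d, w⟩ hdw => ?_
  obtain ⟨ε, hε, hball⟩ := hU _ hdw
  have h1 : Tendsto (fun t : ℝ => (1 + ENNReal.ofReal t)⁻¹) atTop (𝓝 0) := by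
    have := tendsto_inv_iff.2 (tendsto_const_nhds (x := (1 : ℝ≥0∞)) |>.add
      (ENNReal.tendsto_ofReal_atTop))
    simpa using this
  have h2 : ∀ᶠ t : ℝ in atTop, w = 0 ∨ 1 < t * ‖w‖ := by
    by_cases hw : w = 0
    · exact Eventually.of_forall fun _ => Or.inl hw
    · exact ((tendsto_id.atTop_mul_const (norm_pos_iff.2 hw)).eventually_gt_atTop 1).mono
        fun t ht => Or.inr ht
  obtain ⟨t, htε, htw, ht⟩ :=
    ((h1.eventually (gt_mem_nhds hε)).and (h2.and (eventually_gt_atTop 0))).exists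
  have h3 : ∀ᶠ x : ℝ × ℂ in 𝓝 (d, w), |d - x.1| < 1 / t := by
    have hc : Continuous fun x : ℝ × ℂ => |d - x.1| := by fun_prop
    exact (hc.tendsto (d, w)).eventually (gt_mem_nhds (by simpa using ht))
  have h4 : ∀ᶠ x : ℝ × ℂ in 𝓝 (d, w), ‖w - x.2‖ < 1 / t := by
    have hc : Continuous fun x : ℝ × ℂ => ‖w - x.2‖ := by fun_prop
    exact (hc.tendsto (d, w)).eventually (gt_mem_nhds (by simpa using ht))
  have hc : Continuous fun x : ℝ × ℂ => t * ‖x.2‖ := by fun_prop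
  have h5 : ∀ᶠ x : ℝ × ℂ in 𝓝 (d, w), (1 ≤ t * ‖w‖ ↔ 1 ≤ t * ‖x.2‖) := by
    rcases htw with hw | hw
    · have h6 : t * ‖w‖ < 1 := by simp [hw]
      filter_upwards [(hc.tendsto (d, w)).eventually (gt_mem_nhds h6)] with x hx
      exact ⟨fun h => absurd h (not_le.2 h6), fun h => absurd h (not_le.2 hx)⟩
    · filter_upwards [(hc.tendsto (d, w)).eventually (lt_mem_nhds hw)] with x hx
      exact ⟨fun _ => hx.le, fun _ => hw.le⟩
  filter_upwards [h3, h4, h5] with x hx3 hx4 hx5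
  refine hball _ (lt_of_le_of_lt ?_ htε)
  refine ENNReal.inv_le_inv.2 (add_le_add_right ?_ 1)
  exact le_iSup₂_of_le t ⟨ht, closeAt_pairRooted ht hx5 hx3.le hx4.le⟩ le_rfl

/-! ### Loops and edges -/

/-- The root is the only vertex. -/
def RootedNetwork.IsLoop (G : RootedNetwork) : Prop := ∀ v, v = G.root

/-- There are no loops and at most one vertex besides the root. -/
def RootedNetwork.IsEdge (G : RootedNetwork) : Prop :=
  (∀ v, G.ω v v = 0) ∧ ∀ u v, u ≠ G.root → v ≠ G.root → u = v

namespace RootedNetwork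

theorem IsLoop.congr {G H : RootedNetwork} (h : Iso G H) (hG : G.IsLoop) : H.IsLoop := by
  obtain ⟨σ, h0, _⟩ := h
  intro v
  rw [← σ.apply_symm_apply v, hG (σ.symm v), h0]

theorem IsEdge.congr {G H : RootedNetwork} (h : Iso G H) (hG : G.IsEdge) : H.IsEdge := by
  obtain ⟨σ, h0, h1⟩ := h
  have hne : ∀ v, v ≠ H.root → σ.symm v ≠ G.root := fun v hv h => hv (by
    rw [← h0, ← h, σ.apply_symm_apply])
  refine ⟨fun v => ?_, fun u v hu hv => σ.symm.injective (hG.2 _ _ (hne u hu) (hne v hv))⟩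
  rw [← σ.apply_symm_apply v, h1]
  exact hG.1 _

theorem eventually_not_isLoop {G : RootedNetwork} (hG : ¬ G.IsLoop) :
    ∀ᶠ t : ℝ in atTop, ∀ H, CloseAt G H t → ¬ H.IsLoop := by
  unfold IsLoop at hG
  push Not at hG
  obtain ⟨v, hv⟩ := hG
  filter_upwards [G.eventually_mem_ball v] with t ht H ⟨σ, h0, _⟩ hH
  have h1 : σ ⟨v, ht⟩ = σ ⟨G.root, G.root_mem_ball t⟩ := by
    rw [h0]
    exact Subtype.ext (hH _)
  exact hv (congrArg (fun x : G.ball t => x.1) (σ.injective h1))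

/-- The failure is witnessed by a nonzero loop or by two further vertices; either witness sits in a
large ball and is seen by every close network. -/
theorem eventually_not_isEdge {G : RootedNetwork} (hG : ¬ G.IsEdge) :
    ∀ᶠ t : ℝ in atTop, ∀ H, CloseAt G H t → ¬ H.IsEdge := by
  unfold IsEdge at hG
  rw [not_and_or] at hG
  push Not at hG
  rcases hG with ⟨v, hv⟩ | ⟨u, v, hu, hv, huv⟩
  · have h1 : Tendsto (fun t : ℝ => 1 / t) atTop (𝓝 0) := by
      simpa using tendsto_inv_atTop_zero (𝕜 := ℝ)
    filter_upwards [G.eventually_mem_ball v, h1.eventually (gt_mem_nhds (norm_pos_iff.2 hv))]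
      with t ht htv H ⟨σ, _, hσ⟩ hH
    have h2 := hσ ⟨v, ht⟩ ⟨v, ht⟩
    rw [hH.1, sub_zero] at h2
    exact absurd h2 (not_le.2 htv)
  · filter_upwards [G.eventually_mem_ball u, G.eventually_mem_ball v] with t htu htv H ⟨σ, h0, _⟩ hH
    have hne : ∀ x (hx : x ∈ G.ball t), x ≠ G.root → (σ ⟨x, hx⟩).1 ≠ H.root := by
      intro x hx hxo h
      have h1 : σ ⟨x, hx⟩ = σ ⟨G.root, G.root_mem_ball t⟩ := by
        rw [h0]
        exact Subtype.ext h
      exact hxo (congrArg (fun x : G.ball t => x.1) (σ.injective h1))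
    have h2 := hH.2 _ _ (hne u htu hu) (hne v htv hv)
    exact huv (congrArg (fun x : G.ball t => x.1) (σ.injective (Subtype.ext h2)))

end RootedNetwork

namespace NetworkClass

/-- The root is the only vertex. -/
def IsLoop (g : NetworkClass) : Prop :=
  Quotient.liftOn g RootedNetwork.IsLoop
    fun _ _ h => propext ⟨fun hG => hG.congr h, fun hG => hG.congr h.symm⟩

/-- There are no loops and at most one vertex besides the root. -/
def IsEdge (g : NetworkClass) : Prop :=
  Quotient.liftOn g RootedNetwork.IsEdge
    fun _ _ h => propext ⟨fun hG => hG.congr h, fun hG => hG.congr h.symm⟩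

theorem measurableSet_isLoop : MeasurableSet {g : NetworkClass | g.IsLoop} :=
  MeasurableSet.of_compl <| measurableSet_of_closeAt (p := fun G => ¬ G.IsLoop)
    (fun _ => Iff.rfl) fun _ hG => RootedNetwork.eventually_not_isLoop hG

theorem measurableSet_isEdge : MeasurableSet {g : NetworkClass | g.IsEdge} :=
  MeasurableSet.of_compl <| measurableSet_of_closeAt (p := fun G => ¬ G.IsEdge)
    (fun _ => Iff.rfl) fun _ hG => RootedNetwork.eventually_not_isEdge hG

end NetworkClass

theorem isEdge_pairClass (w : ℂ) : (pairClass 0 w).IsEdge := by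
  refine ⟨fun v => ?_, fun u v hu hv => ?_⟩
  · change (pairNetwork 0 w).ω v.1 v.1 = 0
    rcases v.1 with _ | _ <;> simp
  · have hne : ∀ u : (pairRooted 0 w).V, u ≠ (pairRooted 0 w).root → u.1 = false := fun u hu => by
      by_contra h
      exact hu (Subtype.ext ((Bool.not_eq_false _).mp h))
    exact Subtype.ext ((hne u hu).trans (hne v hv).symm)

theorem isLoop_pairClass (d : ℝ) : (pairClass d 0).IsLoop := by
  rintro ⟨v, hv⟩
  cases v
  · obtain ⟨k, p, hp⟩ := (pairNetwork d 0).exists_isPath hv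
    obtain ⟨i, hi⟩ := (le_pathLength_pairNetwork (d := d) (w := 0) (pairNetwork d 0) p id
      hp.1 hp.2.1 fun _ _ => rfl).2
    exact absurd hi (hp.2.2 i)
  · rfl

theorem rootLoop_pairClass (d : ℝ) (w : ℂ) : (pairClass d w).rootLoop = d := rfl

theorem xi_two_pairClass (w : ℂ) : ((pairClass 0 w).xi 2).toReal = ‖w‖ ^ 2 := by
  change ((pairRooted 0 w).xi 2).toReal = _
  rw [← RootedNetwork.deg_eq_xi]
  refine (Network.deg_component (pairNetwork 0 w) true _).trans ?_
  change ∑' u : Bool, ‖(pairNetwork 0 w).ω true u‖ ^ 2 = _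
  rw [tsum_fintype, Fintype.sum_bool]
  simp

theorem psi_pairClass (α d : ℝ) (w : ℂ) : (pairClass d w).psi α = ENNReal.ofReal (|d| ^ α) := by
  rw [NetworkClass.psi_eq, rootLoop_pairClass, Complex.norm_real, Real.norm_eq_abs]

theorem phi_pairClass_loop (α d : ℝ) : (pairClass d 0).phi α = 0 := by
  change 2⁻¹ * ∑' v : {v : (pairRooted d 0).V // v ≠ (pairRooted d 0).root}, _ = _
  have : IsEmpty {v : (pairRooted d 0).V // v ≠ (pairRooted d 0).root} :=
    ⟨fun v => v.2 (isLoop_pairClass d v.1)⟩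
  rw [tsum_empty, mul_zero]

/-- An inequality suffices, as `φ_α` of an edge only enters upper bounds; it spares the case `w =
0`, where the second vertex disappears. -/
theorem phi_pairClass_le {α : ℝ} (hα : 0 < α) (w : ℂ) :
    (pairClass 0 w).phi α ≤ 2⁻¹ * ENNReal.ofReal (‖w‖ ^ α) := by
  change 2⁻¹ * ∑' v : {v : (pairRooted 0 w).V // v ≠ (pairRooted 0 w).root},
    ENNReal.ofReal (‖(pairNetwork 0 w).ω true v.1.1‖ ^ α) ≤ _
  refine mul_le_mul_right ((ENNReal.tsum_comp_le_tsum_of_injective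
    (f := fun v : {v : (pairRooted 0 w).V // v ≠ (pairRooted 0 w).root} => v.1.1)
    (fun u v h => Subtype.ext (Subtype.ext h))
    fun x : Bool => ENNReal.ofReal (‖(pairNetwork 0 w).ω true x‖ ^ α)).trans ?_) _
  rw [tsum_fintype, Fintype.sum_bool]
  simp [hα.ne']

/-! ### Measures determined by few moments -/

/-- The variance is zero. -/
theorem eq_dirac_of_moments {μ : Measure ℝ} [IsProbabilityMeasure μ] {y : ℝ}
    (h1 : Integrable (fun x => x) μ) (h2 : Integrable (fun x => x ^ 2) μ)
    (m1 : ∫ x, x ∂μ = y) (m2 : ∫ x, x ^ 2 ∂μ = y ^ 2) : μ = Measure.dirac y := by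
  have h0 : ∫ x, (x - y) ^ 2 ∂μ = 0 := by
    have : ∀ x : ℝ, (x - y) ^ 2 = x ^ 2 - 2 * y * x + y ^ 2 := fun x => by ring
    simp only [this]
    have hs : Integrable (fun x => x ^ 2 - 2 * y * x) μ := h2.sub (h1.const_mul _)
    rw [integral_add hs (integrable_const _),
      integral_sub h2 (h1.const_mul _), integral_const_mul, m1, m2]
    simp
    ring
  have hi : Integrable (fun x => (x - y) ^ 2) μ := by
    have : (fun x : ℝ => (x - y) ^ 2) = fun x => x ^ 2 - 2 * y * x + y ^ 2 := by ext x; ring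
    rw [this]
    exact (h2.sub (h1.const_mul _)).add (integrable_const _)
  rw [integral_eq_zero_iff_of_nonneg (fun x => sq_nonneg _) hi] at h0
  have h3 : (fun x : ℝ => x) =ᵐ[μ] fun _ => y := by
    filter_upwards [h0] with x hx
    have : (x - y) ^ 2 = 0 := hx
    have := pow_eq_zero_iff (two_ne_zero) |>.1 this
    linarith
  calc μ = μ.map (fun x => x) := Measure.map_id.symm
    _ = μ.map fun _ => y := Measure.map_congr h3
    _ = Measure.dirac y := by rw [Measure.map_const, measure_univ, one_smul]

/-- The moments give `∫ (x² - y²)² = 0`, so `μ` lives on `{y, -y}`; the zero mean makes the two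
weights equal. -/
theorem eq_average_dirac_of_moments {μ : Measure ℝ} [IsProbabilityMeasure μ] {y : ℝ}
    (h1 : Integrable (fun x => x) μ) (h2 : Integrable (fun x => x ^ 2) μ)
    (h4 : Integrable (fun x => x ^ 4) μ) (m1 : ∫ x, x ∂μ = 0) (m2 : ∫ x, x ^ 2 ∂μ = y ^ 2)
    (m4 : ∫ x, x ^ 4 ∂μ = y ^ 4) :
    μ = (2⁻¹ : ℝ≥0∞) • Measure.dirac y + (2⁻¹ : ℝ≥0∞) • Measure.dirac (-y) := by
  have hexp : (fun x : ℝ => (x ^ 2 - y ^ 2) ^ 2) = fun x => x ^ 4 - 2 * y ^ 2 * x ^ 2 + y ^ 4 := by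
    ext x; ring
  have hi : Integrable (fun x => (x ^ 2 - y ^ 2) ^ 2) μ := by
    rw [hexp]
    exact (h4.sub (h2.const_mul _)).add (integrable_const _)
  have h0 : ∫ x, (x ^ 2 - y ^ 2) ^ 2 ∂μ = 0 := by
    have hs : Integrable (fun x => x ^ 4 - 2 * y ^ 2 * x ^ 2) μ := h4.sub (h2.const_mul _)
    rw [hexp, integral_add hs (integrable_const _),
      integral_sub h4 (h2.const_mul _), integral_const_mul, m2, m4]
    simp
    ring
  rw [integral_eq_zero_iff_of_nonneg (fun x => sq_nonneg _) hi] at h0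
  have h3 : ∀ᵐ x ∂μ, x = y ∨ x = -y := by
    filter_upwards [h0] with x hx
    have : (x ^ 2 - y ^ 2) ^ 2 = 0 := hx
    have := pow_eq_zero_iff (two_ne_zero) |>.1 this
    exact sq_eq_sq_iff_eq_or_eq_neg.1 (by linarith)
  have key : ∀ f : ℝ → ℝ, ∫ x, f x ∂μ = (f y + f (-y)) / 2 := by
    intro f
    -- On two points any function is affine, so its integral only depends on the mean. For `y = 0`
    -- the slope is `0` by convention and the formula still holds.
    have h5 : f =ᵐ[μ] fun x => (f y + f (-y)) / 2 + (f y - f (-y)) / (2 * y) * x := by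
      filter_upwards [h3] with x hx
      rcases eq_or_ne y 0 with rfl | hy
      · rcases hx with rfl | rfl <;> simp
      · rcases hx with rfl | rfl <;> field_simp <;> ring
    rw [integral_congr_ae h5, integral_add (integrable_const _) (h1.const_mul _),
      integral_const_mul, m1]
    simp
  refine Measure.ext fun s hs => ?_
  have h6 := key (s.indicator 1)
  rw [integral_indicator_one hs, measureReal_def] at h6
  rw [← ENNReal.ofReal_toReal (measure_ne_top μ s), h6]
  simp only [Measure.add_apply, Measure.smul_apply, smul_eq_mul, Measure.dirac_apply' _ hs]
  by_cases ha : y ∈ s <;> by_cases hb : -y ∈ s <;> simp [ha, hb, ENNReal.inv_two_add_inv_two]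

/-! ### Spectral measures of loops and edges -/

theorem RootedNetwork.IsLoop.trunc {G : RootedNetwork} (hG : G.IsLoop) (θ : ℝ) :
    (G.trunc θ).IsLoop := fun v => Subtype.ext (hG v.1)

theorem RootedNetwork.IsEdge.trunc {G : RootedNetwork} (hG : G.IsEdge) (θ : ℝ) :
    (G.trunc θ).IsEdge := by
  refine ⟨fun v => ?_, fun u v hu hv => Subtype.ext
    (hG.2 u.1 v.1 (fun h => hu (Subtype.ext h)) fun h => hv (Subtype.ext h))⟩
  exact mul_eq_zero_of_left (mul_eq_zero_of_left (hG.1 v.1) _) _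

namespace NetworkClass

variable {θ : ℝ}

theorem IsLoop.spectralMeasure_trunc {g : NetworkClass} (hg : g.IsLoop) (hθ : 0 < θ) :
    (g.trunc θ).spectralMeasure = Measure.dirac (g.truncLoop θ) := by
  obtain ⟨G, hG, h⟩ := exists_isSpectralMeasure_trunc hθ g
  have hprob := h.1
  obtain ⟨i1, m1⟩ := integral_trunc hθ g
  obtain ⟨i2, m2⟩ := h.integral_sq
  have hl : G.IsLoop := by
    induction g using Quotient.inductionOn with | _ G₀ => ?_
    exact RootedNetwork.IsLoop.congr (RootedNetwork.Iso.symm (Quotient.exact hG))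
      (RootedNetwork.IsLoop.trunc hg θ)
  have hω : G.ω G.root G.root = g.truncLoop θ := by
    rw [← rootLoop_trunc, ← hG]
    rfl
  refine eq_dirac_of_moments i1 i2 m1 (m2.trans ?_)
  rw [Network.deg, tsum_eq_single G.root fun v hv => absurd (hl v) hv, hω, Complex.norm_real,
    Real.norm_eq_abs, sq_abs]

/-- The truncated modulus of the edge at the root. -/
def truncEdge (θ : ℝ) (g : NetworkClass) : ℝ :=
  √(g.xi 2).toReal * chiTilde θ (g.xi 2).toReal * chi θ (√(g.xi 2).toReal * chiTilde θ (g.xi 2).toReal)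

theorem measurable_truncEdge (θ : ℝ) : Measurable (truncEdge θ) := by
  have h1 : Measurable (xi 2) := measurable_xi two_pos
  unfold truncEdge chi chiTilde
  fun_prop

theorem tendsto_truncEdge (g : NetworkClass) :
    Tendsto (fun θ => truncEdge θ g) (𝓝[>] 0) (𝓝 √(g.xi 2).toReal) := by
  refine Tendsto.congr' ?_ tendsto_const_nhds
  rcases eq_or_ne √(g.xi 2).toReal 0 with h | h
  · filter_upwards with θ
    simp [truncEdge, h]
  · filter_upwards [eventually_chiTilde_eq_one (g.xi 2).toReal,
      eventually_chi_eq_one ((Real.sqrt_nonneg _).lt_of_ne' h)] with θ h1 h2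
    simp [truncEdge, h1, h2]

/-- Both endpoints of an edge have degree `‖w‖²`, so the degree cutoff and the modulus are functions
of the degree of the root alone. -/
theorem deg_trunc_of_isEdge {G : RootedNetwork} (hG : G.IsEdge) :
    (G.trunc θ).deg (G.trunc θ).root = truncEdge θ (mk G) ^ 2 := by
  refine (Network.deg_component (G.toNetwork.trunc θ) G.root _).trans ?_
  have hxi : ((mk G).xi 2).toReal = G.deg G.root := G.deg_eq_xi.symm
  rw [truncEdge, hxi]
  change ∑' v : G.V, ‖(G.toNetwork.trunc θ).ω G.root v‖ ^ 2 = _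
  simp only [Network.norm_trunc_ω]
  by_cases h : ∃ v, v ≠ G.root
  · obtain ⟨v, hv⟩ := h
    have hdeg : ∀ u w, u ≠ w → (∀ x, x ≠ u → x ≠ w → False) → G.deg u = ‖G.ω u w‖ ^ 2 := by
      intro u w huw hx
      rw [Network.deg, tsum_eq_single w]
      intro x hxw
      have : x = u := by
        by_contra hxu
        exact hx x hxu hxw
      rw [this, hG.1]
      simp
    have hroot := hdeg G.root v hv.symm fun x h1 h2 => h2 (hG.2 x v h1 hv)
    have hv' := hdeg v G.root hv fun x h1 h2 => h1 (hG.2 x v h2 hv)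
    rw [G.hermitian, norm_star] at hv'
    rw [tsum_eq_single v, hroot, hv', max_self, Real.sqrt_sq (norm_nonneg _)]
    intro x hxv
    have : x = G.root := by
      by_contra hx
      exact hxv (hG.2 x v hx hv)
    rw [this, hG.1]
    simp
  · push Not at h
    have hz : ∀ v, G.ω G.root v = 0 := fun v => by rw [h v, hG.1]
    have : G.deg G.root = 0 := by simp [Network.deg, hz]
    simp [hz, this]

/-- Without loops, a two-step walk from the root returns to it, so `T² e_o` is a multiple of `e_o`.
This yields the moments of order `1`, `2` and `4` that pin down two symmetric atoms. -/
theorem IsEdge.spectralMeasure_trunc {g : NetworkClass} (hg : g.IsEdge) (hθ : 0 < θ) :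
    (g.trunc θ).spectralMeasure = (2⁻¹ : ℝ≥0∞) • Measure.dirac (g.truncEdge θ) +
      (2⁻¹ : ℝ≥0∞) • Measure.dirac (-g.truncEdge θ) := by
  obtain ⟨G, hG, h⟩ := exists_isSpectralMeasure_trunc hθ g
  have hprob := h.1
  have hl : G.IsEdge ∧ G.deg G.root = g.truncEdge θ ^ 2 := by
    induction g using Quotient.inductionOn with | _ G₀ => ?_
    have hiso := Quotient.exact hG
    refine ⟨RootedNetwork.IsEdge.congr (RootedNetwork.Iso.symm hiso)
      (RootedNetwork.IsEdge.trunc hg θ), ?_⟩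
    rw [RootedNetwork.deg_congr hiso]
    exact deg_trunc_of_isEdge hg
  obtain ⟨hE, hdeg⟩ := hl
  obtain ⟨i1, m1⟩ := h.integral_id
  obtain ⟨i2, m2⟩ := h.integral_sq
  obtain ⟨_, T, hT, hk⟩ := h
  have hT2 : T (T (basisVec G.root)) = ((g.truncEdge θ ^ 2 : ℝ) : ℂ) • basisVec G.root := by
    ext u
    rw [lp.coeFn_smul, Pi.smul_apply, smul_eq_mul]
    by_cases hu : u = G.root
    · rw [hu, basisVec_apply_self, mul_one, ← hdeg, ← m2, (hk 2).2, pow_two,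
        mul_apply_eq_comp, inner_basisVec]
    · rw [basisVec_apply_ne hu, mul_zero]
      refine (hT.hasSum (T (basisVec G.root)) u).unique ?_
      refine hasSum_zero.congr_fun fun v => ?_
      rw [hT]
      by_cases hv : v = G.root
      · rw [hv, hE.1, zero_mul]
      · rw [hE.2 v u hv hu, hE.1, mul_zero]
  refine eq_average_dirac_of_moments i1 i2 (hk 4).1 (Complex.ofReal_injective ?_)
    (m2.trans hdeg) (Complex.ofReal_injective ?_)
  · rw [m1, hE.1, Complex.ofReal_zero]
  · have h4 : (T ^ 4) (basisVec G.root) = T (T (T (T (basisVec G.root)))) := rfl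
    rw [(hk 4).2, h4, hT2, map_smul, map_smul, hT2, inner_smul_right, inner_smul_right,
      inner_basisVec, basisVec_apply_self]
    push_cast
    ring

end NetworkClass

/-! ### Mixtures of two images of a law on the line -/

theorem integral_half_add_half {X : Type*} [MeasurableSpace X] {μ₁ μ₂ : Measure X} {f : X → ℝ}
    (h₁ : Integrable f μ₁) (h₂ : Integrable f μ₂) :
    ∫ x, f x ∂((2⁻¹ : ℝ≥0∞) • μ₁ + (2⁻¹ : ℝ≥0∞) • μ₂) =
      (∫ x, f x ∂μ₁ + ∫ x, f x ∂μ₂) / 2 := by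
  rw [integral_add_measure (h₁.smul_measure (by simp)) (h₂.smul_measure (by simp)),
    integral_smul_measure, integral_smul_measure]
  simp
  ring

/-- The law of the class `F₁ x` or `F₂ x`, each with probability one half, where `x` has law
`ν`. -/
def mixLaw (ν : ProbabilityMeasure ℝ) (F₁ F₂ : C(ℝ, NetworkClass)) :
    ProbabilityMeasure NetworkClass :=
  ⟨(2⁻¹ : ℝ≥0∞) • (ν : Measure ℝ).map F₁ + (2⁻¹ : ℝ≥0∞) • (ν : Measure ℝ).map F₂, by
    have h1 := Measure.isProbabilityMeasure_map (μ := (ν : Measure ℝ))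
      F₁.continuous.measurable.aemeasurable
    have h2 := Measure.isProbabilityMeasure_map (μ := (ν : Measure ℝ))
      F₂.continuous.measurable.aemeasurable
    exact ⟨by simp [ENNReal.inv_two_add_inv_two]⟩⟩

section MixLaw

variable (ν : ProbabilityMeasure ℝ) (F₁ F₂ : C(ℝ, NetworkClass))

theorem mixLaw_coe : (mixLaw ν F₁ F₂ : Measure NetworkClass) =
    (2⁻¹ : ℝ≥0∞) • (ν : Measure ℝ).map F₁ + (2⁻¹ : ℝ≥0∞) • (ν : Measure ℝ).map F₂ := rfl

theorem lintegral_mixLaw {f : NetworkClass → ℝ≥0∞} (hf : Measurable f) :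
    ∫⁻ g, f g ∂(mixLaw ν F₁ F₂ : Measure NetworkClass) =
      2⁻¹ * ∫⁻ x, f (F₁ x) ∂(ν : Measure ℝ) + 2⁻¹ * ∫⁻ x, f (F₂ x) ∂(ν : Measure ℝ) := by
  rw [mixLaw_coe, lintegral_add_measure, lintegral_smul_measure, lintegral_smul_measure,
    lintegral_map hf F₁.continuous.measurable, lintegral_map hf F₂.continuous.measurable,
    smul_eq_mul, smul_eq_mul]

theorem integral_mixLaw {f : NetworkClass → ℝ} (hf : Measurable f) {C : ℝ}
    (hC : ∀ g, |f g| ≤ C) :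
    ∫ g, f g ∂(mixLaw ν F₁ F₂ : Measure NetworkClass) =
      (∫ x, f (F₁ x) ∂(ν : Measure ℝ) + ∫ x, f (F₂ x) ∂(ν : Measure ℝ)) / 2 := by
  have h1 := Measure.isProbabilityMeasure_map (μ := (ν : Measure ℝ))
    F₁.continuous.measurable.aemeasurable
  have h2 := Measure.isProbabilityMeasure_map (μ := (ν : Measure ℝ))
    F₂.continuous.measurable.aemeasurable
  rw [mixLaw_coe, integral_half_add_half
    (Integrable.of_bound hf.aestronglyMeasurable C (ae_of_all _ hC))
    (Integrable.of_bound hf.aestronglyMeasurable C (ae_of_all _ hC)),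
    integral_map F₁.continuous.measurable.aemeasurable hf.aestronglyMeasurable,
    integral_map F₂.continuous.measurable.aemeasurable hf.aestronglyMeasurable]

theorem ae_mixLaw {p : NetworkClass → Prop} (hp : MeasurableSet {g | p g}) (h₁ : ∀ x, p (F₁ x))
    (h₂ : ∀ x, p (F₂ x)) : ∀ᵐ g ∂(mixLaw ν F₁ F₂ : Measure NetworkClass), p g := by
  rw [mixLaw_coe, ae_add_measure_iff]
  exact ⟨Measure.ae_smul_measure ((ae_map_iff F₁.continuous.measurable.aemeasurable hp).2
      (ae_of_all _ h₁)) _,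
    Measure.ae_smul_measure ((ae_map_iff F₂.continuous.measurable.aemeasurable hp).2
      (ae_of_all _ h₂)) _⟩

end MixLaw

/-- Convergence of `μ_{ρ_θ}` when the spectral measures at the root have two equal atoms. -/
theorem tendsto_integral_truncSpectralMeasure {ρ : ProbabilityMeasure NetworkClass}
    {A B : ℝ → NetworkClass → ℝ} {A₀ B₀ : NetworkClass → ℝ} (hA : ∀ θ, Measurable (A θ))
    (hB : ∀ θ, Measurable (B θ))
    (hκ : ∀ θ, 0 < θ → ∀ᵐ g ∂(ρ : Measure NetworkClass), (g.trunc θ).spectralMeasure =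
      (2⁻¹ : ℝ≥0∞) • Measure.dirac (A θ g) + (2⁻¹ : ℝ≥0∞) • Measure.dirac (B θ g))
    (hA₀ : ∀ g, Tendsto (fun θ => A θ g) (𝓝[>] 0) (𝓝 (A₀ g)))
    (hB₀ : ∀ g, Tendsto (fun θ => B θ g) (𝓝[>] 0) (𝓝 (B₀ g))) (f : ℝ →ᵇ ℝ) :
    Tendsto (fun θ => ∫ x, f x ∂(truncSpectralMeasure ρ θ)) (𝓝[>] 0)
      (𝓝 (∫ g, (f (A₀ g) + f (B₀ g)) / 2 ∂(ρ : Measure NetworkClass))) := by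
  have hbind : ∀ θ, 0 < θ → truncSpectralMeasure ρ θ =
      (2⁻¹ : ℝ≥0∞) • (ρ : Measure NetworkClass).map (A θ) +
        (2⁻¹ : ℝ≥0∞) • (ρ : Measure NetworkClass).map (B θ) := by
    intro θ hθ
    have hms : ∀ (D : NetworkClass → ℝ), Measurable D → ∀ s : Set ℝ, MeasurableSet s →
        Measurable fun g => Measure.dirac (D g) s := fun D hD s hs =>
      (Measure.measurable_coe hs).comp (Measure.measurable_dirac.comp hD)
    have hm : Measurable fun g => (2⁻¹ : ℝ≥0∞) • Measure.dirac (A θ g) +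
        (2⁻¹ : ℝ≥0∞) • Measure.dirac (B θ g) := by
      refine Measure.measurable_of_measurable_coe _ fun s hs => ?_
      simp only [Measure.add_apply, Measure.smul_apply, smul_eq_mul]
      exact ((hms _ (hA θ) s hs).const_mul _).add ((hms _ (hB θ) s hs).const_mul _)
    rw [truncSpectralMeasure, Measure.bind_congr_right (hκ θ hθ)]
    refine Measure.ext fun s hs => ?_
    rw [Measure.bind_apply hs hm.aemeasurable]
    simp only [Measure.add_apply, Measure.smul_apply, smul_eq_mul]
    rw [lintegral_add_left ((hms _ (hA θ) s hs).const_mul _),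
      lintegral_const_mul _ (hms _ (hA θ) s hs), lintegral_const_mul _ (hms _ (hB θ) s hs),
      ← Measure.bind_dirac_eq_map _ (hA θ), ← Measure.bind_dirac_eq_map _ (hB θ),
      Measure.bind_apply hs (f := fun g => Measure.dirac (A θ g))
        (Measure.measurable_dirac.comp (hA θ)).aemeasurable,
      Measure.bind_apply hs (f := fun g => Measure.dirac (B θ g))
        (Measure.measurable_dirac.comp (hB θ)).aemeasurable]
  have hfi : ∀ D : NetworkClass → ℝ, Measurable D →
      Integrable (fun g => f (D g)) (ρ : Measure NetworkClass) := fun D hD =>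
    Integrable.of_bound (f.continuous.measurable.comp hD).aestronglyMeasurable ‖f‖
      (ae_of_all _ fun g => f.norm_coe_le_norm _)
  have hint : ∀ θ, 0 < θ → ∫ x, f x ∂(truncSpectralMeasure ρ θ) =
      ∫ g, (f (A θ g) + f (B θ g)) / 2 ∂(ρ : Measure NetworkClass) := by
    intro θ hθ
    have h1 := Measure.isProbabilityMeasure_map (μ := (ρ : Measure NetworkClass))
      (hA θ).aemeasurable
    have h2 := Measure.isProbabilityMeasure_map (μ := (ρ : Measure NetworkClass))
      (hB θ).aemeasurable
    rw [hbind θ hθ, integral_half_add_half (f.integrable _) (f.integrable _),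
      integral_map (hA θ).aemeasurable f.continuous.aestronglyMeasurable,
      integral_map (hB θ).aemeasurable f.continuous.aestronglyMeasurable, integral_div,
      integral_add (hfi _ (hA θ)) (hfi _ (hB θ))]
  have hev : (fun θ => ∫ g, (f (A θ g) + f (B θ g)) / 2 ∂(ρ : Measure NetworkClass))
      =ᶠ[𝓝[>] 0] fun θ => ∫ x, f x ∂(truncSpectralMeasure ρ θ) := by
    filter_upwards [self_mem_nhdsWithin] with θ hθ
    exact (hint θ hθ).symm
  refine Tendsto.congr' hev (tendsto_integral_filter_of_dominated_convergence (fun _ => ‖f‖)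
    (Eventually.of_forall fun θ => (((f.continuous.measurable.comp (hA θ)).add
      (f.continuous.measurable.comp (hB θ))).div_const 2).aestronglyMeasurable)
    (Eventually.of_forall fun θ => ae_of_all _ fun g => ?_) (integrable_const _)
    (ae_of_all _ fun g => ?_))
  · have h1 := abs_le.1 (f.norm_coe_le_norm (A θ g))
    have h2 := abs_le.1 (f.norm_coe_le_norm (B θ g))
    rw [Real.norm_eq_abs, abs_le]
    constructor <;> linarith
  · exact (((f.continuous.tendsto _).comp (hA₀ g)).add
      ((f.continuous.tendsto _).comp (hB₀ g))).div_const 2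

/-! ### Soficity -/

theorem integral_uniformRoot {n : ℕ} [NeZero n] (H : Matrix (Fin n) (Fin n) ℂ)
    (hH : H.IsHermitian) (f : NetworkClass →ᵇ ℝ) :
    ∫ g, f g ∂(uniformRoot H hH : Measure NetworkClass) =
      (∑ v : Fin n, f (NetworkClass.mk ((matrixNetwork H hH).component v))) / n := by
  rw [uniformRoot, ProbabilityMeasure.coe_mk, integral_smul_measure,
    integral_finsetSum_measure fun v _ => f.integrable _]
  simp only [integral_dirac' _ _ f.continuous.measurable.stronglyMeasurable, smul_eq_mul,
    ENNReal.toReal_inv, ENNReal.toReal_natCast]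
  rw [div_eq_inv_mul]

/-- The network with one vertex and a loop of weight `d`. -/
abbrev singleNetwork (d : ℝ) : Network where
  V := Unit
  countable := inferInstance
  ω := fun _ _ => d
  hermitian := fun _ _ => by simp
  locallyFinite := fun _ => Summable.of_finite

theorem mk_component_single (d : ℝ) :
    NetworkClass.mk ((singleNetwork d).component ()) = pairClass d 0 := by
  refine Quotient.sound (Network.iso_component (M := singleNetwork d) (N := pairNetwork d 0)
    (fun _ => true) (fun _ _ _ => rfl) (fun _ _ => rfl) (fun _ v hv => ?_) ())
  cases v
  · rfl
  · exact absurd ⟨(), rfl⟩ hv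

/-- The loop of weight `|x|`. -/
def loopMap : C(ℝ, NetworkClass) :=
  ⟨fun x => pairClass |x| 0, continuous_pairClass.comp (f := fun x : ℝ => (|x|, (0 : ℂ)))
    (by fun_prop)⟩

/-- The edge of weight `s |x|`. -/
def edgeMap (s : ℂ) : C(ℝ, NetworkClass) :=
  ⟨fun x => pairClass 0 (s * (|x| : ℝ)),
    continuous_pairClass.comp (f := fun x : ℝ => ((0 : ℝ), s * ((|x| : ℝ) : ℂ))) (by fun_prop)⟩

/-- Take diagonal matrices of absolute midpoint quantiles. Every index is its own component, so
`U(H)` is the image under `loopMap` of an empirical measure converging to `ν`. -/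
theorem isAdmissibleSofic_loop (Sa : Set ℂ) (ν : ProbabilityMeasure ℝ) :
    IsAdmissibleSofic Sa {1} (mixLaw ν loopMap loopMap) := by
  let c : ℕ → ℕ → ℝ := fun m k => |quantile ν ((k + 1 / 2) / (m + 1 : ℕ))|
  let H : ∀ m : ℕ, Matrix (Fin (m + 1)) (Fin (m + 1)) ℂ := fun m =>
    Matrix.diagonal fun v => ((c m v : ℝ) : ℂ)
  have hH : ∀ m, (H m).IsHermitian := fun m =>
    Matrix.isHermitian_diagonal_of_self_adjoint _ (by ext v; simp)
  have hclass : ∀ m v, NetworkClass.mk ((matrixNetwork (H m) (hH m)).component v) =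
      pairClass (c m v) 0 := by
    intro m v
    rw [← mk_component_single]
    refine (Quotient.sound (Network.iso_component (M := singleNetwork (c m v))
      (N := matrixNetwork (H m) (hH m)) (fun _ => v) (fun _ _ _ => rfl) (fun _ _ => ?_)
      (fun _ w hw => ?_) ())).symm
    · exact Matrix.diagonal_apply_eq _ _
    · exact Matrix.diagonal_apply_ne _ fun h => hw ⟨(), h⟩
  refine ⟨H, hH, fun m => ⟨fun i j hij => Or.inl (Matrix.diagonal_apply_ne _ hij.ne),
    fun i => ?_⟩, ?_⟩
  · have hi : H m i i = ((c m i : ℝ) : ℂ) := Matrix.diagonal_apply_eq _ _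
    rw [hi, Complex.norm_real, Real.norm_eq_abs, abs_of_nonneg (abs_nonneg _)]
    by_cases h : ((c m i : ℝ) : ℂ) = 0
    · exact Or.inl h
    · exact Or.inr (div_self h)
  · rw [ProbabilityMeasure.tendsto_iff_forall_integral_tendsto]
    intro f
    rw [integral_mixLaw ν _ _ f.continuous.measurable f.norm_coe_le_norm, add_self_div_two]
    have h1 := (tendsto_average_quantile ν (f.compContinuous loopMap)).comp
      (tendsto_add_atTop_nat 1)
    refine h1.congr fun m => ?_
    rw [integral_uniformRoot]
    simp only [hclass]
    rw [Fin.sum_univ_eq_sum_range (fun k => f (pairClass (c m k) 0))]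
    rfl

/-- The matrix of size `n` pairing the indices `2 k` and `2 k + 1` by an edge of weight
`s c_k`. -/
def pairingMatrix (n : ℕ) (s : ℂ) (c : ℕ → ℝ) : Matrix (Fin n) (Fin n) ℂ := fun i j =>
  if i.1 / 2 = j.1 / 2 then
    if i < j then s * (c (i.1 / 2) : ℂ) else if j < i then star s * (c (i.1 / 2) : ℂ) else 0
  else 0

theorem pairingMatrix_isHermitian (n : ℕ) (s : ℂ) (c : ℕ → ℝ) :
    (pairingMatrix n s c).IsHermitian := by
  ext i j
  rw [Matrix.conjTranspose_apply]
  unfold pairingMatrix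
  by_cases h : i.1 / 2 = j.1 / 2
  · rcases lt_trichotomy i j with hij | hij | hij
    · simp [h, hij, hij.not_gt]
    · simp [hij]
    · simp [h, hij, hij.not_gt]
  · simp [h, Ne.symm h]

/-- The class depends on the root: the smaller index sees the phase `s`, the larger one its
conjugate. Hence the mixture of two laws in the limit. -/
theorem mk_component_pairing_even {n : ℕ} (s : ℂ) (c : ℕ → ℝ) {k : ℕ} (hk : 2 * k + 1 < n) :
    NetworkClass.mk ((matrixNetwork (pairingMatrix n s c)
      (pairingMatrix_isHermitian n s c)).component ⟨2 * k, by omega⟩) = pairClass 0 (s * c k) := by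
  have h0 : 2 * k / 2 = k := by omega
  have h1 : (2 * k + 1) / 2 = k := by omega
  refine (Quotient.sound (Network.iso_component (M := pairNetwork 0 (s * c k))
    (N := matrixNetwork (pairingMatrix n s c) (pairingMatrix_isHermitian n s c))
    (fun x => if x then ⟨2 * k, by omega⟩ else ⟨2 * k + 1, hk⟩) (fun x y hxy => ?_)
    (fun x y => ?_) (fun x w hw => ?_) true)).symm
  · cases x <;> cases y <;> simp_all
  · cases x <;> cases y <;> simp [pairingMatrix, h0, h1]
  · have hw0 : w.1 ≠ 2 * k := fun h => hw ⟨true, Fin.ext h.symm⟩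
    have hw1 : w.1 ≠ 2 * k + 1 := fun h => hw ⟨false, Fin.ext h.symm⟩
    have : k ≠ w.1 / 2 := by omega
    cases x <;> simp [pairingMatrix, h0, h1, this]

theorem mk_component_pairing_odd {n : ℕ} (s : ℂ) (c : ℕ → ℝ) {k : ℕ} (hk : 2 * k + 1 < n) :
    NetworkClass.mk ((matrixNetwork (pairingMatrix n s c)
      (pairingMatrix_isHermitian n s c)).component ⟨2 * k + 1, hk⟩) =
        pairClass 0 (star s * c k) := by
  have h0 : 2 * k / 2 = k := by omega
  have h1 : (2 * k + 1) / 2 = k := by omega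
  refine (Quotient.sound (Network.iso_component (M := pairNetwork 0 (star s * c k))
    (N := matrixNetwork (pairingMatrix n s c) (pairingMatrix_isHermitian n s c))
    (fun x => if x then ⟨2 * k + 1, hk⟩ else ⟨2 * k, by omega⟩) (fun x y hxy => ?_)
    (fun x y => ?_) (fun x w hw => ?_) true)).symm
  · cases x <;> cases y <;> simp_all
  · cases x <;> cases y <;> simp [pairingMatrix, h0, h1]
  · have hw0 : w.1 ≠ 2 * k := fun h => hw ⟨false, Fin.ext h.symm⟩
    have hw1 : w.1 ≠ 2 * k + 1 := fun h => hw ⟨true, Fin.ext h.symm⟩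
    have : k ≠ w.1 / 2 := by omega
    cases x <;> simp [pairingMatrix, h0, h1, this]

theorem sum_range_two_mul (F : ℕ → ℝ) (K : ℕ) :
    ∑ i ∈ Finset.range (2 * K), F i = ∑ k ∈ Finset.range K, (F (2 * k) + F (2 * k + 1)) := by
  induction K with
  | zero => simp
  | succ K ih =>
    rw [Finset.sum_range_succ, ← ih, show 2 * (K + 1) = 2 * K + 1 + 1 by ring,
      Finset.sum_range_succ, Finset.sum_range_succ, add_assoc]

/-- Averages over `m + 1` terms from averages over `⌊(m + 1) / 2⌋` consecutive pairs. -/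
theorem tendsto_average_of_pairs {F : ℕ → ℕ → ℝ} {C L : ℝ} (hF : ∀ m i, |F m i| ≤ C)
    (h : Tendsto (fun m : ℕ => (∑ k ∈ Finset.range ((m + 1) / 2),
      (F m (2 * k) + F m (2 * k + 1))) / ((m + 1) / 2 : ℕ)) atTop (𝓝 L)) :
    Tendsto (fun m : ℕ => (∑ i ∈ Finset.range (m + 1), F m i) / (m + 1 : ℕ)) atTop
      (𝓝 (L / 2)) := by
  have hinv : Tendsto (fun m : ℕ => 1 / ((m + 1 : ℕ) : ℝ)) atTop (𝓝 0) :=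
    (tendsto_const_div_atTop_nhds_zero_nat 1).comp (tendsto_add_atTop_nat 1)
  have hmod : ∀ m : ℕ, m + 1 = 2 * ((m + 1) / 2) + (m + 1) % 2 := fun m => by omega
  have hratio : Tendsto (fun m : ℕ => (((m + 1) / 2 : ℕ) : ℝ) / ((m + 1 : ℕ) : ℝ)) atTop
      (𝓝 (1 / 2)) := by
    have hr : Tendsto (fun m : ℕ => (((m + 1) % 2 : ℕ) : ℝ) / ((m + 1 : ℕ) : ℝ)) atTop (𝓝 0) := by
      refine squeeze_zero (fun m => by positivity) (fun m => ?_) hinv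
      gcongr
      exact_mod_cast Nat.lt_succ_iff.1 (Nat.mod_lt _ two_pos)
    have h2 := (tendsto_const_nhds (x := (1 : ℝ))).sub hr |>.div_const 2
    rw [sub_zero] at h2
    refine h2.congr fun m => ?_
    have hpos : ((m + 1 : ℕ) : ℝ) ≠ 0 := by positivity
    have hm : ((m + 1 : ℕ) : ℝ) = 2 * ((m + 1) / 2 : ℕ) + ((m + 1) % 2 : ℕ) := by
      exact_mod_cast hmod m
    field_simp
    linarith
  -- At most one index is left unpaired, and its share of the average vanishes.
  have hrem : Tendsto (fun m : ℕ => (∑ i ∈ Finset.range ((m + 1) % 2),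
      F m (2 * ((m + 1) / 2) + i)) / ((m + 1 : ℕ) : ℝ)) atTop (𝓝 0) := by
    refine squeeze_zero_norm (a := fun m : ℕ => C * (1 / ((m + 1 : ℕ) : ℝ))) (fun m => ?_)
      (by simpa using hinv.const_mul C)
    rw [norm_div, Real.norm_natCast, div_eq_mul_one_div]
    refine mul_le_mul_of_nonneg_right ?_ (by positivity)
    have hC : 0 ≤ C := (abs_nonneg _).trans (hF 0 0)
    refine (norm_sum_le_of_le _ fun i _ => hF m _).trans ?_
    rw [Finset.sum_const, Finset.card_range, nsmul_eq_mul]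
    refine mul_le_of_le_one_left hC ?_
    exact_mod_cast Nat.lt_succ_iff.1 (Nat.mod_lt _ two_pos)
  have hmain := (hratio.mul h).add hrem
  rw [show 1 / 2 * L + 0 = L / 2 by ring] at hmain
  refine hmain.congr' ?_
  filter_upwards [eventually_ge_atTop 1] with m hm
  have hK : (((m + 1) / 2 : ℕ) : ℝ) ≠ 0 := by
    have : (m + 1) / 2 ≠ 0 := by omega
    exact_mod_cast this
  have hsum : ∑ i ∈ Finset.range (m + 1), F m i =
      ∑ k ∈ Finset.range ((m + 1) / 2), (F m (2 * k) + F m (2 * k + 1)) +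
        ∑ i ∈ Finset.range ((m + 1) % 2), F m (2 * ((m + 1) / 2) + i) := by
    rw [← sum_range_two_mul, ← Finset.sum_range_add, ← hmod]
  rw [hsum, add_div]
  congr 1
  field_simp

theorem isAdmissibleSofic_edge {Sa Sb : Set ℂ} {s : ℂ} (hs : s ∈ Sa) (hs1 : ‖s‖ = 1)
    (ν : ProbabilityMeasure ℝ) :
    IsAdmissibleSofic Sa Sb (mixLaw ν (edgeMap s) (edgeMap (star s))) := by
  -- The midpoints are those of the `(m + 1) / 2` full pairs; in odd size the last index has no
  -- partner.
  let c : ℕ → ℕ → ℝ := fun m k => |quantile ν ((k + 1 / 2) / ((m + 1) / 2 : ℕ))|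
  refine ⟨fun m => pairingMatrix (m + 1) s (c m), fun m => pairingMatrix_isHermitian _ _ _,
    fun m => ⟨fun i j hij => ?_, fun i => Or.inl (by simp [pairingMatrix])⟩, ?_⟩
  · change pairingMatrix (m + 1) s (c m) i j = 0 ∨
      pairingMatrix (m + 1) s (c m) i j / (‖pairingMatrix (m + 1) s (c m) i j‖ : ℂ) ∈ Sa
    by_cases h : i.1 / 2 = j.1 / 2
    · have he : pairingMatrix (m + 1) s (c m) i j = s * (c m (i.1 / 2) : ℂ) := by
        simp [pairingMatrix, h, hij]
      rw [he, norm_mul, hs1, one_mul, Complex.norm_real, Real.norm_eq_abs,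
        abs_of_nonneg (abs_nonneg _)]
      by_cases hc : ((c m (i.1 / 2) : ℝ) : ℂ) = 0
      · exact Or.inl (by rw [hc, mul_zero])
      · exact Or.inr (by rwa [mul_div_cancel_right₀ _ hc])
    · exact Or.inl (by simp [pairingMatrix, h])
  · rw [ProbabilityMeasure.tendsto_iff_forall_integral_tendsto]
    intro f
    rw [integral_mixLaw ν _ _ f.continuous.measurable f.norm_coe_le_norm]
    let F : ℕ → ℕ → ℝ := fun m i => if hi : i < m + 1 then
      f (NetworkClass.mk ((matrixNetwork (pairingMatrix (m + 1) s (c m))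
        (pairingMatrix_isHermitian _ _ _)).component ⟨i, hi⟩)) else 0
    have hF : ∀ m i, |F m i| ≤ ‖f‖ := by
      intro m i
      simp only [F]
      split_ifs
      · exact f.norm_coe_le_norm _
      · simp
    have hK : Tendsto (fun m : ℕ => (m + 1) / 2) atTop atTop :=
      tendsto_atTop.2 fun b => by
        filter_upwards [eventually_ge_atTop (2 * b)] with m hm
        omega
    have h1 := (tendsto_average_quantile ν
      (f.compContinuous (edgeMap s) + f.compContinuous (edgeMap (star s)))).comp hK
    have h2 := tendsto_average_of_pairs (F := F) (C := ‖f‖) (L := ∫ x, f (edgeMap s x) ∂(ν : Measure ℝ)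
      + ∫ x, f (edgeMap (star s) x) ∂(ν : Measure ℝ)) hF (by
        have hadd := integral_add ((f.compContinuous (edgeMap s)).integrable (ν : Measure ℝ))
          ((f.compContinuous (edgeMap (star s))).integrable (ν : Measure ℝ))
        rw [show ∫ x, f (edgeMap s x) ∂(ν : Measure ℝ) + ∫ x, f (edgeMap (star s) x) ∂(ν : Measure ℝ) =
          ∫ x, (f.compContinuous (edgeMap s) + f.compContinuous (edgeMap (star s))) x
            ∂(ν : Measure ℝ) from hadd.symm]
        refine h1.congr fun m => ?_
        refine congrArg (· / _) (Finset.sum_congr rfl fun k hk => ?_)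
        have hk' : 2 * k + 1 < m + 1 := by
          have := Finset.mem_range.1 hk
          omega
        simp only [F]
        rw [dif_pos hk', dif_pos (by omega : 2 * k < m + 1), mk_component_pairing_odd s (c m) hk',
          mk_component_pairing_even s (c m) hk']
        rfl)
    refine h2.congr fun m => ?_
    rw [integral_uniformRoot, ← Fin.sum_univ_eq_sum_range]
    congr 1
    refine Finset.sum_congr rfl fun v _ => ?_
    simp only [F]
    rw [dif_pos v.2]

/-! ### Upper bounds for the rate function -/

variable {α : ℝ} {a b : ℝ≥0∞} {Sa Sb : Set ℂ} {ν : ProbabilityMeasure ℝ}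

theorem measurable_ofReal_abs_rpow (α : ℝ) : Measurable fun x : ℝ => ENNReal.ofReal (|x| ^ α) := by
  fun_prop

/-- Finite `𝔼 ψ_α` and `𝔼 φ_α` give a finite moment of order `α`, so the convergence of the
truncations identifies `μ_ρ` and `ρ` is a competitor. -/
theorem ratePhi_le {ρ : ProbabilityMeasure NetworkClass} (hα : 0 < α) (hα2 : α < 2)
    (hρ : IsAdmissibleSofic Sa Sb ρ)
    (hpsi : ∫⁻ g, g.psi α ∂(ρ : Measure NetworkClass) ≠ ∞)
    (hphi : ∫⁻ g, g.phi α ∂(ρ : Measure NetworkClass) ≠ ∞)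
    (hlim : ∀ f : ℝ →ᵇ ℝ, Tendsto (fun θ : ℝ => ∫ x, f x ∂(truncSpectralMeasure ρ θ)) (𝓝[>] 0)
      (𝓝 (∫ x, f x ∂(ν : Measure ℝ)))) :
    ratePhi α a b Sa Sb ν ≤ b * ∫⁻ g, g.psi α ∂(ρ : Measure NetworkClass) +
      a * ∫⁻ g, g.phi α ∂(ρ : Measure NetworkClass) := by
  have hfin : HasFiniteMoment ρ := by
    refine ⟨α, hα, hα2, ?_⟩
    rw [lintegral_xi_eq hα]
    finiteness
  refine (iInf₂_le ρ ⟨hρ, fun _ => hlim, fun h => absurd hfin h⟩).trans_eq ?_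
  rw [rateI, if_pos hρ]

theorem ratePhi_le_of_nonneg (hα : 0 < α) (hα2 : α < 2) (hb : 0 < b)
    (hν : (ν : Measure ℝ).support ⊆ Set.Ici 0) :
    ratePhi α a b Sa {1} ν ≤ b * absMoment α ν := by
  by_cases hM : absMoment α ν = ∞
  · rw [hM, ENNReal.mul_top hb.ne']
    exact le_top
  have hpsi : ∫⁻ g, g.psi α ∂(mixLaw ν loopMap loopMap : Measure NetworkClass) =
      absMoment α ν := by
    rw [lintegral_mixLaw _ _ _ (NetworkClass.measurable_psi α), ← add_mul,
      ENNReal.inv_two_add_inv_two, one_mul]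
    refine lintegral_congr fun x => ?_
    change (pairClass |x| 0).psi α = _
    rw [psi_pairClass, abs_abs]
  have hphi : ∫⁻ g, g.phi α ∂(mixLaw ν loopMap loopMap : Measure NetworkClass) = 0 := by
    rw [lintegral_mixLaw _ _ _ (NetworkClass.measurable_phi hα), ← add_mul,
      ENNReal.inv_two_add_inv_two, one_mul]
    have : ∀ x, (loopMap x).phi α = 0 := fun x => phi_pairClass_loop α |x|
    simp [this]
  have h := ratePhi_le (a := a) (b := b) hα hα2 (isAdmissibleSofic_loop Sa ν) (ν := ν)
    (by rwa [hpsi]) (by simp [hphi]) fun f => by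
      -- The single atom of a loop is treated as two coinciding half atoms.
      have h1 := tendsto_integral_truncSpectralMeasure (ρ := mixLaw ν loopMap loopMap)
        NetworkClass.measurable_truncLoop NetworkClass.measurable_truncLoop (fun θ hθ => by
          filter_upwards [ae_mixLaw ν loopMap loopMap NetworkClass.measurableSet_isLoop
            (fun x => isLoop_pairClass |x|) fun x => isLoop_pairClass |x|] with g hg
          rw [hg.spectralMeasure_trunc hθ, ← add_smul, ENNReal.inv_two_add_inv_two, one_smul])
        NetworkClass.tendsto_truncLoop NetworkClass.tendsto_truncLoop f
      have hm : Measurable fun g : NetworkClass => f g.rootLoop.re :=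
        f.continuous.measurable.comp
          (Complex.measurable_re.comp NetworkClass.continuous_rootLoop.measurable)
      simp only [add_self_div_two] at h1
      rw [integral_mixLaw ν _ _ hm fun g => f.norm_coe_le_norm _, add_self_div_two] at h1
      have h2 : ∫ x, f x ∂(ν : Measure ℝ) = ∫ x, f (loopMap x).rootLoop.re ∂(ν : Measure ℝ) := by
        refine integral_congr_ae ?_
        -- The loops carry `|x|`, which is `x` for almost every `x` because the support is
        -- nonnegative.
        filter_upwards [Measure.support_mem_ae (μ := (ν : Measure ℝ))] with x hx
        change f x = f ((|x| : ℝ) : ℂ).re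
        rw [Complex.ofReal_re, abs_of_nonneg (hν hx)]
      rwa [h2]
  rwa [hpsi, hphi, mul_zero, add_zero] at h

theorem ratePhi_le_of_symmetric (hα : 0 < α) (hα2 : α < 2) (ha : 0 < a) {s : ℂ} (hs : s ∈ Sa)
    (hs1 : ‖s‖ = 1) (hν : (ν : Measure ℝ).map (fun x => -x) = (ν : Measure ℝ)) :
    ratePhi α a b Sa Sb ν ≤ a / 2 * absMoment α ν := by
  by_cases hM : absMoment α ν = ∞
  · rw [hM, ENNReal.mul_top (ENNReal.div_pos ha.ne' ENNReal.ofNat_ne_top).ne']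
    exact le_top
  have hs1' : ‖star s‖ = 1 := by rw [norm_star, hs1]
  set ρ := mixLaw ν (edgeMap s) (edgeMap (star s)) with hρ
  have hpsi : ∫⁻ g, g.psi α ∂(ρ : Measure NetworkClass) = 0 := by
    rw [hρ, lintegral_mixLaw _ _ _ (NetworkClass.measurable_psi α)]
    have : ∀ z x, (edgeMap z x).psi α = 0 := fun z x => by
      refine (psi_pairClass α 0 _).trans ?_
      simp [hα.ne']
    simp [this]
  have hnorm : ∀ z : ℂ, ‖z‖ = 1 → ∀ x : ℝ, ‖z * ((|x| : ℝ) : ℂ)‖ = |x| := fun z hz x => by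
    rw [norm_mul, hz, one_mul, Complex.norm_real, Real.norm_eq_abs, abs_abs]
  have hphi : ∫⁻ g, g.phi α ∂(ρ : Measure NetworkClass) ≤ 2⁻¹ * absMoment α ν := by
    have h1 : ∀ z : ℂ, ‖z‖ = 1 → ∫⁻ x, (edgeMap z x).phi α ∂(ν : Measure ℝ) ≤
        2⁻¹ * absMoment α ν := fun z hz => by
      rw [absMoment, ← lintegral_const_mul _ (measurable_ofReal_abs_rpow α)]
      refine lintegral_mono fun x => (phi_pairClass_le hα _).trans_eq ?_
      rw [hnorm z hz]
    rw [hρ, lintegral_mixLaw _ _ _ (NetworkClass.measurable_phi hα)]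
    refine (add_le_add (mul_le_mul_right (h1 s hs1) _) (mul_le_mul_right (h1 _ hs1') _)).trans_eq ?_
    rw [← add_mul, ENNReal.inv_two_add_inv_two, one_mul]
  have h := ratePhi_le (a := a) (b := b) hα hα2
    (isAdmissibleSofic_edge (Sb := Sb) hs hs1 ν) (ν := ν) (by rw [← hρ, hpsi]; exact ENNReal.zero_ne_top)
    (ne_top_of_le_ne_top (by finiteness) hphi) fun f => by
      rw [← hρ]
      have h1 := tendsto_integral_truncSpectralMeasure (ρ := ρ)
        NetworkClass.measurable_truncEdge (fun θ => (NetworkClass.measurable_truncEdge θ).neg)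
        (fun θ hθ => by
          filter_upwards [ae_mixLaw ν (edgeMap s) (edgeMap (star s))
            NetworkClass.measurableSet_isEdge (fun x => isEdge_pairClass _)
            fun x => isEdge_pairClass _] with g hg
          exact hg.spectralMeasure_trunc hθ)
        NetworkClass.tendsto_truncEdge (fun g => (NetworkClass.tendsto_truncEdge g).neg) f
      have hx : Measurable (NetworkClass.xi 2) := NetworkClass.measurable_xi two_pos
      have hfc := f.continuous.measurable
      have hm : Measurable fun g : NetworkClass =>
          (f √(g.xi 2).toReal + f (-√(g.xi 2).toReal)) / 2 := by fun_prop
      have hbd : ∀ y : ℝ, |(f y + f (-y)) / 2| ≤ ‖f‖ := fun y => by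
        have h1 := abs_le.1 (f.norm_coe_le_norm y)
        have h2 := abs_le.1 (f.norm_coe_le_norm (-y))
        rw [abs_le]
        constructor <;> linarith
      have hedge : ∀ z : ℂ, ‖z‖ = 1 →
          ∫ x, (f √((edgeMap z x).xi 2).toReal + f (-√((edgeMap z x).xi 2).toReal)) / 2
            ∂(ν : Measure ℝ) = ∫ x, f x ∂(ν : Measure ℝ) := fun z hz => by
        have h2 : ∀ x, (f √((edgeMap z x).xi 2).toReal + f (-√((edgeMap z x).xi 2).toReal)) / 2 =
            (f x + f (-x)) / 2 := fun x => by
          have : √((edgeMap z x).xi 2).toReal = |x| := by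
            change √((pairClass 0 (z * ((|x| : ℝ) : ℂ))).xi 2).toReal = |x|
            rw [xi_two_pairClass, hnorm z hz, Real.sqrt_sq (abs_nonneg _)]
          rw [this]
          -- The atoms `±|x|` are `±x` in some order, and symmetry of `ν` then averages `f (x)` and
          -- `f (-x)` to the integral of `f`.
          rcases abs_choice x with h | h <;> rw [h]
          rw [neg_neg, add_comm]
        have h3 : ∫ x, f (-x) ∂(ν : Measure ℝ) = ∫ x, f x ∂(ν : Measure ℝ) := by
          conv_rhs => rw [← hν]
          exact (integral_map measurable_neg.aemeasurable
            f.continuous.aestronglyMeasurable).symm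
        simp only [h2]
        have hi : Integrable (fun x => f (-x)) (ν : Measure ℝ) := Integrable.of_bound
          (f.continuous.measurable.comp measurable_neg).aestronglyMeasurable ‖f‖
          (ae_of_all _ fun x => f.norm_coe_le_norm _)
        rw [integral_div, integral_add (f.integrable _) hi, h3, add_self_div_two]
      rwa [hρ, integral_mixLaw ν _ _ hm fun g => hbd _, hedge s hs1, hedge _ hs1',
        add_self_div_two] at h1
  rw [← hρ, hpsi, mul_zero, zero_add] at h
  refine h.trans ((mul_le_mul_right hphi _).trans_eq ?_)
  rw [← mul_assoc, div_eq_mul_inv]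

end WignerLDP

end

theorem theorem1p3
    {Ω : Type*} [MeasurableSpace Ω] (P : Measure Ω) [IsProbabilityMeasure P]
    (X₁₂ : Ω → ℂ) (X₁₁ : Ω → ℝ) (hX₁₂ : Measurable X₁₂) (hX₁₁ : Measurable X₁₁)
    (α : ℝ) (hα₀ : 0 < α) (hα₂ : α < 2)
    (a b : ℝ≥0∞) (ha : 0 < a) (hb : 0 < b)
    (ϑa ϑb : Measure (Metric.sphere (0 : ℂ) 1)) [IsProbabilityMeasure ϑa] [IsProbabilityMeasure ϑb]
    (h₁₂ : WignerLDP.InTailClass P X₁₂ α a ϑa)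
    (h₁₁ : WignerLDP.InTailClass P (fun x => (X₁₁ x : ℂ)) α b ϑb)
    (hϑb : WignerLDP.phaseSupport ϑb = {1}) :
    -- (a)
    (∀ ν : ProbabilityMeasure ℝ, (ν : Measure ℝ).support ⊆ Set.Ici 0 →
      WignerLDP.ratePhi α a b (WignerLDP.phaseSupport ϑa) (WignerLDP.phaseSupport ϑb) ν
        ≤ b * WignerLDP.absMoment α ν) ∧
    -- (b)
    (1 < α → ∀ ν : ProbabilityMeasure ℝ,
      (ν : Measure ℝ).map (fun x => -x) = (ν : Measure ℝ) →
      WignerLDP.ratePhi α a b (WignerLDP.phaseSupport ϑa) (WignerLDP.phaseSupport ϑb) ν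
        = a / 2 * WignerLDP.absMoment α ν) ∧
    -- (c): the positive part of `ν` has a smaller integral than the negative part
    (1 < α → ∀ ν : ProbabilityMeasure ℝ,
      ∫⁻ x, ENNReal.ofReal x ∂(ν : Measure ℝ) < ∫⁻ x, ENNReal.ofReal (-x) ∂(ν : Measure ℝ) →
      WignerLDP.ratePhi α a b (WignerLDP.phaseSupport ϑa) (WignerLDP.phaseSupport ϑb) ν = ∞) := by
  -- The pairing construction needs one admissible phase; a nonzero measure on the circle has
  -- nonempty support.
  obtain ⟨s, hs⟩ := Measure.nonempty_support (IsProbabilityMeasure.ne_zero ϑa)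
  have hsa : (s : ℂ) ∈ WignerLDP.phaseSupport ϑa := ⟨s, hs, rfl⟩
  have hs1 : ‖(s : ℂ)‖ = 1 := by simp
  rw [hϑb]
  exact ⟨fun ν hν => WignerLDP.ratePhi_le_of_nonneg hα₀ hα₂ hb hν,
    fun hα ν hν => le_antisymm (WignerLDP.ratePhi_le_of_symmetric hα₀ hα₂ ha hsa hs1 hν)
      (WignerLDP.le_ratePhi_of_symmetric hα hα₂ ha hb hν),
    fun hα ν hν => WignerLDP.ratePhi_eq_top_of_neg hα hα₂ ha hb hν⟩
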